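/- **Setting.** Let $s\in\mathbb{N}$ and let $\alpha=(\alpha_w)_{w\ge 1}$, $\beta=(\beta_w)_{w\ge 1}$ be finitely supported sequences of natural numbers with $s-\sum_w w\,\alpha_w+\sum_w w\,\beta_w=0$. Let $\Delta=\Delta^3_{s}(\alpha,\beta)$ be the labeled multiset in $\mathbb{Z}^3$ consisting of $s$ copies of each of $(1,1,1),(-1,0,0),(0,-1,0)$, of $\alpha_w$ copies of $(0,0,-w)$ and of $\beta_w$ copies of $(0,0,w)$ for $w\geq 1$ (the degree of a floor). Let $\mathcal{M}_{0,1}(\mathbb{R}^3,\Delta)\cong\mathcal{M}_{0,1+\#\Delta}\times\mathbb{R}^3$ be the moduli space of rational tropical stable maps to $\mathbb{R}^3$ of degree $\Delta$ with one contracted end $x_0$, viewed as a tropical cycle with all weights $1$ and with cells given by combinatorial types. An end is *vertical* if its primitive direction is $(0,0,\pm 1)$. Let $\pi:\mathbb{R}^3\to\mathbb{R}^2$ forget the last coordinate, let $\operatorname{ev}$ be the evaluation at $x_0$, for a vertical end $k$ let $\partial\operatorname{ev}_k$ send a stable map to the point to which $\pi$ contracts the end $k$, and for four distinct labels $\lambda$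 let $\operatorname{ft}_\lambda$ be the forgetful map to $\mathcal{M}_{0,4}$, whose vertex is denoted by $0$. The standard directions of $\mathbb{R}^2$ are $(1,1),(-1,0),(0,-1)$. **Conditions.** Let $p\in\mathbb{R}^3$, let $\eta,\kappa$ be disjoint sets of vertical ends, let $P_f\in\mathbb{R}^2$ for $f\in\eta$, let $L_k$ for $k\in\kappa$ be plane tropical curves all of whose ends have standard direction (for example tropical multi lines), and let $\lambda_1,\dots,\lambda_l$ be degenerated tropical cross-ratios, i.e. sets of four distinct labels, each of which is $x_0$ or a vertical end. Let $q$ be a vertical end and suppose that the intersection product $$Y_q:=\prod_{k\in\kappa}\partial\operatorname{ev}_k^*(L_k)\cdot\prod_{f\in\eta}\partial\operatorname{ev}_f^*(P_f)\cdot\prod_{j=1}^{l}\operatorname{ft}_{\lambda_j}^*(0)\cdot\operatorname{ev}^*(p)\cdot\mathcal{M}_{0,1}(\mathbb{R}^3,\Delta)$$ is of dimension one, i.e. $\#\Delta=3+2\,\#\eta+\#\kappa+l$. (The conditions may be in any position, in particular in general position.) **Claim.** 1. Every end of the recession fan of the push-forward $(\partial\operatorname{ev}_q)_*(Y_q)$,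 a one-dimensional tropical cycle in $\mathbb{R}^2$, has standard direction. 2. Let $\sigma$ be an unbounded cell of $Y_q$ (a one-dimensional cell of nonzero weight) that is mapped by $\partial\operatorname{ev}_q$ to an end of the recession fan of $(\partial\operatorname{ev}_q)_*(Y_q)$, and let $C_\sigma$ be a stable map in the relative interior of $\sigma$. Then the vertex of $C_\sigma$ adjacent to $q$ is $3$-valent and is adjacent to another end $E\neq q$ such that $\pi(E)\subset\mathbb{R}^2$ is an end of standard direction. -/

import Mathlib

noncomputable section

namespace TropicalFloor

/-! ## Tropical cycles -/

section Cycles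

variable {V : Type*} [AddCommGroup V] [Module ℝ V] [TopologicalSpace V]
variable {V' : Type*} [AddCommGroup V'] [Module ℝ V'] [TopologicalSpace V']

/-- A polyhedron whose facet normals are integral with respect to the lattice `Γ`: a finite
intersection of closed half spaces `a x ≤ b` with `a(Γ) ⊆ ℤ` and `b` real. -/
def IsRationalPolyhedron (Γ : AddSubgroup V) (P : Set V) : Prop :=
  ∃ S : Finset ((V →ₗ[ℝ] ℝ) × ℝ),
    (∀ a ∈ S, ∀ g ∈ Γ, ∃ m : ℤ, a.1 g = m) ∧ P = {x | ∀ a ∈ S, a.1 x ≤ a.2}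

/-- The dimension of a polyhedron. -/
def polyDim (P : Set V) : ℕ := Module.finrank ℝ (vectorSpan ℝ P)

/-- The lattice `Γ_σ` of the lattice vectors parallel to `σ`. -/
def cellLattice (Γ : AddSubgroup V) (σ : Set V) : AddSubgroup V :=
  Γ ⊓ (vectorSpan ℝ σ).toAddSubgroup

/-- `u` represents the normal vector of `σ` relative to its codimension one face `τ`:
it generates `Γ_σ / Γ_τ` and points from `τ` into `σ`. -/
def IsNormalVector (Γ : AddSubgroup V) (σ τ : Set V) (u : V) : Prop :=
  u ∈ cellLattice Γ σ ∧
  (∀ g ∈ cellLattice Γ σ, ∃ m : ℤ, g - m • u ∈ cellLattice Γ τ) ∧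
  ∃ x ∈ τ, ∃ ε : ℝ, 0 < ε ∧ x + ε • u ∈ σ

open scoped Classical in
/-- A weighted balanced rational polyhedral complex, i.e. a representative of a tropical cycle
(weights of cells which are not of top dimension carry no meaning, weight zero is allowed). -/
structure TropicalCycle (Γ : AddSubgroup V) where
  dim : ℕ
  cells : Finset (Set V)
  weight : Set V → ℤ
  nonempty : ∀ σ ∈ cells, σ.Nonempty
  polyhedron : ∀ σ ∈ cells, IsRationalPolyhedron Γ σ
  face_mem : ∀ σ ∈ cells, ∀ τ : Set V, τ.Nonempty → IsExposed ℝ σ τ → τ ∈ cells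
  inter_face : ∀ σ ∈ cells, ∀ τ ∈ cells, IsExposed ℝ σ (σ ∩ τ)
  pure : ∀ σ ∈ cells, ∃ ρ ∈ cells, σ ⊆ ρ ∧ polyDim ρ = dim
  balanced : ∀ τ ∈ cells, polyDim τ + 1 = dim → ∀ u : Set V → V,
    (∀ σ ∈ cells, polyDim σ = dim → τ ⊆ σ → IsNormalVector Γ σ τ (u σ)) →
    ∑ σ ∈ cells with polyDim σ = dim ∧ τ ⊆ σ, weight σ • u σ ∈ vectorSpan ℝ τ

variable {Γ : AddSubgroup V} {Γ' : AddSubgroup V'}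

open scoped Classical in
/-- The cells of top dimension. -/
def TropicalCycle.facets (X : TropicalCycle Γ) : Finset (Set V) :=
  X.cells.filter fun σ => polyDim σ = X.dim

/-- `X'` is a refinement of `X`. -/
def Refines (X' X : TropicalCycle Γ) : Prop :=
  X'.dim = X.dim ∧
  (⋃ σ ∈ X'.cells, σ) = (⋃ σ ∈ X.cells, σ) ∧
  (∀ σ' ∈ X'.cells, ∃ σ ∈ X.cells, σ' ⊆ σ) ∧
  ∀ σ' ∈ X'.facets, ∀ σ ∈ X.facets, σ' ⊆ σ → X'.weight σ' = X.weight σ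

open scoped Classical in
/-- `D` is the divisor of the piecewise affine linear function `φ` on `X`, where `φ` is affine on
every cell of `X`: the codimension one skeleton of `X` with the weights
`ω_φ(τ) = ∑ φ_σ(ω(σ) u_{σ/τ}) - φ_τ(∑ ω(σ) u_{σ/τ})`. Here `lin σ` is the linear part of `φ`
on `σ`. -/
def IsDivisor (φ : V → ℝ) (X D : TropicalCycle Γ) : Prop :=
  X.dim = D.dim + 1 ∧
  (∀ τ, τ ∈ D.cells ↔ τ ∈ X.cells ∧ polyDim τ ≤ D.dim) ∧
  ∃ (lin : Set V → (V →ₗ[ℝ] ℝ)) (c : Set V → ℝ),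
    (∀ σ ∈ X.cells, ∀ x ∈ σ, φ x = lin σ x + c σ) ∧
    ∀ τ ∈ D.facets, ∃ u : Set V → V,
      (∀ σ ∈ X.facets, τ ⊆ σ → IsNormalVector Γ σ τ (u σ)) ∧
      (D.weight τ : ℝ) = (∑ σ ∈ X.facets with τ ⊆ σ, lin σ (X.weight σ • u σ)) -
        lin τ (∑ σ ∈ X.facets with τ ⊆ σ, X.weight σ • u σ)

/-- `IsIntersectionProduct [φ₁, …, φᵣ] X Y`: `Y` represents the intersection product
`φᵣ ⋯ φ₁ · X`. As divisors are defined on refinements, any number of refinements is allowed. -/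
inductive IsIntersectionProduct :
    List (V → ℝ) → TropicalCycle Γ → TropicalCycle Γ → Prop
  | nil {X Y : TropicalCycle Γ} : Refines Y X → IsIntersectionProduct [] X Y
  | cons {φ : V → ℝ} {l : List (V → ℝ)} {X X' D Y : TropicalCycle Γ} :
      Refines X' X → IsDivisor φ X' D → IsIntersectionProduct l D Y →
      IsIntersectionProduct (φ :: l) X Y

open scoped Classical in
/-- `Z` is the push-forward of `Y` along the linear map `f`, where `Y` is fine enough for the
images of its cells to form a polyhedral complex. -/
def IsPushforward (f : V →ₗ[ℝ] V') (Y : TropicalCycle Γ) (Z : TropicalCycle Γ') : Prop :=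
  Z.dim = Y.dim ∧
  (∀ σ', σ' ∈ Z.cells ↔ ∃ σ ∈ Y.cells,
    (∃ ρ ∈ Y.facets, Y.weight ρ ≠ 0 ∧ σ ⊆ ρ ∧ Set.InjOn f ρ) ∧ σ' = f '' σ) ∧
  ∀ σ' ∈ Z.facets, Z.weight σ' = ∑ σ ∈ Y.facets with f '' σ = σ',
    Y.weight σ *
      (((cellLattice Γ σ).map f.toAddMonoidHom).relIndex (cellLattice Γ' σ') : ℤ)

/-- The recession cone of a polyhedron. -/
def recessionCone (P : Set V) : Set V :=
  {v | ∀ x ∈ P, ∀ t : ℝ, 0 ≤ t → x + t • v ∈ P}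

/-- `v` spans an end of the recession fan of the one-dimensional cycle `Z`; the cones of the
recession fan are the recession cones of the cells of nonzero weight. -/
def IsRecessionEnd (Z : TropicalCycle Γ) (v : V) : Prop :=
  v ≠ 0 ∧ ∃ σ ∈ Z.facets, Z.weight σ ≠ 0 ∧ v ∈ recessionCone σ

end Cycles

/-! ## Rational tropical stable maps to `ℝ³` -/

/-- An abstract rational tropical curve whose ends are labeled by `ι`: a metric tree with vertex
set `Fin n`, where the end with label `i` is attached to the vertex `attach i`. The values of
`length` away from the edges of the tree carry no meaning. -/
structure MarkedCurve (ι : Type*) where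
  n : ℕ
  graph : SimpleGraph (Fin n)
  isTree : graph.IsTree
  attach : ι → Fin n
  three_le_valence : ∀ v, 3 ≤ (graph.neighborSet v).ncard + (attach ⁻¹' {v}).ncard
  length : Sym2 (Fin n) → ℝ
  length_pos : ∀ e ∈ graph.edgeSet, 0 < length e

namespace MarkedCurve

variable {ι : Type*} (C : MarkedCurve ι)

/-- The number of edges (bounded edges and ends) at a vertex. -/
def valence (v : Fin C.n) : ℕ := (C.graph.neighborSet v).ncard + (C.attach ⁻¹' {v}).ncard

/-- The length of the path between two vertices. -/
def dist (v w : Fin C.n) : ℝ :=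
  (((C.isTree.existsUnique_path v w).choose.edges).map C.length).sum

/-- For pairwise different labels `c 0, …, c 3`: the coordinate of the image of the curve under
the forgetful map to `M_{0,4}`. It is `ℓ`, `-ℓ`, `0` for the point of `M_{0,4}` with bounded edge
of length `ℓ` and type `(c₀c₁|c₂c₃)`, `(c₀c₂|c₁c₃)`, `(c₀c₃|c₁c₂)`, respectively. -/
def crossRatio (c : Fin 4 ↪ ι) : ℝ :=
  (C.dist (C.attach (c 0)) (C.attach (c 2)) + C.dist (C.attach (c 1)) (C.attach (c 3))
    - C.dist (C.attach (c 0)) (C.attach (c 1)) - C.dist (C.attach (c 2)) (C.attach (c 3))) / 2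

/-- Two curves have the same combinatorial type. -/
def SameType (C C' : MarkedCurve ι) : Prop :=
  ∃ e : C.graph ≃g C'.graph, ∀ i, e (C.attach i) = C'.attach i

end MarkedCurve

open scoped Classical in
/-- A rational tropical stable map to `ℝ³` whose end with label `i` has direction vector `Δ i`
(zero for contracted ends). `slope v w` is the direction vector at `v` of the bounded edge from
`v` to `w`; its values on non-adjacent pairs carry no meaning. -/
structure StableMap {ι : Type*} [Fintype ι] (Δ : ι → Fin 3 → ℤ) extends MarkedCurve ι where
  pos : Fin n → Fin 3 → ℝ
  slope : Fin n → Fin n → Fin 3 → ℤ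
  affine : ∀ v w, graph.Adj v w →
    pos w = pos v + length s(v, w) • (fun j => (slope v w j : ℝ))
  balancing : ∀ v,
    ∑ w with graph.Adj v w, slope v w + ∑ i with attach i = v, Δ i = 0

/-- The projection `ℝ³ → ℝ²` that forgets the last coordinate. -/
def proj {R : Type*} (x : Fin 3 → R) : Fin 2 → R := fun j => x j.castSucc

/-- The ambient space of the moduli space. Its coordinates on a stable map are: all images under
forgetful maps to `M_{0,4}`, the position of the contracted end, and the positions of the
projections of the ends parallel to the last axis. -/
abbrev Ambient (ι : Type*) : Type _ :=
  ((Fin 4 ↪ ι) → ℝ) × (Fin 3 → ℝ) × (ι → Fin 2 → ℝ)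

section Moduli

variable {ι : Type*} [Fintype ι] {Δ : ι → Fin 3 → ℤ}

/-- The point of the embedded moduli space `M_{0,1}(ℝ³, Δ)` given by a stable map, where `x₀` is
the label of the contracted end. The last block of coordinates consists of linear functions of the
first two, so it does not change the fan structure of `M_{0,N} × ℝ³`. -/
def StableMap.toPoint (x₀ : ι) (C : StableMap Δ) : Ambient ι :=
  (fun c => C.crossRatio c, C.pos (C.attach x₀),
    fun k => if proj (Δ k) = 0 then proj (C.pos (C.attach k)) else 0)

/-- The lattice of the moduli space, generated by the stable maps with integral edge lengths and
integral vertices. -/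
def moduliLattice (Δ : ι → Fin 3 → ℤ) (x₀ : ι) : AddSubgroup (Ambient ι) :=
  AddSubgroup.closure {x | ∃ C : StableMap Δ,
    (∀ e ∈ C.graph.edgeSet, ∃ m : ℤ, C.length e = m) ∧
    (∀ v j, ∃ m : ℤ, C.pos v j = m) ∧ x = C.toPoint x₀}

/-- `M` is the tropical cycle `M_{0,1}(ℝ³, Δ)`, of dimension `N - 3 + 3` for `N` ends, subdivided
at least as finely as by combinatorial types, all weights being one. -/
def IsModuliSpace (Δ : ι → Fin 3 → ℤ) (x₀ : ι) (M : TropicalCycle (moduliLattice Δ x₀)) : Prop :=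
  M.dim = Fintype.card ι ∧
  (⋃ σ ∈ M.cells, σ) = Set.range (StableMap.toPoint x₀ : StableMap Δ → Ambient ι) ∧
  (∀ σ ∈ M.facets, M.weight σ = 1) ∧
  ∀ σ ∈ M.cells, ∀ C C' : StableMap Δ, C.toPoint x₀ ∈ intrinsicInterior ℝ σ →
    C'.toPoint x₀ ∈ intrinsicInterior ℝ σ → C.toMarkedCurve.SameType C'.toMarkedCurve

/-- The evaluation `∂ev_k`, the position in `ℝ²` of the projection of the end `k`. -/
def tangencyEv (k : ι) : Ambient ι →ₗ[ℝ] (Fin 2 → ℝ) :=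
  LinearMap.proj k ∘ₗ LinearMap.snd ℝ (Fin 3 → ℝ) (ι → Fin 2 → ℝ) ∘ₗ
    LinearMap.snd ℝ ((Fin 4 ↪ ι) → ℝ) ((Fin 3 → ℝ) × (ι → Fin 2 → ℝ))

end Moduli

/-! ## Degrees and conditions -/

/-- The degree `Δ³_s(α, β)`. -/
def floorDegree (s : ℕ) (α β : ℕ+ →₀ ℕ) : Multiset (Fin 3 → ℤ) :=
  Multiset.replicate s ![1, 1, 1] + Multiset.replicate s ![-1, 0, 0] +
    Multiset.replicate s ![0, -1, 0] +
    α.sum (fun w m => Multiset.replicate m ![0, 0, -((w : ℕ) : ℤ)]) +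
    β.sum (fun w m => Multiset.replicate m ![0, 0, ((w : ℕ) : ℤ)])

/-- The standard directions of `ℝ²`. -/
def standardDirections : Set (Fin 2 → ℤ) := {![1, 1], ![-1, 0], ![0, -1]}

/-- A plane tropical curve all of whose ends have standard direction, as the corner locus of a
tropical polynomial `max (a x + b y + coeff (a, b))` with Newton polygon the triangle with corners
`(0, 0)`, `(w, 0)`, `(0, w)`. If the corners are the only exponents, then this is a
multi line with ends of weight `w`, and each multi line arises so. -/
structure PlaneCurve where
  w : ℕ
  w_pos : 0 < w
  exponents : Finset (ℕ × ℕ)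
  coeff : ℕ × ℕ → ℝ
  zero_mem : (0, 0) ∈ exponents
  left_mem : (w, 0) ∈ exponents
  right_mem : (0, w) ∈ exponents
  le_w : ∀ a ∈ exponents, a.1 + a.2 ≤ w

/-- The tropical polynomial that cuts out the curve. -/
def PlaneCurve.poly (L : PlaneCurve) (x : Fin 2 → ℝ) : ℝ :=
  L.exponents.sup' ⟨_, L.zero_mem⟩ fun a => a.1 * x 0 + a.2 * x 1 + L.coeff a

section Conditions

variable {ι : Type*}

/-- The end `i` has primitive direction `(0, 0, ±1)`. -/
def IsVerticalEnd (Δ : ι → Fin 3 → ℤ) (i : ι) : Prop := proj (Δ i) = 0 ∧ Δ i ≠ 0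

/-- The functions `max (x_j - p_j) 0` on `ℝ³`, pulled back along the evaluation at the contracted
end: they cut out `ev^*(p)`. -/
def pointFunctions (p : Fin 3 → ℝ) : List (Ambient ι → ℝ) :=
  (List.finRange 3).map fun j x => max (x.2.1 j - p j) 0

/-- The function that cuts out the pull-back `ft_c^*(0)` of the vertex of `M_{0,4}`. -/
def crossRatioFunction (c : Fin 4 ↪ ι) : Ambient ι → ℝ := fun x => max (x.1 c) 0

/-- The functions that cut out `∂ev_f^*(P)` for a point `P` of `ℝ²`. -/
def tangencyPointFunctions (P : Fin 2 → ℝ) (f : ι) : List (Ambient ι → ℝ) :=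
  (List.finRange 2).map fun j x => max (tangencyEv f x j - P j) 0

/-- The function that cuts out `∂ev_k^*(L)`. -/
def tangencyCurveFunction (L : PlaneCurve) (k : ι) : Ambient ι → ℝ :=
  fun x => L.poly (tangencyEv k x)

/-- `Y` represents the cycle
`∏_{k ∈ κ} ∂ev_k^*(L_k) · ∏_{f ∈ η} ∂ev_f^*(P_f) · ∏_j ft_{λ_j}^*(0) · ev^*(p) · M_{0,1}(ℝ³, Δ)`. -/
def IsFloorCycle [Fintype ι] (Δ : ι → Fin 3 → ℤ) (x₀ : ι) (p : Fin 3 → ℝ) (η κ : Finset ι)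
    (P : ι → Fin 2 → ℝ) (L : ι → PlaneCurve) (crs : List (Fin 4 ↪ ι))
    (Y : TropicalCycle (moduliLattice Δ x₀)) : Prop :=
  ∃ M : TropicalCycle (moduliLattice Δ x₀), IsModuliSpace Δ x₀ M ∧
    IsIntersectionProduct
      (pointFunctions p ++ crs.map crossRatioFunction ++
        η.toList.flatMap (fun f => tangencyPointFunctions (P f) f) ++
        κ.toList.map (fun k => tangencyCurveFunction (L k) k)) M Y

end Conditions

/-- The lattice `ℤ²` in `ℝ²`. -/
def planeLattice : AddSubgroup (Fin 2 → ℝ) :=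
  AddSubgroup.pi Set.univ fun _ => (Int.castAddHom ℝ).range

end TropicalFloor

end

/-! Let `σ` be a cell of `Y` of nonzero weight with a recession vector `v` that moves the end `q` in
the plane. Unwinding the divisors puts `σ` into a facet of the moduli space, that is, into the
closure of a 3-valent combinatorial type `C`. There `v` becomes a vector `ℓ ≥ 0` of growth rates of
the edge lengths, with `x₀` at rest (`IsFloorCycle.exists_cells`, `IsModuliSpace.exists_param`). In
the projection to the plane the vertex `a` moves with velocity `w a`, and `w b - w a` is a
nonnegative multiple of the edge direction `D a b`. Edges that contribute to a cross-ratio condition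
keep length zero. The conditions are transverse and `σ` has dimension one, so `w` is unique up to
scaling among the deformations compatible with the conditions. `RigidRay` records this.

The core is a flow argument with the convex function `h(x, y) = |x| + |y| + |x - y|`. Send the flow
`hexGrad (w a) (D a b)` from `a` to `b` along each edge between moving vertices. Edges only grow and
the subgradient of `h` is monotone, so the total outflow is at most zero (`sum_outflow_nonpos`).
Every single outflow is nevertheless nonnegative (`outflow_nonneg`): by balancing, an edge of
direction `D` arriving from a resting vertex feeds in `h(D)`, an end of standard direction takes
away at most `2 ≤ h(D)`, and rigidity excludes the remaining configurations. Hence all outflows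
vanish.

At an edge from a moving to a resting vertex this is possible only if the moving vertex has an end
`E` of standard direction and the edge is parallel to it. Rigidity then makes this vertex the only
moving one, so it carries `q` (`RigidRay.exists_end`), and `q` moves in the direction of `E`. This
is the first claim. For the second, the growing edge separates `q` and `E` from all other labels, so
in the relative interior of `σ` all coordinates of type `(qE|ab)` are positive. These coordinates
detect the 3-valent vertex in any stable map over such a point, whether or not other edges of `C`
have shrunk to length zero (`valence_eq_three_of_crossRatio_pos`). -/

namespace TropicalFloor

/-! ### Cells of divisors and intersection products of maxima of affine functions -/

section Polyhedral

variable {V : Type*} [NormedAddCommGroup V] [NormedSpace ℝ V]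

theorem IsRationalPolyhedron.convex {Γ : AddSubgroup V} {P : Set V}
    (h : IsRationalPolyhedron Γ P) : Convex ℝ P := by
  obtain ⟨S, -, rfl⟩ := h
  intro x hx y hy a b ha hb hab i hi
  have h1 := hx i hi
  have h2 := hy i hi
  simp only [map_add, map_smul, smul_eq_mul]
  calc a * i.1 x + b * i.1 y ≤ a * i.2 + b * i.2 := by gcongr
    _ = i.2 := by rw [← add_mul, hab, one_mul]

/-- Trades the interior in the subtype `affineSpan ℝ s` for a ball of directions in `vectorSpan ℝ
s`, which is how relative interior points are used. -/
theorem mem_intrinsicInterior_iff_exists_ball {s : Set V} {z : V} :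
    z ∈ intrinsicInterior ℝ s ↔
      z ∈ s ∧ ∃ ε > 0, ∀ v ∈ vectorSpan ℝ s, ‖v‖ < ε → z + v ∈ s := by
  rw [mem_intrinsicInterior]
  constructor
  · rintro ⟨y, hy, rfl⟩
    refine ⟨(interior_subset hy : y ∈ Subtype.val ⁻¹' s), ?_⟩
    obtain ⟨ε, hε, hb⟩ := Metric.mem_nhds_iff.1 (mem_interior_iff_mem_nhds.1 hy)
    refine ⟨ε, hε, fun v hv hvε => ?_⟩
    have hmem : (y : V) + v ∈ affineSpan ℝ s := by
      rw [add_comm]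
      exact AffineSubspace.vadd_mem_of_mem_direction
        (by rwa [direction_affineSpan]) y.2
    have : (⟨(y : V) + v, hmem⟩ : affineSpan ℝ s) ∈ Metric.ball y ε := by
      rw [Metric.mem_ball, Subtype.dist_eq]
      simpa using hvε
    exact hb this
  · rintro ⟨hz, ε, hε, h⟩
    refine ⟨⟨z, subset_affineSpan ℝ s hz⟩, ?_, rfl⟩
    rw [mem_interior_iff_mem_nhds, Metric.mem_nhds_iff]
    refine ⟨ε, hε, fun y hy => ?_⟩
    rw [Metric.mem_ball, Subtype.dist_eq, dist_eq_norm] at hy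
    have := h ((y : V) - z) (by
      rw [← direction_affineSpan]
      exact AffineSubspace.vsub_mem_direction y.2 (subset_affineSpan ℝ s hz)) hy
    simpa using this

theorem exists_add_smul_mem_of_mem_intrinsicInterior {s : Set V} {z v : V}
    (hz : z ∈ intrinsicInterior ℝ s) (hv : v ∈ vectorSpan ℝ s) :
    ∃ δ : ℝ, 0 < δ ∧ z + δ • v ∈ s := by
  obtain ⟨-, ε, hε, h⟩ := mem_intrinsicInterior_iff_exists_ball.1 hz
  refine ⟨ε / (2 * (‖v‖ + 1)), by positivity, h _ (Submodule.smul_mem _ _ hv) ?_⟩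
  rw [norm_smul, Real.norm_of_nonneg (by positivity), div_mul_eq_mul_div,
    div_lt_iff₀ (by positivity)]
  nlinarith [norm_nonneg v]

/-- By convexity a ball of radius `ε` around `z` shrinks to one of radius `t * ε` around the point
of the segment. -/
theorem lineMap_mem_intrinsicInterior {s : Set V} (hs : Convex ℝ s) {y z : V} (hy : y ∈ s)
    (hz : z ∈ intrinsicInterior ℝ s) {t : ℝ} (ht : 0 < t) (ht1 : t ≤ 1) :
    (1 - t) • y + t • z ∈ intrinsicInterior ℝ s := by
  obtain ⟨hzs, ε, hε, h⟩ := mem_intrinsicInterior_iff_exists_ball.1 hz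
  refine mem_intrinsicInterior_iff_exists_ball.2
    ⟨hs hy hzs (by linarith) ht.le (by ring), t * ε, by positivity, fun v hv hvt => ?_⟩
  have h1 := h (t⁻¹ • v) (Submodule.smul_mem _ _ hv) (by
    rw [norm_smul, Real.norm_of_nonneg (by positivity), inv_mul_lt_iff₀ ht]; exact hvt)
  have h2 := hs hy h1 (sub_nonneg.2 ht1) ht.le (by ring)
  rwa [smul_add, smul_inv_smul₀ ht.ne', ← add_assoc] at h2

/-- An affine function that is nonnegative on `s` and vanishes at a relative interior point
vanishes on `s`. -/
theorem affine_eq_zero_of_intrinsicInterior {s : Set V} {z : V} (hz : z ∈ intrinsicInterior ℝ s)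
    (f : V →ₗ[ℝ] ℝ) (b : ℝ) (h : ∀ x ∈ s, 0 ≤ f x + b) (h0 : f z + b = 0) :
    ∀ x ∈ s, f x + b = 0 := by
  intro x hx
  have hzs := intrinsicInterior_subset hz
  obtain ⟨δ, hδ, hm⟩ := exists_add_smul_mem_of_mem_intrinsicInterior hz
    (vsub_mem_vectorSpan ℝ hzs hx)
  have h1 := h _ hm
  have h2 := h x hx
  simp only [vsub_eq_sub, map_add, map_smul, map_sub, smul_eq_mul] at h1
  nlinarith

theorem linear_eq_on_vectorSpan {s : Set V} {f g : V →ₗ[ℝ] ℝ} {b c : ℝ}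
    (h : ∀ x ∈ s, f x + b = g x + c) : ∀ v ∈ vectorSpan ℝ s, f v = g v := by
  intro v hv
  have : vectorSpan ℝ s ≤ LinearMap.ker (f - g) := by
    rw [vectorSpan_def, Submodule.span_le]
    rintro _ ⟨x, hx, y, hy, rfl⟩
    have h1 := h x hx
    have h2 := h y hy
    simp only [vsub_eq_sub, SetLike.mem_coe, LinearMap.mem_ker, LinearMap.sub_apply, map_sub]
    linarith
  have := this hv
  rwa [LinearMap.mem_ker, LinearMap.sub_apply, sub_eq_zero] at this

theorem recessionCone_subset_vectorSpan {s : Set V} (hs : s.Nonempty) {v : V}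
    (hv : v ∈ recessionCone s) : v ∈ vectorSpan ℝ s := by
  obtain ⟨x, hx⟩ := hs
  have := vsub_mem_vectorSpan ℝ (hv x hx 1 zero_le_one) hx
  simpa using this

/-- `φ` is the pointwise maximum of the affine functions `a.1 + a.2`, `a ∈ S`. -/
def IsMaxOf (φ : V → ℝ) (S : Set ((V →ₗ[ℝ] ℝ) × ℝ)) : Prop :=
  ∀ x, (∃ a ∈ S, φ x = a.1 x + a.2) ∧ ∀ a ∈ S, a.1 x + a.2 ≤ φ x

/-- `ℓ` is the nonzero difference of the linear parts of two functions of `S` that are both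
maximal on `τ`. -/
def IsCut (S : Set ((V →ₗ[ℝ] ℝ) × ℝ)) (τ : Set V) (ℓ : V →ₗ[ℝ] ℝ) : Prop :=
  ∃ a ∈ S, ∃ a' ∈ S, ℓ = a.1 - a'.1 ∧ ℓ ≠ 0 ∧
    ∀ x ∈ τ, a.1 x + a.2 = a'.1 x + a'.2 ∧ ∀ b ∈ S, b.1 x + b.2 ≤ a.1 x + a.2

theorem IsCut.mono {S : Set ((V →ₗ[ℝ] ℝ) × ℝ)} {τ τ' : Set V} {ℓ : V →ₗ[ℝ] ℝ}
    (h : IsCut S τ ℓ) (hτ : τ' ⊆ τ) : IsCut S τ' ℓ := by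
  obtain ⟨a, ha, a', ha', h1, h2, h3⟩ := h
  exact ⟨a, ha, a', ha', h1, h2, fun x hx => h3 x (hτ hx)⟩

theorem IsCut.apply_eq_zero {S : Set ((V →ₗ[ℝ] ℝ) × ℝ)} {τ : Set V} {ℓ : V →ₗ[ℝ] ℝ}
    (h : IsCut S τ ℓ) {v : V} (hv : v ∈ vectorSpan ℝ τ) : ℓ v = 0 := by
  obtain ⟨a, -, a', -, rfl, -, h3⟩ := h
  rw [LinearMap.sub_apply, sub_eq_zero]
  exact linear_eq_on_vectorSpan (fun x hx => (h3 x hx).1) v hv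

variable {Γ : AddSubgroup V}

theorem TropicalCycle.mem_facets {X : TropicalCycle Γ} {σ : Set V} :
    σ ∈ X.facets ↔ σ ∈ X.cells ∧ polyDim σ = X.dim := by
  classical
  rw [TropicalCycle.facets, Finset.mem_filter]

variable [FiniteDimensional ℝ V]

/-- A maximum of affine functions that is affine on a convex set agrees there with one of them. -/
theorem IsMaxOf.exists_eq_on {φ : V → ℝ} {S : Set ((V →ₗ[ℝ] ℝ) × ℝ)} (hφ : IsMaxOf φ S)
    {s : Set V} (hs : Convex ℝ s) (hne : s.Nonempty) {f : V →ₗ[ℝ] ℝ} {c : ℝ}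
    (hf : ∀ x ∈ s, φ x = f x + c) : ∃ a ∈ S, ∀ x ∈ s, φ x = a.1 x + a.2 := by
  obtain ⟨z, hz⟩ := hne.intrinsicInterior hs
  obtain ⟨a, ha, haz⟩ := (hφ z).1
  refine ⟨a, ha, fun x hx => ?_⟩
  have := affine_eq_zero_of_intrinsicInterior hz (f - a.1) (c - a.2) (fun y hy => by
    have h1 := (hφ y).2 a ha
    rw [hf y hy] at h1
    simp only [LinearMap.sub_apply]
    linarith) (by
    rw [hf z (intrinsicInterior_subset hz)] at haz
    simp only [LinearMap.sub_apply]
    linarith) x hx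
  rw [hf x hx]
  simp only [LinearMap.sub_apply] at this
  linarith

/-- Purity enlarges the cell of `X` around `σ` to a facet; inclusion and equal dimension make the
spans agree. -/
theorem Refines.exists_facet {X' X : TropicalCycle Γ} (h : Refines X' X) {σ : Set V}
    (hσ : σ ∈ X'.facets) (hw : X'.weight σ ≠ 0) :
    ∃ ρ ∈ X.facets, X.weight ρ ≠ 0 ∧ σ ⊆ ρ ∧ vectorSpan ℝ ρ = vectorSpan ℝ σ := by
  obtain ⟨hdim, -, hsub, hwt⟩ := h
  have hσ' := TropicalCycle.mem_facets.1 hσ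
  obtain ⟨ρ₀, hρ₀, h0⟩ := hsub σ hσ'.1
  obtain ⟨ρ, hρ, h1, h2⟩ := X.pure ρ₀ hρ₀
  have hρf : ρ ∈ X.facets := TropicalCycle.mem_facets.2 ⟨hρ, h2⟩
  refine ⟨ρ, hρf, ?_, h0.trans h1, ?_⟩
  · rwa [← hwt σ hσ ρ hρf (h0.trans h1)]
  · refine (Submodule.eq_of_le_of_finrank_eq (vectorSpan_mono ℝ (h0.trans h1)) ?_).symm
    have : polyDim σ = polyDim ρ := by rw [hσ'.2, h2, hdim]
    exact this

/-- A facet of nonzero weight of the divisor of a maximum of affine functions is cut out of a facet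
of nonzero weight by the difference of two of these functions. -/
theorem IsDivisor.exists_facet {φ : V → ℝ} {S : Set ((V →ₗ[ℝ] ℝ) × ℝ)} (hφ : IsMaxOf φ S)
    {X D : TropicalCycle Γ} (h : IsDivisor φ X D) {τ : Set V} (hτ : τ ∈ D.facets)
    (hw : D.weight τ ≠ 0) :
    ∃ σ ∈ X.facets, X.weight σ ≠ 0 ∧ τ ⊆ σ ∧ ∃ ℓ, IsCut S τ ℓ ∧
      ∀ v ∈ vectorSpan ℝ σ, ℓ v = 0 → v ∈ vectorSpan ℝ τ := by
  classical
  obtain ⟨hdim, hcells, lin, c, hlin, hwt⟩ := h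
  obtain ⟨u, hu, hwu⟩ := hwt τ hτ
  obtain ⟨hτD, hτdim⟩ := TropicalCycle.mem_facets.1 hτ
  have hτX : τ ∈ X.cells := ((hcells τ).1 hτD).1
  have key : ∀ σ ∈ X.cells, ∃ a ∈ S, ∀ x ∈ σ, φ x = a.1 x + a.2 := fun σ hσ =>
    hφ.exists_eq_on (X.polyhedron σ hσ).convex (X.nonempty σ hσ) (hlin σ hσ)
  obtain ⟨a₁, ha₁, hφ₁⟩ := key τ hτX
  -- By balancing, `lin τ` is only applied to a vector in the span of `τ`, where it agrees with
  -- `a₁`. The weight becomes `∑ ω(σ) (lin σ - a₁)(u σ)`, and a nonzero summand provides `σ`.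
  have hbal : ∑ σ ∈ X.facets with τ ⊆ σ, X.weight σ • u σ ∈ vectorSpan ℝ τ := by
    have := X.balanced τ hτX (by rw [hτdim, hdim]) u
      (fun σ hσ hd hs => hu σ (TropicalCycle.mem_facets.2 ⟨hσ, hd⟩) hs)
    rw [TropicalCycle.facets, Finset.filter_filter]
    exact this
  have hlinτ : lin τ (∑ σ ∈ X.facets with τ ⊆ σ, X.weight σ • u σ) =
      a₁.1 (∑ σ ∈ X.facets with τ ⊆ σ, X.weight σ • u σ) :=
    linear_eq_on_vectorSpan (fun x hx => by rw [← hlin τ hτX x hx, hφ₁ x hx]) _ hbal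
  rw [hlinτ, map_sum, ← Finset.sum_sub_distrib] at hwu
  have hne : (D.weight τ : ℝ) ≠ 0 := by exact_mod_cast hw
  rw [hwu] at hne
  obtain ⟨σ, hσ, hne⟩ := Finset.exists_ne_zero_of_sum_ne_zero hne
  obtain ⟨hσf, hτσ⟩ := Finset.mem_filter.1 hσ
  obtain ⟨hσX, hσdim⟩ := TropicalCycle.mem_facets.1 hσf
  obtain ⟨a, ha, hφa⟩ := key σ hσX
  have huσ : u σ ∈ vectorSpan ℝ σ := (hu σ hσf hτσ).1.2
  have hlinσ : lin σ (u σ) = a.1 (u σ) :=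
    linear_eq_on_vectorSpan (fun x hx => by rw [← hlin σ hσX x hx, hφa x hx]) _ huσ
  rw [map_zsmul, map_zsmul, hlinσ, ← smul_sub, zsmul_eq_mul] at hne
  have hℓu : (a.1 - a₁.1) (u σ) ≠ 0 := by
    rw [LinearMap.sub_apply]
    exact right_ne_zero_of_mul hne
  have hcut : IsCut S τ (a.1 - a₁.1) := by
    refine ⟨a, ha, a₁, ha₁, rfl, fun h => hℓu (by rw [h]; rfl), fun x hx => ⟨?_, fun b hb => ?_⟩⟩
    · rw [← hφa x (hτσ hx), hφ₁ x hx]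
    · rw [← hφa x (hτσ hx)]
      exact (hφ x).2 b hb
  refine ⟨σ, hσf, fun h => hne (by simp [h]), hτσ, a.1 - a₁.1, hcut, ?_⟩
  -- The functional does not vanish on `u σ`, so its kernel in `W` has codimension one and must be
  -- the span of `τ`.
  set W := vectorSpan ℝ σ
  set K := W ⊓ LinearMap.ker (a.1 - a₁.1)
  have hle : vectorSpan ℝ τ ≤ K := fun v hv => ⟨vectorSpan_mono ℝ hτσ hv, hcut.apply_eq_zero hv⟩
  have hlt : K < W := lt_of_le_of_ne inf_le_left fun h => hℓu (by
    have : u σ ∈ K := h ▸ huσ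
    exact this.2)
  have hfin := Submodule.finrank_lt_finrank_of_lt hlt
  have hWd : Module.finrank ℝ W = D.dim + 1 := by rw [← hdim]; exact hσdim
  have hτd : Module.finrank ℝ (vectorSpan ℝ τ) = D.dim := hτdim
  have heq : vectorSpan ℝ τ = K := Submodule.eq_of_le_of_finrank_le hle (by omega)
  intro v hv hℓ
  rw [heq]
  exact ⟨hv, hℓ⟩

/-- `τ` lies in the facet `ρ` and is cut out, as far as the linear spans are concerned, by
functionals that come from the maxima `L`. -/
def IsCutOut (L : List ((V → ℝ) × Set ((V →ₗ[ℝ] ℝ) × ℝ))) (ρ τ : Set V) : Prop :=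
  τ ⊆ ρ ∧ (∀ p ∈ L, ∃ ℓ, IsCut p.2 τ ℓ) ∧
    ∀ v ∈ vectorSpan ℝ ρ, (∀ p ∈ L, ∀ ℓ, IsCut p.2 τ ℓ → ℓ v = 0) → v ∈ vectorSpan ℝ τ

/-- Peels off a prefix of the conditions in order to expose the intermediate cycle `D`: the point
and cross-ratio conditions are studied on its cells rather than on those of `Y`. The cuts of later
divisors restrict to smaller cells, so they accumulate along the induction. -/
theorem IsIntersectionProduct.exists_isCutOut
    (L : List ((V → ℝ) × Set ((V →ₗ[ℝ] ℝ) × ℝ))) (hL : ∀ p ∈ L, IsMaxOf p.1 p.2)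
    {l : List (V → ℝ)} {X Y : TropicalCycle Γ}
    (h : IsIntersectionProduct (L.map Prod.fst ++ l) X Y) :
    ∃ D : TropicalCycle Γ, IsIntersectionProduct l D Y ∧
      ∀ τ ∈ D.facets, D.weight τ ≠ 0 → ∃ ρ ∈ X.facets, X.weight ρ ≠ 0 ∧ IsCutOut L ρ τ := by
  induction L generalizing X with
  | nil => exact ⟨X, h, fun τ hτ hw => ⟨τ, hτ, hw, subset_rfl, by simp, fun v hv _ => hv⟩⟩
  | cons p L ih =>
    rw [List.map_cons, List.cons_append] at h
    cases h with
    | cons hX' hdiv hrest =>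
      obtain ⟨D, hD, hcut⟩ := ih (fun p' hp' => hL p' (List.mem_cons_of_mem _ hp')) hrest
      refine ⟨D, hD, fun τ hτ hw => ?_⟩
      obtain ⟨τ₁, hτ₁, hw₁, hsub₁, hex₁, hspan₁⟩ := hcut τ hτ hw
      obtain ⟨σ, hσ, hwσ, hsubσ, ℓ, hℓ, hspanσ⟩ :=
        hdiv.exists_facet (hL p List.mem_cons_self) hτ₁ hw₁
      obtain ⟨ρ, hρ, hwρ, hsubρ, hspanρ⟩ := hX'.exists_facet hσ hwσ
      refine ⟨ρ, hρ, hwρ, hsub₁.trans (hsubσ.trans hsubρ), ?_, ?_⟩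
      · intro p' hp'
        rcases List.mem_cons.1 hp' with rfl | hp'
        · exact ⟨ℓ, hℓ.mono hsub₁⟩
        · exact hex₁ p' hp'
      · intro v hv hz
        rw [hspanρ] at hv
        exact hspan₁ v (hspanσ v hv (hz p List.mem_cons_self ℓ (hℓ.mono hsub₁)))
          fun p' hp' => hz p' (List.mem_cons_of_mem _ hp')

theorem IsIntersectionProduct.exists_isCutOut_facet
    (L : List ((V → ℝ) × Set ((V →ₗ[ℝ] ℝ) × ℝ))) (hL : ∀ p ∈ L, IsMaxOf p.1 p.2)
    {X Y : TropicalCycle Γ} (h : IsIntersectionProduct (L.map Prod.fst) X Y)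
    {σ : Set V} (hσ : σ ∈ Y.facets) (hw : Y.weight σ ≠ 0) :
    ∃ ρ ∈ X.facets, X.weight ρ ≠ 0 ∧ IsCutOut L ρ σ := by
  rw [← List.append_nil (L.map Prod.fst)] at h
  obtain ⟨D, hD, hcut⟩ := exists_isCutOut L hL h
  cases hD with
  | nil hr =>
    obtain ⟨τ, hτ, hwτ, hsub, hspan⟩ := hr.exists_facet hσ hw
    obtain ⟨ρ, hρ, hwρ, hsub', hex, hsp⟩ := hcut τ hτ hwτ
    refine ⟨ρ, hρ, hwρ, hsub.trans hsub', fun p hp => ?_, fun v hv hz => ?_⟩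
    · obtain ⟨ℓ, hℓ⟩ := hex p hp
      exact ⟨ℓ, hℓ.mono hsub⟩
    · rw [← hspan]
      exact hsp v hv fun p hp ℓ hℓ => hz p hp ℓ (hℓ.mono hsub)

end Polyhedral

end TropicalFloor

namespace TropicalFloor

/-! ### Splits of the vertices of a tree by its edges -/

section Separation

variable {V : Type*} {G : SimpleGraph V}

/-- The edge `e` of `G` separates `a` from `b`. -/
def Separates (G : SimpleGraph V) (e : Sym2 V) (a b : V) : Prop :=
  ¬ (G.deleteEdges {e}).Reachable a b

theorem not_separates_self (e : Sym2 V) (a : V) : ¬ Separates G e a a :=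
  not_not.2 (SimpleGraph.Reachable.refl a)

theorem separates_comm {e : Sym2 V} {a b : V} : Separates G e a b ↔ Separates G e b a := by
  rw [Separates, Separates, SimpleGraph.reachable_comm]

theorem separates_congr_right {e : Sym2 V} {a b c : V} (h : ¬ Separates G e b c) :
    Separates G e a b ↔ Separates G e a c := by
  have h := not_not.1 h
  exact not_congr ⟨fun h' => h'.trans h, fun h' => h'.trans h.symm⟩

theorem separates_congr_left {e : Sym2 V} {a b c : V} (h : ¬ Separates G e a b) :
    Separates G e a c ↔ Separates G e b c := by
  rw [separates_comm, separates_congr_right h, separates_comm]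

theorem not_separates_of_adj {e : Sym2 V} {a b : V} (h : G.Adj a b) (he : e ≠ s(a, b)) :
    ¬ Separates G e a b := by
  refine not_not.2 (SimpleGraph.Adj.reachable ?_)
  rw [SimpleGraph.deleteEdges_adj]
  exact ⟨h, fun h' => he (by simpa using h'.symm)⟩

theorem separates_of_adj (hG : G.IsTree) {a b : V} (h : G.Adj a b) :
    Separates G s(a, b) a b :=
  SimpleGraph.isBridge_iff.1
    (SimpleGraph.isAcyclic_iff_forall_isBridge.1 hG.isAcyclic (G.mem_edgeSet.2 h))

theorem not_separates_iff_exists_walk {e : Sym2 V} {a b : V} :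
    ¬ Separates G e a b ↔ ∃ p : G.Walk a b, e ∉ p.edges := by
  induction e with
  | _ x y => rw [Separates, not_not, SimpleGraph.reachable_deleteEdges_iff_exists_walk]

theorem Separates.mem_edges {e : Sym2 V} {a b : V} (h : Separates G e a b) (p : G.Walk a b) :
    e ∈ p.edges :=
  p.mem_edges_of_not_reachable_deleteEdges h

/-- Along a walk from `a` to `x`, a step other than the edge stays on the same side, and a step
along the edge starts at one of its endpoints. -/
theorem not_separates_fst_or_snd (hG : G.Connected) {x y : V} (a : V) :
    ¬ Separates G s(x, y) x a ∨ ¬ Separates G s(x, y) y a := by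
  obtain ⟨p⟩ := hG.preconnected a x
  induction p with
  | nil => exact Or.inl (not_separates_self _ _)
  | @cons u v w h p ih =>
    by_cases he : s(w, y) = s(u, v)
    · rcases Sym2.eq_iff.1 he with ⟨rfl, rfl⟩ | ⟨rfl, rfl⟩
      · exact Or.inl (not_separates_self _ _)
      · exact Or.inr (not_separates_self _ _)
    · have := not_separates_of_adj h he
      rw [separates_comm] at this
      rw [← separates_congr_right this, ← separates_congr_right (a := y) this]
      exact ih

theorem not_separates_of_separates (hG : G.Connected) {e : Sym2 V} {a b c : V}
    (h : Separates G e a b) (h' : Separates G e a c) : ¬ Separates G e b c := by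
  induction e with
  | _ x y =>
    have key : ∀ {x y : V}, Separates G s(x, y) a b → Separates G s(x, y) a c →
        ¬ Separates G s(x, y) x a → ¬ Separates G s(x, y) b c := by
      intro x y h h' hx
      have hb := (separates_congr_left hx).2 h
      have hc := (separates_congr_left hx).2 h'
      have h1 := (not_separates_fst_or_snd hG b).resolve_left (not_not.2 hb)
      have h2 := (not_separates_fst_or_snd hG c).resolve_left (not_not.2 hc)
      rwa [← separates_congr_left h1]
    rcases not_separates_fst_or_snd hG (x := x) (y := y) a with hx | hx
    · exact key h h' hx
    · rw [Sym2.eq_swap] at h h' hx ⊢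
      exact key h h' hx

/-- An edge has only two sides, so the sides relative to a base vertex `a` decide all separations.
-/
theorem separates_iff_not_iff (hG : G.Connected) {e : Sym2 V} (a : V) {b c : V} :
    Separates G e b c ↔ ¬ (Separates G e a b ↔ Separates G e a c) := by
  by_cases h : Separates G e a b
  · by_cases h' : Separates G e a c
    · simpa [h, h'] using not_separates_of_separates hG h h'
    · rw [← separates_congr_right h', separates_comm]
      simp [h, h']
  · rw [← separates_congr_left h]
    simp [h]

/-- The edges that separate two vertices of a tree are the edges of the path between them. -/
theorem mem_edges_iff_separates (hG : G.IsTree) {e : Sym2 V} {a b : V} {p : G.Walk a b}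
    (hp : p.IsPath) : e ∈ p.edges ↔ Separates G e a b := by
  classical
  refine ⟨fun he => ?_, fun h => h.mem_edges p⟩
  by_contra hs
  obtain ⟨q, hq⟩ := not_separates_iff_exists_walk.1 hs
  have : q.bypass = p := congrArg Subtype.val
    ((hG.isAcyclic.subsingleton_path a b).elim ⟨q.bypass, q.bypass_isPath⟩ ⟨p, hp⟩)
  exact hq (q.edges_bypass_subset_edges (this ▸ he))

theorem exists_adj_separates (hG : G.IsTree) {v u : V} (h : v ≠ u) :
    ∃ x, G.Adj v x ∧ Separates G s(v, x) v u := by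
  obtain ⟨p, hp, -⟩ := hG.existsUnique_path v u
  cases p with
  | nil => exact absurd rfl h
  | cons h' p =>
    exact ⟨_, h', (mem_edges_iff_separates hG hp).1 (by simp)⟩

/-- A path starting at `v` uses only one edge at `v`, namely its first. -/
theorem eq_of_separates (hG : G.IsTree) {v x y u : V}
    (hx : Separates G s(v, x) v u) (hy : Separates G s(v, y) v u) : x = y := by
  obtain ⟨p, hp, -⟩ := hG.existsUnique_path v u
  have hx := hx.mem_edges p
  have hy := hy.mem_edges p
  cases p with
  | nil => simp at hx
  | @cons _ w _ h' p =>
    rw [SimpleGraph.Walk.cons_isPath_iff] at hp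
    have key : ∀ z, s(v, z) ∈ (SimpleGraph.Walk.cons h' p).edges → s(v, z) = s(v, w) := by
      intro z hz
      rw [SimpleGraph.Walk.edges_cons, List.mem_cons] at hz
      refine hz.resolve_right fun h => hp.2 (SimpleGraph.Walk.fst_mem_support_of_mem_edges _ h)
    exact Sym2.congr_right.1 ((key x hx).trans (key y hy).symm)

/-- An edge that separates `v` from a vertex in the branch of `x` at `v` does not separate `v` from
the vertices of the other branches. -/
theorem not_separates_of_branch (hG : G.IsTree) {v x a b : V} {e : Sym2 V}
    (ha : Separates G s(v, x) v a) (hb : ¬ Separates G s(v, x) v b) (he : Separates G e v a) :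
    ¬ Separates G e v b := by
  classical
  intro hb'
  obtain ⟨p, hp⟩ := not_separates_iff_exists_walk.1
    (not_separates_of_separates hG.connected he hb')
  have hab : Separates G s(v, x) a b := by
    rw [← separates_congr_right hb, separates_comm]
    exact ha
  have hv : v ∈ p.support := SimpleGraph.Walk.fst_mem_support_of_mem_edges _ (hab.mem_edges p)
  have : ¬ Separates G e a v := not_separates_iff_exists_walk.2
    ⟨p.takeUntil v hv, fun h => hp (p.edges_takeUntil_subset_edges hv h)⟩
  exact this (separates_comm.1 he)

/-- The splits induced by two edges are compatible. -/
theorem splits_compatible {e e' : Sym2 V} {a b c d : V}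
    (hab : ¬ Separates G e a b) (hcd : ¬ Separates G e c d) (hac : Separates G e a c)
    (hab' : Separates G e' a b) (hcd' : Separates G e' c d) : False := by
  classical
  induction e' with
  | _ x y =>
    -- A walk from `a` to `b` that avoids `e` must cross `e'`, so the endpoint `x` of `e'` lies on
    -- their side of `e`. The same holds for `c` and `d`, although `e` separates `a` from `c`.
    have key : ∀ {a b : V}, ¬ Separates G e a b → Separates G s(x, y) a b →
        ¬ Separates G e a x := by
      intro a b h h'
      obtain ⟨p, hp⟩ := not_separates_iff_exists_walk.1 h
      have hx : x ∈ p.support := SimpleGraph.Walk.fst_mem_support_of_mem_edges _ (h'.mem_edges p)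
      exact not_separates_iff_exists_walk.2
        ⟨p.takeUntil x hx, fun h => hp (p.edges_takeUntil_subset_edges hx h)⟩
    have h1 := key hab hab'
    have h2 := key hcd hcd'
    exact h2 (separates_comm.1 ((separates_congr_left h1).1 hac))

/-- Identifies positions and displacements of vertices by comparing increments along edges. -/
theorem eq_of_forall_adj_sub_eq {M : Type*} [AddCommGroup M] (hG : G.Connected) {f g : V → M}
    {r : V} (hr : f r = g r) (h : ∀ a b, G.Adj a b → f b - f a = g b - g a) : f = g := by
  funext a
  obtain ⟨p⟩ := hG.preconnected a r
  induction p with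
  | nil => exact hr
  | cons hadj p ih =>
    have h1 := h _ _ hadj
    rw [ih hr] at h1
    exact sub_right_injective h1

end Separation

/-! ### Labels on the two sides of an edge -/

section Sides

variable {ι : Type*} [Finite ι] (C : MarkedCurve ι)

/-- Stability leaves at least two ends or edges at `v` besides the edge to `a`; the cases sort them
by kind. -/
theorem MarkedCurve.exists_item_ne {v a : Fin C.n} (ha : C.graph.Adj v a) :
    (∃ i j, i ≠ j ∧ C.attach i = v ∧ C.attach j = v) ∨
    (∃ i b, C.attach i = v ∧ C.graph.Adj v b ∧ b ≠ a) ∨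
    ∃ b b', b ≠ b' ∧ C.graph.Adj v b ∧ b ≠ a ∧ C.graph.Adj v b' ∧ b' ≠ a := by
  have hval := C.three_le_valence v
  have hdiff : (C.graph.neighborSet v \ {a}).ncard + 1 = (C.graph.neighborSet v).ncard :=
    Set.ncard_sdiff_singleton_add_one ha
  rcases Nat.lt_or_ge 1 ((C.attach ⁻¹' {v}).ncard) with h | h
  · obtain ⟨i, hi, j, hj, hij⟩ := (Set.one_lt_ncard (Set.toFinite _)).1 h
    exact Or.inl ⟨i, j, hij, hi, hj⟩
  rcases Nat.lt_or_ge 0 ((C.attach ⁻¹' {v}).ncard) with h' | h'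
  · obtain ⟨i, hi⟩ := (Set.ncard_pos (Set.toFinite _)).1 h'
    obtain ⟨b, hb⟩ := (Set.ncard_pos (Set.toFinite _)).1
      (show 0 < (C.graph.neighborSet v \ {a}).ncard by omega)
    exact Or.inr (Or.inl ⟨i, b, hi, hb.1, hb.2⟩)
  · obtain ⟨b, hb, b', hb', hbb⟩ := (Set.one_lt_ncard (Set.toFinite _)).1
      (show 1 < (C.graph.neighborSet v \ {a}).ncard by omega)
    exact Or.inr (Or.inr ⟨b, b', hbb, hb.1, hb.2, hb'.1, hb'.2⟩)

/-- Both sides of a bounded edge of a stable curve contain at least two labels. -/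
theorem MarkedCurve.exists_two_labels {a b : Fin C.n} (h : C.graph.Adj a b) :
    ∃ i j, i ≠ j ∧ Separates C.graph s(a, b) a (C.attach i) ∧
      Separates C.graph s(a, b) a (C.attach j) := by
  -- Induction on the number of vertices behind the edge: every branch that leaves `b` away from `a`
  -- is strictly smaller.
  induction hm : {u | Separates C.graph s(a, b) a u}.ncard using Nat.strong_induction_on
    generalizing a b with
  | _ m ih =>
    have hab := separates_of_adj C.isTree h
    have hsub : ∀ z, z ≠ a → ∀ u, Separates C.graph s(b, z) b u →
        Separates C.graph s(a, b) a u := by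
      intro z hz u hu
      by_contra hn
      rw [separates_congr_left hn, separates_comm, Sym2.eq_swap] at hab
      exact hz (eq_of_separates C.isTree hu hab)
    have hrec : ∀ z, C.graph.Adj b z → z ≠ a → ∃ i j, i ≠ j ∧
        Separates C.graph s(b, z) b (C.attach i) ∧ Separates C.graph s(b, z) b (C.attach j) := by
      intro z hbz hz
      refine ih _ ?_ hbz rfl
      rw [← hm]
      refine Set.ncard_lt_ncard ⟨fun u hu => hsub z hz u hu, fun hn => ?_⟩ (Set.toFinite _)
      exact not_separates_self _ _ (hn hab)
    rcases C.exists_item_ne h.symm with ⟨i, j, hij, hi, hj⟩ | ⟨i, z, hi, hz, hza⟩ |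
      ⟨z, -, -, hz, hza, -, -⟩
    · exact ⟨i, j, hij, hi ▸ hab, hj ▸ hab⟩
    · obtain ⟨j, -, -, hj, -⟩ := hrec z hz hza
      refine ⟨i, j, ?_, hi ▸ hab, hsub z hza _ hj⟩
      rintro rfl
      rw [hi] at hj
      exact not_separates_self _ _ hj
    · obtain ⟨i, j, hij, hi, hj⟩ := hrec z hz hza
      exact ⟨i, j, hij, hsub z hza _ hi, hsub z hza _ hj⟩

end Sides

end TropicalFloor

namespace TropicalFloor

/-! ### Linear coordinates on the stable maps of a fixed combinatorial type -/

open scoped Classical in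
/-- The indicator of a proposition. -/
noncomputable def ind (p : Prop) : ℝ := if p then 1 else 0

theorem ind_true {p : Prop} (h : p) : ind p = 1 := if_pos h

theorem ind_false {p : Prop} (h : ¬ p) : ind p = 0 := if_neg h

/-- The derivative of the `M_{0,4}`-coordinate with respect to the length of an edge that splits
the labels according to `S`. -/
noncomputable def crossCoeff {ι : Type*} (S : ι → ι → Prop) (c : Fin 4 ↪ ι) : ℝ :=
  (ind (S (c 0) (c 2)) + ind (S (c 1) (c 3)) - ind (S (c 0) (c 1)) - ind (S (c 2) (c 3))) / 2

namespace MarkedCurve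

variable {ι : Type*} (C : MarkedCurve ι)

/-- The edge `e` separates the ends `i` and `j`. -/
def Split (e : Sym2 (Fin C.n)) (i j : ι) : Prop :=
  Separates C.graph e (C.attach i) (C.attach j)

noncomputable instance : Fintype C.graph.edgeSet := Fintype.ofFinite _

/-- The edges on the path are those that separate its endpoints, so distances are linear in the
lengths with coefficients that depend on the splits alone. -/
theorem dist_eq_sum (a b : Fin C.n) :
    C.dist a b = ∑ e : C.graph.edgeSet, C.length e * ind (Separates C.graph e a b) := by
  classical
  have hp := (C.isTree.existsUnique_path a b).choose_spec.1
  rw [MarkedCurve.dist]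
  set p := (C.isTree.existsUnique_path a b).choose
  rw [← List.sum_toFinset _ hp.isTrail.edges_nodup,
    Finset.sum_set_coe (f := fun e => C.length e * ind (Separates C.graph e a b))]
  refine Finset.sum_subset_zero_on_sdiff (fun e he => ?_) (fun e he => ?_) (fun e he => ?_)
  · rw [Set.mem_toFinset]
    exact p.edges_subset_edgeSet (List.mem_toFinset.1 he)
  · rw [Finset.mem_sdiff, List.mem_toFinset, mem_edges_iff_separates C.isTree hp] at he
    rw [ind_false he.2, mul_zero]
  · rw [List.mem_toFinset, mem_edges_iff_separates C.isTree hp] at he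
    rw [ind_true he, mul_one]

theorem crossRatio_eq_sum (c : Fin 4 ↪ ι) :
    C.crossRatio c = ∑ e : C.graph.edgeSet, C.length e * crossCoeff (C.Split e) c := by
  simp only [crossRatio, dist_eq_sum, crossCoeff, ← Finset.sum_add_distrib,
    ← Finset.sum_sub_distrib, Finset.sum_div]
  refine Finset.sum_congr rfl fun e _ => ?_
  simp only [Split]
  ring

theorem separates_of_iso {C C' : MarkedCurve ι} (φ : C.graph ≃g C'.graph) {e : Sym2 (Fin C.n)}
    {a b : Fin C.n} :
    Separates C'.graph (e.map φ) (φ a) (φ b) ↔ Separates C.graph e a b := by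
  have key : ∀ {C C' : MarkedCurve ι} (φ : C.graph ≃g C'.graph) {e : Sym2 (Fin C.n)}
      {a b : Fin C.n}, ¬ Separates C.graph e a b →
      ¬ Separates C'.graph (e.map φ) (φ a) (φ b) := by
    intro C C' φ e a b h
    obtain ⟨p, hp⟩ := not_separates_iff_exists_walk.1 h
    refine not_separates_iff_exists_walk.2 ⟨p.map φ.toHom, fun h => hp ?_⟩
    rw [SimpleGraph.Walk.edges_map] at h
    obtain ⟨e', he', h⟩ := List.mem_map.1 h
    rwa [← Sym2.map.injective φ.injective h]
  refine ⟨fun h => ?_, fun h => ?_⟩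
  · by_contra hn
    exact key φ hn h
  · by_contra hn
    have hmap : (e.map φ).map φ.symm = e := by
      induction e with
      | _ x y => simp
    have := key φ.symm hn
    rw [hmap, RelIso.symm_apply_apply, RelIso.symm_apply_apply] at this
    exact this h

end MarkedCurve

section Linearization

variable {ι : Type*} [Fintype ι]

open scoped Classical in
/-- The direction of an edge that splits the labels according to `S`, pointing away from `x₀`. -/
noncomputable def outDir (Δ : ι → Fin 3 → ℤ) (x₀ : ι) (S : ι → ι → Prop) : Fin 3 → ℤ :=
  ∑ i with S x₀ i, Δ i

open scoped Classical in
/-- The derivative of the point of the moduli space with respect to the length of an edge that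
splits the labels according to `S`. -/
noncomputable def edgeRay (Δ : ι → Fin 3 → ℤ) (x₀ : ι) (S : ι → ι → Prop) : Ambient ι :=
  (fun c => crossCoeff S c, 0, fun k => if proj (Δ k) = 0 then
    ind (S x₀ k) • proj (fun j => (outDir Δ x₀ S j : ℝ)) else 0)

open scoped Classical in
/-- The translations of the stable maps. -/
noncomputable def translation (Δ : ι → Fin 3 → ℤ) : (Fin 3 → ℝ) →ₗ[ℝ] Ambient ι where
  toFun x := (0, x, fun k => if proj (Δ k) = 0 then proj x else 0)
  map_add' x y := by
    refine Prod.ext (by simp) (Prod.ext rfl ?_)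
    funext k
    by_cases h : proj (Δ k) = 0
    · simp only [h, if_true, Prod.snd_add, Pi.add_apply]; rfl
    · simp [h]
  map_smul' r x := by
    refine Prod.ext (by simp) (Prod.ext rfl ?_)
    funext k
    by_cases h : proj (Δ k) = 0
    · simp only [h, if_true, Prod.smul_snd, Pi.smul_apply]; rfl
    · simp [h]

variable {Δ : ι → Fin 3 → ℤ}

namespace StableMap

variable (C : StableMap Δ) (x₀ : ι)

/-- The linear parametrization by edge lengths and the position of `x₀` of the stable maps with the
combinatorial type of `C`. -/
noncomputable def param : (C.graph.edgeSet → ℝ) × (Fin 3 → ℝ) →ₗ[ℝ] Ambient ι :=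
  (Fintype.linearCombination ℝ fun e : C.graph.edgeSet => edgeRay Δ x₀ (C.Split e)).coprod
    (translation Δ)

/-- The displacement of the vertex `v` relative to the position of `x₀` for the edge lengths `ℓ`. -/
noncomputable def displacement (ℓ : C.graph.edgeSet → ℝ) (v : Fin C.n) : Fin 3 → ℝ :=
  ∑ e : C.graph.edgeSet, (ℓ e * ind (Separates C.graph e (C.attach x₀) v)) •
    fun j => (outDir Δ x₀ (C.Split e) j : ℝ)

theorem param_apply (ℓ : C.graph.edgeSet → ℝ) (x : Fin 3 → ℝ) :
    C.param x₀ (ℓ, x) =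
      ∑ e : C.graph.edgeSet, ℓ e • edgeRay Δ x₀ (C.Split e) + translation Δ x := rfl

theorem param_fst (ℓ : C.graph.edgeSet → ℝ) (x : Fin 3 → ℝ) (c : Fin 4 ↪ ι) :
    (C.param x₀ (ℓ, x)).1 c = ∑ e : C.graph.edgeSet, ℓ e * crossCoeff (C.Split e) c := by
  rw [param_apply]
  simp [translation, edgeRay, Prod.fst_sum, Finset.sum_apply]

theorem param_snd_fst (ℓ : C.graph.edgeSet → ℝ) (x : Fin 3 → ℝ) :
    (C.param x₀ (ℓ, x)).2.1 = x := by
  rw [param_apply]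
  simp [translation, edgeRay, Prod.fst_sum, Prod.snd_sum]

theorem param_snd_snd (ℓ : C.graph.edgeSet → ℝ) (x : Fin 3 → ℝ) {k : ι} (hk : proj (Δ k) = 0) :
    (C.param x₀ (ℓ, x)).2.2 k = proj (x + C.displacement x₀ ℓ (C.attach k)) := by
  rw [param_apply]
  funext j
  simp [translation, edgeRay, Prod.snd_sum, hk, displacement, proj, MarkedCurve.Split,
    Finset.sum_apply, add_comm, mul_assoc]

theorem param_snd_snd_of_ne (ℓ : C.graph.edgeSet → ℝ) (x : Fin 3 → ℝ) {k : ι}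
    (hk : proj (Δ k) ≠ 0) : (C.param x₀ (ℓ, x)).2.2 k = 0 := by
  rw [param_apply]
  simp [translation, edgeRay, Prod.snd_sum, hk]

/-- Not imposed by `StableMap`: it follows from `affine` read in both directions, since the length
is positive. -/
theorem slope_swap {a b : Fin C.n} (h : C.graph.Adj a b) : C.slope b a = - C.slope a b := by
  have h1 := C.affine a b h
  have h2 := C.affine b a h.symm
  rw [Sym2.eq_swap] at h2
  have hl := C.length_pos s(a, b) (C.graph.mem_edgeSet.2 h)
  funext j
  have h1 := congrFun h1 j
  have h2 := congrFun h2 j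
  simp only [Pi.add_apply, Pi.smul_apply, smul_eq_mul] at h1 h2
  have h3 : C.length s(a, b) * ((C.slope b a j : ℝ) + C.slope a b j) = 0 := by linarith
  have h4 := (mul_eq_zero.1 h3).resolve_left hl.ne'
  have h5 : C.slope b a j + C.slope a b j = 0 := by exact_mod_cast h4
  rw [Pi.neg_apply]
  omega

/-- The slope of an edge is the sum of the directions of the ends behind it. -/
theorem slope_eq_outDir {a b : Fin C.n} (h : C.graph.Adj a b)
    (hs : Separates C.graph s(a, b) (C.attach x₀) b) :
    C.slope a b = outDir Δ x₀ (C.Split s(a, b)) := by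
  classical
  -- Balancing is summed over the vertices behind the edge. Slopes inside `U` cancel in pairs,
  -- leaving the ends behind the edge and the slope of the edge itself.
  set U : Finset (Fin C.n) :=
    Finset.univ.filter fun v => Separates C.graph s(a, b) (C.attach x₀) v with hU
  have hmem : ∀ v, v ∈ U ↔ Separates C.graph s(a, b) (C.attach x₀) v := by simp [hU]
  have hbU : b ∈ U := (hmem b).2 hs
  have haU : a ∉ U := by
    rw [hmem]
    intro ha
    exact not_separates_of_separates C.isTree.connected ha hs (separates_of_adj C.isTree h)
  have hbal : ∑ v ∈ U, (∑ w with C.graph.Adj v w, C.slope v w +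
      ∑ i with C.attach i = v, Δ i) = 0 := by
    refine Finset.sum_eq_zero fun v _ => ?_
    convert C.balancing v
  rw [Finset.sum_add_distrib] at hbal
  have hends : ∑ v ∈ U, ∑ i with C.attach i = v, Δ i = outDir Δ x₀ (C.Split s(a, b)) := by
    rw [outDir]
    rw [← Finset.sum_fiberwise_of_maps_to (s := Finset.univ.filter _) (t := U) (g := C.attach)]
    · refine Finset.sum_congr rfl fun v hv => Finset.sum_congr ?_ fun _ _ => rfl
      ext i
      simp only [Finset.mem_filter, Finset.mem_univ, true_and]
      refine ⟨fun hi => ⟨?_, hi⟩, fun hi => hi.2⟩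
      rw [MarkedCurve.Split, hi]
      exact (hmem v).1 hv
    · intro i hi
      rw [hmem]
      exact (Finset.mem_filter.1 hi).2
  have hsplit : ∑ v ∈ U, ∑ w with C.graph.Adj v w, C.slope v w = C.slope b a := by
    have h1 : ∀ v ∈ U, ∑ w with C.graph.Adj v w, C.slope v w =
        ∑ w ∈ U, (if C.graph.Adj v w then C.slope v w else 0) +
          (if v = b then C.slope b a else 0) := by
      intro v hv
      rw [Finset.sum_filter, ← Finset.sum_add_sum_compl U]
      congr 1
      have hcross : ∀ w ∈ Uᶜ, C.graph.Adj v w → v = b ∧ w = a := by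
        intro w hw hadj
        have hw' : ¬ Separates C.graph s(a, b) (C.attach x₀) w := by
          rw [← hmem]; exact Finset.mem_compl.1 hw
        by_cases he : s(a, b) = s(v, w)
        · rcases Sym2.eq_iff.1 he with ⟨rfl, rfl⟩ | ⟨rfl, rfl⟩
          · exact absurd hv haU
          · exact ⟨rfl, rfl⟩
        · exact absurd ((separates_congr_right (not_separates_of_adj hadj he)).1 ((hmem v).1 hv))
            hw'
      by_cases hvb : v = b
      · subst hvb
        rw [if_pos rfl, Finset.sum_eq_single a]
        · rw [if_pos h.symm]
        · intro w hw hwa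
          exact if_neg fun hadj => hwa (hcross w hw hadj).2
        · intro ha
          exact absurd (Finset.mem_compl.2 haU) ha
      · rw [if_neg hvb]
        exact Finset.sum_eq_zero fun w hw => if_neg fun hadj => hvb (hcross w hw hadj).1
    rw [Finset.sum_congr rfl h1, Finset.sum_add_distrib, Finset.sum_ite_eq' U b, if_pos hbU]
    have hanti : ∑ v ∈ U, ∑ w ∈ U, (if C.graph.Adj v w then C.slope v w else 0) =
        -∑ v ∈ U, ∑ w ∈ U, (if C.graph.Adj v w then C.slope v w else 0) := by
      conv_lhs => rw [Finset.sum_comm]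
      rw [← Finset.sum_neg_distrib]
      refine Finset.sum_congr rfl fun v _ => ?_
      rw [← Finset.sum_neg_distrib]
      refine Finset.sum_congr rfl fun w _ => ?_
      by_cases hadj : C.graph.Adj v w
      · rw [if_pos hadj, if_pos hadj.symm, C.slope_swap hadj]
      · rw [if_neg hadj, if_neg fun h => hadj h.symm, neg_zero]
    rw [self_eq_neg.1 hanti, zero_add]
  rw [hsplit, hends, C.slope_swap h, neg_add_eq_zero] at hbal
  exact hbal

/-- Only the edge itself distinguishes `a` from `b`. The sign depends on which of them is farther
from `x₀`, and `slope_swap` absorbs it. -/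
theorem displacement_sub (ℓ : C.graph.edgeSet → ℝ) {a b : Fin C.n} (h : C.graph.Adj a b) :
    C.displacement x₀ ℓ b - C.displacement x₀ ℓ a =
      ℓ ⟨s(a, b), C.graph.mem_edgeSet.2 h⟩ • fun j => (C.slope a b j : ℝ) := by
  classical
  rw [displacement, displacement, ← Finset.sum_sub_distrib,
    Finset.sum_eq_single ⟨s(a, b), C.graph.mem_edgeSet.2 h⟩]
  · have hab := separates_of_adj C.isTree h
    by_cases hb : Separates C.graph s(a, b) (C.attach x₀) b
    · have ha : ¬ Separates C.graph s(a, b) (C.attach x₀) a := fun ha =>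
        not_separates_of_separates C.isTree.connected ha hb hab
      simp only [ind_true hb, ind_false ha, C.slope_eq_outDir x₀ h hb, mul_one, mul_zero, zero_smul,
        sub_zero]
    · have ha : Separates C.graph s(a, b) (C.attach x₀) a := by
        rw [separates_congr_left hb, separates_comm]
        exact hab
      have hsl := C.slope_swap h
      rw [C.slope_eq_outDir x₀ h.symm (by rwa [Sym2.eq_swap]), Sym2.eq_swap] at hsl
      simp only [ind_true ha, ind_false hb, hsl, mul_one, mul_zero, zero_smul, zero_sub]
      funext j
      simp
  · rintro ⟨e, he⟩ - hne
    have hne' : e ≠ s(a, b) := fun h => hne (Subtype.ext h)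
    have := separates_congr_right (a := C.attach x₀) (not_separates_of_adj h hne')
    simp only [this, sub_self]
  · intro h
    exact absurd (Finset.mem_univ _) h

theorem displacement_root (ℓ : C.graph.edgeSet → ℝ) :
    C.displacement x₀ ℓ (C.attach x₀) = 0 := by
  rw [displacement]
  exact Finset.sum_eq_zero fun e _ => by rw [ind_false (not_separates_self _ _)]; simp

theorem pos_eq (v : Fin C.n) :
    C.pos v = C.pos (C.attach x₀) + C.displacement x₀ (fun e => C.length e) v := by
  have := eq_of_forall_adj_sub_eq C.isTree.connected (r := C.attach x₀) (f := C.pos)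
    (g := fun v => C.pos (C.attach x₀) + C.displacement x₀ (fun e => C.length e) v)
    (by simp [displacement_root]) (fun a b h => by
      rw [add_sub_add_left_eq_sub, C.displacement_sub x₀ _ h, C.affine a b h,
        add_sub_cancel_left])
  exact congrFun this v

theorem toPoint_eq_param :
    C.toPoint x₀ = C.param x₀ (fun e => C.length e, C.pos (C.attach x₀)) := by
  refine Prod.ext ?_ (Prod.ext ?_ ?_)
  · funext c
    rw [param_fst]
    exact C.crossRatio_eq_sum c
  · rw [param_snd_fst]
    rfl
  · funext k
    by_cases hk : proj (Δ k) = 0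
    · rw [param_snd_snd _ _ _ _ hk, ← C.pos_eq x₀]
      simp [toPoint, hk]
    · rw [param_snd_snd_of_ne _ _ _ _ hk]
      simp [toPoint, hk]

/-- The stable maps with the combinatorial type of `C` lie in the image of its parametrization. -/
theorem toPoint_eq_param_of_sameType {C C' : StableMap Δ}
    (h : C'.toMarkedCurve.SameType C.toMarkedCurve) :
    ∃ ℓ : C.graph.edgeSet → ℝ, (∀ e, 0 < ℓ e) ∧
      C'.toPoint x₀ = C.param x₀ (ℓ, C'.pos (C'.attach x₀)) := by
  obtain ⟨φ, hφ⟩ := h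
  refine ⟨fun e => C'.length (φ.mapEdgeSet.symm e),
    fun e => C'.length_pos _ (φ.mapEdgeSet.symm e).2, ?_⟩
  rw [C'.toPoint_eq_param, param_apply, param_apply, ← φ.mapEdgeSet.sum_comp]
  congr 1
  refine Finset.sum_congr rfl fun e _ => ?_
  have hsplit : C.Split (φ.mapEdgeSet e) = C'.Split e := by
    funext i j
    rw [MarkedCurve.Split, MarkedCurve.Split, ← hφ, ← hφ]
    exact propext (MarkedCurve.separates_of_iso φ)
  rw [hsplit, Equiv.symm_apply_apply]

end StableMap

theorem MarkedCurve.card_edgeSet_add_one {ι : Type*} (C : MarkedCurve ι) :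
    Fintype.card C.graph.edgeSet + 1 = C.n := by
  have := C.isTree.card_edgeFinset
  rwa [SimpleGraph.edgeFinset_card, Fintype.card_fin] at this

theorem MarkedCurve.sum_valence (C : MarkedCurve ι) :
    ∑ v, C.valence v = 2 * Fintype.card C.graph.edgeSet + Fintype.card ι := by
  classical
  simp only [MarkedCurve.valence, Finset.sum_add_distrib]
  congr 1
  · have := C.graph.sum_degrees_eq_twice_card_edges
    simp only [SimpleGraph.edgeFinset, Set.toFinset_card, Fintype.card_eq_nat_card] at this
    rw [Fintype.card_eq_nat_card, ← this]
    refine Finset.sum_congr rfl fun v _ => ?_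
    rw [← SimpleGraph.card_neighborSet_eq_degree, ← Nat.card_coe_set_eq, Nat.card_eq_fintype_card]
  · have := Finset.card_eq_sum_card_fiberwise (f := C.attach) (s := Finset.univ)
      (t := Finset.univ) (fun _ _ => Finset.mem_coe.2 (Finset.mem_univ _))
    rw [Finset.card_univ] at this
    rw [this]
    refine Finset.sum_congr rfl fun v _ => ?_
    rw [← Set.ncard_coe_finset]
    congr 1
    ext i
    simp

/-- The linear data of a cell of top dimension of the moduli space: the points of its relative
interior are stable maps with `3`-valent vertices only. -/
theorem IsModuliSpace.exists_param {x₀ : ι} {M : TropicalCycle (moduliLattice Δ x₀)}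
    (hM : IsModuliSpace Δ x₀ M) {ρ : Set (Ambient ι)} (hρ : ρ ∈ M.facets) :
    ∃ C : StableMap Δ, (∀ v, C.valence v = 3) ∧ Function.Injective (C.param x₀) ∧
      vectorSpan ℝ ρ = LinearMap.range (C.param x₀) ∧
      ∀ y ∈ ρ, ∃ ℓ x, (∀ e, 0 ≤ ℓ e) ∧ y = C.param x₀ (ℓ, x) := by
  obtain ⟨hdim, hsupp, -, htype⟩ := hM
  obtain ⟨hρM, hρdim⟩ := TropicalCycle.mem_facets.1 hρ
  have hconv := (M.polyhedron ρ hρM).convex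
  obtain ⟨z, hz⟩ := (M.nonempty ρ hρM).intrinsicInterior hconv
  have hex : ∀ y ∈ ρ, ∃ C : StableMap Δ, C.toPoint x₀ = y := by
    intro y hy
    have : y ∈ ⋃ σ ∈ M.cells, σ := Set.mem_biUnion hρM hy
    rwa [hsupp] at this
  obtain ⟨C, hC⟩ := hex z (intrinsicInterior_subset hz)
  have hinner : ∀ y ∈ intrinsicInterior ℝ ρ, ∃ ℓ x, (∀ e, 0 < ℓ e) ∧ y = C.param x₀ (ℓ, x) := by
    intro y hy
    obtain ⟨C', hC'⟩ := hex y (intrinsicInterior_subset hy)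
    obtain ⟨ℓ, hℓ, h⟩ := StableMap.toPoint_eq_param_of_sameType x₀
      (htype ρ hρM C' C (hC'.symm ▸ hy) (hC.symm ▸ hz))
    exact ⟨ℓ, _, hℓ, hC' ▸ h⟩
  -- A point `y` of `ρ` is `2 m - z`, where `m` is the midpoint of `y` and `z`; both `m` and `z` are
  -- relative interior points.
  have hrange : ∀ y ∈ ρ, y ∈ LinearMap.range (C.param x₀) := by
    intro y hy
    obtain ⟨ℓ, x, -, h1⟩ := hinner z hz
    obtain ⟨ℓ', x', -, h2⟩ := hinner _ (lineMap_mem_intrinsicInterior hconv hy hz (t := 1 / 2)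
      (by norm_num) (by norm_num))
    refine ⟨(2 : ℝ) • (ℓ', x') - (ℓ, x), ?_⟩
    rw [map_sub, map_smul, ← h1, ← h2]
    module
  have hle : vectorSpan ℝ ρ ≤ LinearMap.range (C.param x₀) := by
    rw [vectorSpan_def, Submodule.span_le]
    rintro _ ⟨x, hx, y, hy, rfl⟩
    exact Submodule.sub_mem _ (hrange x hx) (hrange y hy)
  -- For `N` ends, `N = dim ρ ≤ rank ≤ #edges + 3`, while valences at least three give `#edges ≤ N -
  -- 3`. Equality throughout yields injectivity, 3-valence and the span at once.
  have hfin : Module.finrank ℝ (vectorSpan ℝ ρ) = Fintype.card ι := hρdim.trans hdim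
  have h3 : Module.finrank ℝ ((C.graph.edgeSet → ℝ) × (Fin 3 → ℝ)) =
      Fintype.card C.graph.edgeSet + 3 := by simp
  have h1 : Fintype.card ι ≤ Module.finrank ℝ (LinearMap.range (C.param x₀)) := by
    rw [← hfin]
    exact Submodule.finrank_mono hle
  have h2 : Module.finrank ℝ (LinearMap.range (C.param x₀)) +
      Module.finrank ℝ (LinearMap.ker (C.param x₀)) = Fintype.card C.graph.edgeSet + 3 := by
    rw [← h3]
    exact LinearMap.finrank_range_add_finrank_ker (C.param x₀)
  have h4 := C.card_edgeSet_add_one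
  have h5 := C.sum_valence
  have h6 : ∑ v : Fin C.n, 3 ≤ ∑ v, C.valence v :=
    Finset.sum_le_sum fun v _ => C.three_le_valence v
  have h7 : ∑ v : Fin C.n, 3 = 3 * C.n := by simp [mul_comm]
  have hinj : Function.Injective (C.param x₀) := by
    rw [← LinearMap.ker_eq_bot, ← Submodule.finrank_eq_zero (R := ℝ)]
    omega
  have h8 : Module.finrank ℝ (LinearMap.range (C.param x₀)) ≤ Fintype.card ι := by omega
  have heq : vectorSpan ℝ ρ = LinearMap.range (C.param x₀) :=
    Submodule.eq_of_le_of_finrank_le hle (h8.trans_eq hfin.symm)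
  refine ⟨C, fun v => ?_, hinj, heq, fun y hy => ?_⟩
  · have h9 : ∑ v : Fin C.n, 3 = ∑ v, C.valence v := by omega
    exact ((Finset.sum_eq_sum_iff_of_le fun v _ => C.three_le_valence v).1 h9 v
      (Finset.mem_univ v)).symm
  · obtain ⟨⟨ℓ, x⟩, hy'⟩ := hrange y hy
    obtain ⟨ℓz, xz, hℓz, hz'⟩ := hinner z hz
    refine ⟨ℓ, x, fun e => ?_, hy'.symm⟩
    by_contra hneg
    rw [not_le] at hneg
    have hpos := hℓz e
    -- The parameter at which the length of `e` vanishes on the segment from `y` to `z`; relative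
    -- interior points have positive lengths.
    set t : ℝ := -ℓ e / (ℓz e - ℓ e) with ht
    have hden : 0 < ℓz e - ℓ e := by linarith
    have ht0 : 0 < t := div_pos (by linarith) hden
    have ht1 : t ≤ 1 := by rw [ht, div_le_one hden]; linarith
    obtain ⟨ℓt, xt, hℓt, h⟩ := hinner _ (lineMap_mem_intrinsicInterior hconv hy hz ht0 ht1)
    rw [← hy', hz', ← map_smul, ← map_smul, ← map_add] at h
    have h := congrFun (congrArg Prod.fst (hinj h)) e
    have hlt := hℓt e
    simp only [Prod.smul_mk, Prod.mk_add_mk, Pi.add_apply, Pi.smul_apply, smul_eq_mul] at h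
    have htd : t * (ℓz e - ℓ e) = -ℓ e := div_mul_cancel₀ _ hden.ne'
    nlinarith

end Linearization

end TropicalFloor

namespace TropicalFloor

/-! ### The hexagonal convex function on the plane -/

section Plane

/-- The inclusion `ℤ² → ℝ²`. -/
noncomputable def castVec : (Fin 2 → ℤ) →+ (Fin 2 → ℝ) := (Int.castAddHom ℝ).compLeft (Fin 2)

theorem castVec_apply (x : Fin 2 → ℤ) (j : Fin 2) : castVec x j = x j := rfl

theorem castVec_eq_zero {x : Fin 2 → ℤ} : castVec x = 0 ↔ x = 0 := by
  refine ⟨fun h => ?_, fun h => by rw [h, map_zero]⟩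
  funext j
  have := congrFun h j
  simpa [castVec_apply] using this

theorem exists_smul_of_det_eq_zero {x y : Fin 2 → ℝ} (hy : y ≠ 0) (h : x 0 * y 1 = x 1 * y 0) :
    ∃ r : ℝ, x = r • y := by
  by_cases h0 : y 0 = 0
  · have h1 : y 1 ≠ 0 := fun h1 => hy (by funext j; fin_cases j <;> simp [h0, h1])
    refine ⟨x 1 / y 1, ?_⟩
    funext j
    fin_cases j
    · simp [h0, h1] at h ⊢
      exact h
    · simp [h1]
  · refine ⟨x 0 / y 0, ?_⟩
    funext j
    fin_cases j
    · simp [h0]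
    · simp only [Fin.mk_one, Pi.smul_apply, smul_eq_mul]
      field_simp
      linarith

/-- A gradient of the convex function `|x| + |y| + |x - y|` on `ℝ²`. -/
noncomputable def hexGrad (w : Fin 2 → ℝ) : (Fin 2 → ℝ) →ₗ[ℝ] ℝ :=
  let x : (Fin 2 → ℝ) →ₗ[ℝ] ℝ := LinearMap.proj 0
  let y : (Fin 2 → ℝ) →ₗ[ℝ] ℝ := LinearMap.proj 1
  Real.sign (w 0) • x + Real.sign (w 1) • y + Real.sign (w 0 - w 1) • (x - y)

theorem hexGrad_apply (w x : Fin 2 → ℝ) :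
    hexGrad w x = Real.sign (w 0) * x 0 + Real.sign (w 1) * x 1 +
      Real.sign (w 0 - w 1) * (x 0 - x 1) := by
  simp [hexGrad]

theorem sign_smul_of_pos {t : ℝ} (ht : 0 < t) (x : ℝ) : Real.sign (t * x) = Real.sign x := by
  rcases lt_trichotomy x 0 with h | h | h
  · rw [Real.sign_of_neg h, Real.sign_of_neg (mul_neg_of_pos_of_neg ht h)]
  · rw [h, mul_zero]
  · rw [Real.sign_of_pos h, Real.sign_of_pos (mul_pos ht h)]

theorem hexGrad_smul {t : ℝ} (ht : 0 < t) (w : Fin 2 → ℝ) : hexGrad (t • w) = hexGrad w := by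
  simp only [hexGrad, Pi.smul_apply, smul_eq_mul, ← mul_sub, sign_smul_of_pos ht]

theorem sign_add_mul_self_nonneg {r : ℝ} (hr : 0 ≤ r) (ξ x : ℝ) :
    0 ≤ (Real.sign (ξ + r * x) - Real.sign ξ) * x := by
  have hmono : ∀ {a b : ℝ}, a ≤ b → Real.sign a ≤ Real.sign b := by
    intro a b hab
    rcases lt_trichotomy a 0 with h | h | h
    · rw [Real.sign_of_neg h]
      rcases Real.sign_apply_eq b with h | h | h <;> rw [h] <;> norm_num
    · rw [h, Real.sign_zero]
      rcases (h ▸ hab : 0 ≤ b).eq_or_lt with h' | h'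
      · rw [← h', Real.sign_zero]
      · rw [Real.sign_of_pos h']
        exact zero_le_one
    · rw [Real.sign_of_pos h, Real.sign_of_pos (h.trans_le hab)]
  rcases le_total 0 x with hx | hx
  · exact mul_nonneg (sub_nonneg.2 (hmono (le_add_of_nonneg_right (mul_nonneg hr hx)))) hx
  · exact mul_nonneg_of_nonpos_of_nonpos
      (sub_nonpos.2 (hmono (add_le_of_nonpos_right (mul_nonpos_of_nonneg_of_nonpos hr hx)))) hx

/-- Monotonicity of the subgradient of a convex function, checked on each of the three absolute
values. -/
theorem hexGrad_mono {r : ℝ} (hr : 0 ≤ r) {w w' x : Fin 2 → ℝ} (h : w' - w = r • x) :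
    hexGrad w x ≤ hexGrad w' x := by
  obtain rfl : w' = w + r • x := by rw [← h, add_sub_cancel]
  have h0 := sign_add_mul_self_nonneg hr (w 0) (x 0)
  have h1 := sign_add_mul_self_nonneg hr (w 1) (x 1)
  have h2 := sign_add_mul_self_nonneg hr (w 0 - w 1) (x 0 - x 1)
  have h3 : (w 0 + r * x 0) - (w 1 + r * x 1) = w 0 - w 1 + r * (x 0 - x 1) := by ring
  simp only [hexGrad_apply, Pi.add_apply, Pi.smul_apply, smul_eq_mul, h3]
  linarith

theorem hexGrad_castVec (D u : Fin 2 → ℤ) :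
    hexGrad (castVec D) (castVec u) = ((Int.sign (D 0) * u 0 + Int.sign (D 1) * u 1 +
      Int.sign (D 0 - D 1) * (u 0 - u 1) : ℤ) : ℝ) := by
  simp only [hexGrad_apply, castVec_apply]
  push_cast
  rw [← Int.cast_sub, Real.sign_intCast, Real.sign_intCast, Real.sign_intCast]

theorem hexGrad_self_pos {D : Fin 2 → ℤ} (hD : D ≠ 0) :
    0 < hexGrad (castVec D) (castVec D) := by
  rw [hexGrad_castVec]
  have : D 0 ≠ 0 ∨ D 1 ≠ 0 := by
    by_contra! h
    exact hD (by funext j; fin_cases j <;> simp [h.1, h.2])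
  simp only [Int.sign_mul_self_eq_abs]
  have h0 := abs_nonneg (D 0)
  have h1 := abs_nonneg (D 1)
  have h2 := abs_nonneg (D 0 - D 1)
  have h3 : 0 < |D 0| ∨ 0 < |D 1| := this.imp abs_pos.2 abs_pos.2
  rw [Int.cast_pos]
  omega

/-- For `h(x, y) = |x| + |y| + |x - y|` the left side is at most `h(u) = 2` and the right side is
`h(D)`, a positive even integer. For the six lattice vectors with `h(D) = 2`, the convention `sign 0
= 0` leaves equality only at `D = u`. Integrality of the edge directions is essential here. -/
theorem hexGrad_std_le {D u : Fin 2 → ℤ} (hD : D ≠ 0) (hu : u ∈ standardDirections) :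
    hexGrad (castVec D) (castVec u) ≤ hexGrad (castVec D) (castVec D) ∧
    (hexGrad (castVec D) (castVec u) = hexGrad (castVec D) (castVec D) → D = u) := by
  have h0 : D 0 ≠ 0 ∨ D 1 ≠ 0 := by
    by_contra! h
    exact hD (by funext j; fin_cases j <;> simp [h.1, h.2])
  have hDu : D = u ↔ D 0 = u 0 ∧ D 1 = u 1 := by
    refine ⟨fun h => by rw [h]; exact ⟨rfl, rfl⟩, fun h => ?_⟩
    funext j
    fin_cases j
    exacts [h.1, h.2]
  rw [hexGrad_castVec, hexGrad_castVec, hDu, Int.cast_le, Int.cast_inj]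
  generalize D 0 = a at *
  generalize D 1 = b at *
  have hsign : ∀ x : ℤ, (x < 0 ∧ x.sign = -1) ∨ (x = 0 ∧ x.sign = 0) ∨ (0 < x ∧ x.sign = 1) := by
    intro x
    rcases lt_trichotomy x 0 with h | h | h
    · exact Or.inl ⟨h, Int.sign_eq_neg_one_of_neg h⟩
    · exact Or.inr (Or.inl ⟨h, by rw [h, Int.sign_zero]⟩)
    · exact Or.inr (Or.inr ⟨h, Int.sign_eq_one_of_pos h⟩)
  rcases hu with rfl | rfl | rfl <;>
  rcases hsign a with ⟨ha, ha'⟩ | ⟨ha, ha'⟩ | ⟨ha, ha'⟩ <;>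
  rcases hsign b with ⟨hb, hb'⟩ | ⟨hb, hb'⟩ | ⟨hb, hb'⟩ <;>
  rcases hsign (a - b) with ⟨hc, hc'⟩ | ⟨hc, hc'⟩ | ⟨hc, hc'⟩ <;>
  simp only [ha', hb', hc', Matrix.cons_val_zero, Matrix.cons_val_one] <;> omega

theorem hexGrad_std_neg {u u' : Fin 2 → ℤ} (hu : u ∈ standardDirections)
    (hu' : u' ∈ standardDirections) (h : u ≠ u') :
    hexGrad (castVec u) (castVec u') < 0 := by
  rw [hexGrad_castVec, Int.cast_lt_zero]
  rcases hu with rfl | rfl | rfl <;> rcases hu' with rfl | rfl | rfl <;>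
    first | exact absurd rfl h | decide

end Plane

/-! ### The moving part of a rigid deformation -/

section Rigidity

variable {ι : Type*}

theorem MarkedCurve.trivalent_cases [Finite ι] {C : MarkedCurve ι} {a : Fin C.n} (ha : C.valence a = 3)
    {i : ι} (hi : C.attach i = a) :
    (∀ b, ¬ C.graph.Adj a b) ∨
    (∃ j b, j ≠ i ∧ C.attach j = a ∧ C.graph.Adj a b ∧
      (∀ k, C.attach k = a → k = i ∨ k = j) ∧ ∀ b', C.graph.Adj a b' → b' = b) ∨
    ∃ b b', b ≠ b' ∧ C.graph.Adj a b ∧ C.graph.Adj a b' ∧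
      (∀ k, C.attach k = a → k = i) ∧ ∀ x, C.graph.Adj a x → x = b ∨ x = b' := by
  have hpos : (C.attach ⁻¹' {a} \ {i}).ncard + 1 = (C.attach ⁻¹' {a}).ncard :=
    Set.ncard_sdiff_singleton_add_one hi
  have hsum : (C.graph.neighborSet a).ncard + (C.attach ⁻¹' {a}).ncard = 3 := ha
  obtain h | h | h : (C.graph.neighborSet a).ncard = 0 ∨ (C.graph.neighborSet a).ncard = 1 ∨
      (C.graph.neighborSet a).ncard = 2 := by omega
  · left
    intro b hb
    rw [Set.ncard_eq_zero] at h
    exact (h ▸ hb : b ∈ (∅ : Set _))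
  · right; left
    obtain ⟨b, hb⟩ := Set.ncard_eq_one.1 h
    obtain ⟨j, hj⟩ := Set.ncard_eq_one.1 (show (C.attach ⁻¹' {a} \ {i}).ncard = 1 by omega)
    have hj' : j ∈ C.attach ⁻¹' {a} \ {i} := hj ▸ Set.mem_singleton j
    refine ⟨j, b, hj'.2, hj'.1, (hb ▸ Set.mem_singleton b : b ∈ C.graph.neighborSet a),
      fun k hk => ?_, fun b' hb' => ?_⟩
    · by_cases hki : k = i
      · exact Or.inl hki
      · exact Or.inr (hj ▸ (⟨hk, hki⟩ : k ∈ C.attach ⁻¹' {a} \ {i}) : k ∈ ({j} : Set ι))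
    · exact (hb ▸ hb' : b' ∈ ({b} : Set _))
  · right; right
    obtain ⟨b, b', hbb, hb⟩ := Set.ncard_eq_two.1 h
    have h0 := (Set.ncard_eq_zero).1 (show (C.attach ⁻¹' {a} \ {i}).ncard = 0 by omega)
    have hmem : ∀ x, C.graph.Adj a x ↔ x ∈ ({b, b'} : Set _) := fun x => by
      rw [← hb, SimpleGraph.mem_neighborSet]
    refine ⟨b, b', hbb, (hmem b).2 (by simp), (hmem b').2 (by simp), fun k hk => ?_,
      fun x hx => (hmem x).1 hx⟩
    by_contra hki
    exact (h0 ▸ (⟨hk, hki⟩ : k ∈ C.attach ⁻¹' {a} \ {i}) : k ∈ (∅ : Set ι))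

/-- An infinitesimal unbounded deformation `w` of a plane tropical curve with `3`-valent
combinatorial type `C`, edge directions `D` and end directions `d`, that is unique up to scaling
among the deformations which do not change the edges in `P` and respect the conditions at the
ends in `J`. -/
structure RigidRay (C : MarkedCurve ι) (D : Fin C.n → Fin C.n → Fin 2 → ℤ) (d : ι → Fin 2 → ℤ)
    (w : Fin C.n → Fin 2 → ℝ) (c : Sym2 (Fin C.n) → ℝ) (P : Set (Sym2 (Fin C.n)))
    (J : Set ι) : Prop where
  trivalent : ∀ v, C.valence v = 3
  swap : ∀ a b, C.graph.Adj a b → D b a = - D a b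
  balancing : ∀ v, ∀ (N : Finset (Fin C.n)) (A : Finset ι), (∀ x, x ∈ N ↔ C.graph.Adj v x) →
    (∀ i, i ∈ A ↔ C.attach i = v) → ∑ x ∈ N, D v x + ∑ i ∈ A, d i = 0
  standard : ∀ i, d i = 0 ∨ d i ∈ standardDirections
  nonneg : ∀ e ∈ C.graph.edgeSet, 0 ≤ c e
  affine : ∀ a b, C.graph.Adj a b → w b - w a = c s(a, b) • castVec (D a b)
  dir_ne_zero : ∀ a b, C.graph.Adj a b → s(a, b) ∉ P → D a b ≠ 0
  fixed : ∀ a b, C.graph.Adj a b → s(a, b) ∈ P → w b = w a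
  notMem : ∀ i b, d i ≠ 0 → C.graph.Adj (C.attach i) b → s(C.attach i, b) ∉ P
  contracted : ∀ j ∈ J, d j = 0
  on_standard : ∀ j ∈ J, w (C.attach j) ≠ 0 →
    ∃ u ∈ standardDirections, ∃ t : ℝ, 0 < t ∧ w (C.attach j) = t • castVec u
  unique : ∀ w' : Fin C.n → Fin 2 → ℝ,
    (∀ a b, C.graph.Adj a b → s(a, b) ∉ P → ∃ r : ℝ, w' b - w' a = r • castVec (D a b)) →
    (∀ a b, C.graph.Adj a b → s(a, b) ∈ P → w' b = w' a) →
    (∀ j ∈ J, ∃ r : ℝ, w' (C.attach j) = r • w (C.attach j)) → ∃ μ : ℝ, w' = μ • w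

namespace RigidRay

variable {C : MarkedCurve ι} {D : Fin C.n → Fin C.n → Fin 2 → ℤ} {d : ι → Fin 2 → ℤ}
  {w : Fin C.n → Fin 2 → ℝ} {c : Sym2 (Fin C.n) → ℝ} {P : Set (Sym2 (Fin C.n))} {J : Set ι}

theorem castVec_swap (h : RigidRay C D d w c P J) {a b : Fin C.n} (hab : C.graph.Adj a b) :
    castVec (D b a) = - castVec (D a b) := by
  rw [h.swap a b hab, map_neg]

/-- If a vertex whose edges are not in `P` can be moved on its own, then no other vertex moves. -/
theorem eq_zero_of_move_vertex (h : RigidRay C D d w c P J) {a : Fin C.n}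
    (ha : ∀ b, C.graph.Adj a b → s(a, b) ∉ P) {z : Fin 2 → ℝ} (hz : z ≠ 0)
    (hzD : ∀ b, C.graph.Adj a b → ∃ r : ℝ, z = r • castVec (D a b))
    (hzJ : ∀ j ∈ J, C.attach j = a → ∃ r : ℝ, z = r • w a) :
    ∀ v, v ≠ a → w v = 0 := by
  -- Test deformation: `a` moves by `z` and all other vertices rest. Rigidity makes it a nonzero
  -- multiple of `w`.
  obtain ⟨μ, hμ⟩ := h.unique (Function.update 0 a z)
    (fun x y hxy _ => by
      by_cases hx : x = a
      · subst hx
        obtain ⟨r, hr⟩ := hzD y hxy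
        refine ⟨-r, ?_⟩
        rw [Function.update_self, Function.update_of_ne hxy.ne', hr]
        simp
      · by_cases hy : y = a
        · subst hy
          obtain ⟨r, hr⟩ := hzD x hxy.symm
          refine ⟨-r, ?_⟩
          rw [Function.update_self, Function.update_of_ne hx, hr, h.castVec_swap hxy]
          simp
        · exact ⟨0, by rw [Function.update_of_ne hx, Function.update_of_ne hy]; simp⟩)
    (fun x y hxy hP => by
      by_cases hx : x = a
      · subst hx
        exact absurd hP (ha y hxy)
      · by_cases hy : y = a
        · subst hy
          exact absurd hP (by rw [Sym2.eq_swap]; exact ha x hxy.symm)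
        · rw [Function.update_of_ne hx, Function.update_of_ne hy]; rfl)
    (fun j hj => by
      by_cases hja : C.attach j = a
      · rw [hja, Function.update_self]
        exact hzJ j hj hja
      · exact ⟨0, by rw [Function.update_of_ne hja]; simp⟩)
  have hμ0 : μ ≠ 0 := by
    rintro rfl
    refine hz ?_
    have := congrFun hμ a
    simpa using this
  intro v hv
  have := congrFun hμ v
  rw [Function.update_of_ne hv] at this
  exact (smul_eq_zero.1 this.symm).resolve_left hμ0

theorem balancing_of_one (h : RigidRay C D d w c P J) {a b : Fin C.n} {i j : ι} (hij : j ≠ i)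
    (hi : C.attach i = a) (hj : C.attach j = a) (hb : C.graph.Adj a b)
    (hk : ∀ k, C.attach k = a → k = i ∨ k = j) (hb' : ∀ b', C.graph.Adj a b' → b' = b) :
    D a b + (d i + d j) = 0 := by
  classical
  have := h.balancing a {b} {i, j} (fun x => by
    rw [Finset.mem_singleton]
    exact ⟨fun hx => hx ▸ hb, hb' x⟩) (fun k => by
    rw [Finset.mem_insert, Finset.mem_singleton]
    refine ⟨?_, hk k⟩
    rintro (rfl | rfl)
    exacts [hi, hj])
  rwa [Finset.sum_singleton, Finset.sum_pair hij.symm] at this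

theorem balancing_of_two (h : RigidRay C D d w c P J) {a b b' : Fin C.n} {i : ι} (hbb : b ≠ b')
    (hi : C.attach i = a) (hb : C.graph.Adj a b) (hb' : C.graph.Adj a b')
    (hk : ∀ k, C.attach k = a → k = i) (hx : ∀ x, C.graph.Adj a x → x = b ∨ x = b') :
    D a b + D a b' + d i = 0 := by
  classical
  have := h.balancing a {b, b'} {i} (fun x => by
    rw [Finset.mem_insert, Finset.mem_singleton]
    refine ⟨?_, hx x⟩
    rintro (rfl | rfl)
    exacts [hb, hb']) (fun k => by
    rw [Finset.mem_singleton]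
    exact ⟨fun hx => hx ▸ hi, hk k⟩)
  rwa [Finset.sum_singleton, Finset.sum_pair hbb] at this

/-- A vertex with an end of nonzero direction and two neighbours has a neighbour that does not
move, unless it does not move itself. -/
theorem eq_zero_of_two_neighbors (h : RigidRay C D d w c P J) {a b b' : Fin C.n} {i : ι}
    (hbb : b ≠ b') (hi : C.attach i = a) (hdi : d i ≠ 0) (hb : C.graph.Adj a b)
    (hb' : C.graph.Adj a b') (hk : ∀ k, C.attach k = a → k = i)
    (hx : ∀ x, C.graph.Adj a x → x = b ∨ x = b') : w b = 0 ∨ w b' = 0 := by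
  classical
  by_cases hb0 : w b = 0
  · exact Or.inl hb0
  have hP : ∀ x, C.graph.Adj a x → s(a, x) ∉ P := fun x hax =>
    hi ▸ h.notMem i x hdi (hi ▸ hax)
  have hJ : ∀ j ∈ J, C.attach j ≠ a := fun j hj hja =>
    hdi (hk j hja ▸ h.contracted j hj)
  set p := castVec (D a b)
  set p' := castVec (D a b')
  have hp0 : p ≠ 0 := fun h0 => h.dir_ne_zero a b hb (hP b hb) (castVec_eq_zero.1 h0)
  have hp0' : p' ≠ 0 := fun h0 => h.dir_ne_zero a b' hb' (hP b' hb') (castVec_eq_zero.1 h0)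
  -- If the two edges are parallel, then `a` can slide along their common line on its own.
  by_cases hdet : p 0 * p' 1 = p 1 * p' 0
  · left
    refine h.eq_zero_of_move_vertex hP hp0 (fun x hax => ?_)
      (fun j hj hja => absurd hja (hJ j hj)) b hb.ne'
    rcases hx x hax with rfl | rfl
    · exact ⟨1, by rw [one_smul]⟩
    · exact exists_smul_of_det_eq_zero hp0' hdet
  right
  -- `t • p'` is the intersection of the line through `w b` in direction `p` with the line through
  -- the origin in direction `p'`.
  obtain ⟨t, ht⟩ : ∃ t : ℝ, ∃ r : ℝ, w b - t • p' = r • p := by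
    refine ⟨(w b 0 * p 1 - w b 1 * p 0) / (p' 0 * p 1 - p' 1 * p 0),
      exists_smul_of_det_eq_zero hp0 ?_⟩
    have : p' 0 * p 1 - p' 1 * p 0 ≠ 0 := fun h0 => hdet (by linarith)
    simp only [Pi.sub_apply, Pi.smul_apply, smul_eq_mul]
    field_simp
    ring
  -- Test deformation: the branch of `b` keeps its motion, that of `b'` stops, and `a` goes to the
  -- intersection point. Conditions at the ends in `J` survive, as each such end moves by `1` or `0`
  -- times its old motion. Since `w'` vanishes at `b'` but not at `b`, it can be a multiple of `w`
  -- only if `w b' = 0`.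
  set w' : Fin C.n → Fin 2 → ℝ := fun v =>
    if v = a then t • p' else if Separates C.graph s(a, b) a v then w v else 0 with hw'
  have hwa : w' a = t • p' := if_pos rfl
  have hwn : ∀ v, v ≠ a → w' v = if Separates C.graph s(a, b) a v then w v else 0 :=
    fun v hv => if_neg hv
  have hab := separates_of_adj C.isTree hb
  have hwb : w' b = w b := by rw [hwn b hb.ne', if_pos hab]
  have hwb' : w' b' = 0 := by
    rw [hwn b' hb'.ne', if_neg]
    exact fun hs => hbb (eq_of_separates C.isTree hs (separates_of_adj C.isTree hb'))
  have hedge : ∀ x, C.graph.Adj a x → ∃ r : ℝ, w' x - w' a = r • castVec (D a x) := by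
    intro x hax
    rcases hx x hax with rfl | rfl
    · rw [hwa, hwb]
      exact ht
    · exact ⟨-t, by rw [hwa, hwb', zero_sub, neg_smul]⟩
  have hsep : ∀ x y, C.graph.Adj x y → x ≠ a → y ≠ a →
      (Separates C.graph s(a, b) a x ↔ Separates C.graph s(a, b) a y) := by
    intro x y hxy hxa hya
    refine separates_congr_right (not_separates_of_adj hxy fun he => ?_)
    rcases Sym2.eq_iff.1 he with ⟨h1, -⟩ | ⟨h1, -⟩
    exacts [hxa h1.symm, hya h1.symm]
  obtain ⟨μ, hμ⟩ := h.unique w'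
    (fun x y hxy _ => by
      by_cases hxa : x = a
      · subst hxa
        exact hedge y hxy
      · by_cases hya : y = a
        · subst hya
          obtain ⟨r, hr⟩ := hedge x hxy.symm
          refine ⟨r, ?_⟩
          rw [h.castVec_swap hxy.symm, smul_neg, ← hr, neg_sub]
        · rw [hwn x hxa, hwn y hya]
          by_cases hs : Separates C.graph s(a, b) a x
          · rw [if_pos hs, if_pos ((hsep x y hxy hxa hya).1 hs)]
            exact ⟨_, h.affine x y hxy⟩
          · rw [if_neg hs, if_neg fun hs' => hs ((hsep x y hxy hxa hya).2 hs')]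
            exact ⟨0, by simp⟩)
    (fun x y hxy hxyP => by
      by_cases hxa : x = a
      · subst hxa
        exact absurd hxyP (hP y hxy)
      · by_cases hya : y = a
        · subst hya
          exact absurd hxyP (by rw [Sym2.eq_swap]; exact hP x hxy.symm)
        · rw [hwn x hxa, hwn y hya]
          by_cases hs : Separates C.graph s(a, b) a x
          · rw [if_pos hs, if_pos ((hsep x y hxy hxa hya).1 hs)]
            exact h.fixed x y hxy hxyP
          · rw [if_neg hs, if_neg fun hs' => hs ((hsep x y hxy hxa hya).2 hs')])
    (fun j hj => by
      rw [hwn _ (hJ j hj)]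
      split_ifs
      · exact ⟨1, by rw [one_smul]⟩
      · exact ⟨0, by rw [zero_smul]⟩)
  by_contra hne
  have hμ0 : μ = 0 := by
    have := congrFun hμ b'
    rw [hwb'] at this
    exact (smul_eq_zero.1 this.symm).resolve_right hne
  refine hb0 ?_
  have := congrFun hμ b
  rw [hwb, hμ0] at this
  simpa using this

open scoped Classical in
/-- The flow of the gradient field `hexGrad w` out of a vertex to other moving vertices. -/
noncomputable def outflow (C : MarkedCurve ι) (D : Fin C.n → Fin C.n → Fin 2 → ℤ)
    (w : Fin C.n → Fin 2 → ℝ) (a : Fin C.n) : ℝ :=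
  ∑ b, if C.graph.Adj a b ∧ w a ≠ 0 ∧ w b ≠ 0 then hexGrad (w a) (castVec (D a b)) else 0

/-- The two directions of an edge together contribute `hexGrad (w a) D - hexGrad (w b) D` with `D =
D a b`. This is nonpositive because `w b - w a` is a nonnegative multiple of `D`. -/
theorem sum_outflow_nonpos (h : RigidRay C D d w c P J) : ∑ a, outflow C D w a ≤ 0 := by
  classical
  set F : Fin C.n → Fin C.n → ℝ := fun a b =>
    if C.graph.Adj a b ∧ w a ≠ 0 ∧ w b ≠ 0 then hexGrad (w a) (castVec (D a b)) else 0
  have hF : ∀ a b, F a b + F b a ≤ 0 := by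
    intro a b
    by_cases hab : C.graph.Adj a b ∧ w a ≠ 0 ∧ w b ≠ 0
    · have h1 : F a b = hexGrad (w a) (castVec (D a b)) := if_pos hab
      have h2 : F b a = hexGrad (w b) (castVec (D b a)) :=
        if_pos ⟨hab.1.symm, hab.2.2, hab.2.1⟩
      have h3 := hexGrad_mono (h.nonneg _ (C.graph.mem_edgeSet.2 hab.1)) (h.affine a b hab.1)
      rw [h1, h2, h.castVec_swap hab.1, map_neg]
      linarith
    · have h1 : F a b = 0 := if_neg hab
      have h2 : F b a = 0 := if_neg fun h => hab ⟨h.1.symm, h.2.2, h.2.1⟩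
      rw [h1, h2, add_zero]
  have hsum : ∑ a, ∑ b, F a b + ∑ a, ∑ b, F a b ≤ 0 := by
    conv_lhs =>
      rhs
      rw [Finset.sum_comm]
    rw [← Finset.sum_add_distrib]
    refine Finset.sum_nonpos fun a _ => ?_
    rw [← Finset.sum_add_distrib]
    exact Finset.sum_nonpos fun b _ => hF a b
  have : ∑ a, outflow C D w a = ∑ a, ∑ b, F a b := rfl
  linarith

theorem eq_smul_of_neighbor_eq_zero (h : RigidRay C D d w c P J) {a b : Fin C.n}
    (hab : C.graph.Adj a b) (hb : w b = 0) : w a = c s(a, b) • castVec (D b a) := by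
  have := h.affine b a hab.symm
  rwa [hb, sub_zero, Sym2.eq_swap] at this

/-- Next to a resting vertex, `w a` is a positive multiple of the edge direction, and `hexGrad`
depends only on the ray. -/
theorem hexGrad_eq_of_neighbor_eq_zero (h : RigidRay C D d w c P J) {a b : Fin C.n}
    (hab : C.graph.Adj a b) (ha : w a ≠ 0) (hb : w b = 0) :
    0 < c s(a, b) ∧ D b a ≠ 0 ∧ hexGrad (w a) = hexGrad (castVec (D b a)) := by
  have heq := h.eq_smul_of_neighbor_eq_zero hab hb
  have hc : 0 < c s(a, b) := (h.nonneg _ (C.graph.mem_edgeSet.2 hab)).lt_of_ne' fun h0 =>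
    ha (by rw [heq, h0, zero_smul])
  refine ⟨hc, fun h0 => ha (by rw [heq, h0, map_zero, smul_zero]), ?_⟩
  rw [heq, hexGrad_smul hc]

/-- At a vertex without ends of nonzero direction, the outflow to moving vertices equals the inflow
from the vertices at rest. -/
theorem outflow_eq [Fintype ι] (h : RigidRay C D d w c P J) {a : Fin C.n} (ha : w a ≠ 0)
    (hd : ∀ i, C.attach i = a → d i = 0) [DecidablePred fun b => C.graph.Adj a b ∧ w b = 0] :
    outflow C D w a =
      ∑ b, if C.graph.Adj a b ∧ w b = 0 then hexGrad (w a) (castVec (D b a)) else 0 := by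
  classical
  have hbal := h.balancing a (Finset.univ.filter fun x => C.graph.Adj a x)
    (Finset.univ.filter fun i => C.attach i = a) (by simp) (by simp)
  rw [Finset.sum_eq_zero (s := Finset.univ.filter fun i => C.attach i = a)
    (fun i hi => hd i (Finset.mem_filter.1 hi).2), add_zero] at hbal
  have hbal := congrArg (fun x => hexGrad (w a) (castVec x)) hbal
  simp only [map_sum, map_zero, Finset.sum_filter] at hbal
  rw [outflow, ← sub_eq_zero, ← Finset.sum_sub_distrib]
  refine (Finset.sum_congr rfl fun b _ => ?_).trans hbal
  by_cases hab : C.graph.Adj a b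
  · by_cases hb : w b = 0
    · simp [hab, hb, h.castVec_swap hab]
    · simp [hab, ha, hb]
  · simp [hab]

theorem inflow_pos (h : RigidRay C D d w c P J) {a b : Fin C.n} (hab : C.graph.Adj a b)
    (ha : w a ≠ 0) (hb : w b = 0) : 0 < hexGrad (w a) (castVec (D b a)) := by
  obtain ⟨-, hD, hG⟩ := h.hexGrad_eq_of_neighbor_eq_zero hab ha hb
  rw [hG]
  exact hexGrad_self_pos hD

theorem outflow_of_one {a b : Fin C.n} (ha : w a ≠ 0) (hab : C.graph.Adj a b)
    (hb' : ∀ b', C.graph.Adj a b' → b' = b) :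
    (w b = 0 → outflow C D w a = 0) ∧
    (w b ≠ 0 → outflow C D w a = hexGrad (w a) (castVec (D a b))) := by
  rw [outflow, Finset.sum_eq_single b (fun x _ hx => if_neg fun hh => hx (hb' x hh.1))
    (fun hh => absurd (Finset.mem_univ b) hh)]
  exact ⟨fun hb => if_neg fun hh => hh.2.2 hb, fun hb => if_pos ⟨hab, ha, hb⟩⟩

theorem outflow_of_two {a b b' : Fin C.n} (ha : w a ≠ 0) (hab' : C.graph.Adj a b')
    (hx : ∀ x, C.graph.Adj a x → x = b ∨ x = b') (hb : w b = 0) :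
    (w b' = 0 → outflow C D w a = 0) ∧
    (w b' ≠ 0 → outflow C D w a = hexGrad (w a) (castVec (D a b'))) := by
  rw [outflow, Finset.sum_eq_single b' (fun x _ hxb => if_neg fun hh =>
      hh.2.2 (((hx x hh.1).resolve_right hxb) ▸ hb))
    (fun hh => absurd (Finset.mem_univ b') hh)]
  exact ⟨fun hb => if_neg fun hh => hh.2.2 hb, fun hb => if_pos ⟨hab', ha, hb⟩⟩

/-- If no end at `a` has a nonzero direction, balancing turns the outflow into a sum of positive
inflows from resting neighbours. Otherwise at most one neighbour moves, by 3-valence and rigidity,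
and the outflow is a single term controlled by `hexGrad_std_neg` or `hexGrad_std_le`. -/
theorem outflow_nonneg [Fintype ι] (h : RigidRay C D d w c P J)
    (a : Fin C.n) : 0 ≤ outflow C D w a := by
  classical
  by_cases ha : w a = 0
  · rw [outflow]
    exact (Finset.sum_eq_zero fun b _ => if_neg fun hh => hh.2.1 ha).ge
  by_cases hE : ∀ i, C.attach i = a → d i = 0
  · rw [h.outflow_eq ha hE]
    refine Finset.sum_nonneg fun b _ => ?_
    split_ifs with hb
    · exact (h.inflow_pos hb.1 ha hb.2).le
    · exact le_rfl
  push Not at hE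
  obtain ⟨i, hi, hdi⟩ := hE
  have hstd := (h.standard i).resolve_left hdi
  have hP : ∀ x, C.graph.Adj a x → s(a, x) ∉ P := fun x hax =>
    hi ▸ h.notMem i x hdi (hi ▸ hax)
  rcases MarkedCurve.trivalent_cases (h.trivalent a) hi with hno | ⟨j, b, hji, hj, hab, hk, hb'⟩ |
    ⟨b, b', hbb, hab, hab', hk, hx⟩
  · rw [outflow]
    exact (Finset.sum_eq_zero fun b _ => if_neg fun hh => hno b hh.1).ge
  · obtain ⟨h0, h1⟩ := outflow_of_one (D := D) ha hab hb'
    by_cases hb : w b = 0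
    · exact (h0 hb).ge
    have hbal := h.balancing_of_one hji hi hj hab hk hb'
    have hab0 : castVec (D a b) ≠ 0 := fun hz =>
      h.dir_ne_zero a b hab (hP b hab) (castVec_eq_zero.1 hz)
    -- Without a condition at `a`, this vertex could slide along its only edge, and `b` would rest.
    have hjJ : ∃ k ∈ J, C.attach k = a := by
      by_contra! hn
      exact hb (h.eq_zero_of_move_vertex hP hab0
        (fun x hax => ⟨1, by rw [hb' x hax, one_smul]⟩)
        (fun k hkJ hka => absurd hka (hn k hkJ)) b hab.ne')
    obtain ⟨k, hkJ, hka⟩ := hjJ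
    have hkj : k = j := (hk k hka).resolve_left fun hki => hdi (hki ▸ h.contracted k hkJ)
    rw [← hkj, h.contracted k hkJ, add_zero] at hbal
    have hDi : D a b = - d i := eq_neg_of_add_eq_zero_left hbal
    obtain ⟨u, hu, t, ht, hwt⟩ := h.on_standard k hkJ (hka ▸ ha)
    rw [hka] at hwt
    rw [h1 hb, hDi, map_neg, map_neg, hwt, hexGrad_smul ht]
    -- If `a` moves in the direction of its own end, it moves along its only edge, and rigidity
    -- would stop `b`. Any other standard direction gives a positive outflow.
    by_cases hui : u = d i
    · refine absurd (h.eq_zero_of_move_vertex hP ha (fun x hax => ⟨-t, ?_⟩)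
        (fun k' _ hk' => ⟨1, by rw [one_smul]⟩) b hab.ne') hb
      rw [hb' x hax, hDi, hwt, hui, map_neg, neg_smul_neg]
    · exact (neg_pos.2 (hexGrad_std_neg hu hstd hui)).le
  · have key : ∀ {b b' : Fin C.n}, b ≠ b' → C.graph.Adj a b → C.graph.Adj a b' →
        (∀ x, C.graph.Adj a x → x = b ∨ x = b') → w b = 0 → 0 ≤ outflow C D w a := by
      intro b b' hbb hab hab' hx hb
      obtain ⟨h0, h1⟩ := outflow_of_two (D := D) ha hab' hx hb
      by_cases hw' : w b' = 0
      · exact (h0 hw').ge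
      have hbal := h.balancing_of_two hbb hi hab hab' hk hx
      obtain ⟨-, hD, hG⟩ := h.hexGrad_eq_of_neighbor_eq_zero hab ha hb
      have hDb' : D a b' = D b a - d i := by
        rw [h.swap a b hab, ← sub_eq_zero, ← hbal]
        abel
      rw [h1 hw', hDb', hG, map_sub, map_sub, sub_nonneg]
      exact (hexGrad_std_le hD hstd).1
    rcases h.eq_zero_of_two_neighbors hbb hi hdi hab hab' hk hx with hb | hb
    · exact key hbb hab hab' hx hb
    · exact key hbb.symm hab' hab (fun x hax => (hx x hax).symm) hb

theorem outflow_eq_zero [Fintype ι] (h : RigidRay C D d w c P J)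
    (a : Fin C.n) : outflow C D w a = 0 := by
  have h1 := h.sum_outflow_nonpos
  have h2 : ∀ a ∈ Finset.univ, 0 ≤ outflow C D w a := fun a _ => h.outflow_nonneg a
  exact (Finset.sum_eq_zero_iff_of_nonneg h2).1 (le_antisymm h1 (Finset.sum_nonneg h2)) a
    (Finset.mem_univ a)

/-- The moving part of a rigid unbounded deformation consists of a single vertex, which is adjacent
to an end of standard direction. -/
theorem exists_end [Fintype ι] (h : RigidRay C D d w c P J) {x₀ q : ι} (hx₀ : w (C.attach x₀) = 0)
    (hq : w (C.attach q) ≠ 0) (hdq : d q = 0) :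
    ∃ i b, d i ∈ standardDirections ∧ C.attach i = C.attach q ∧ C.graph.Adj (C.attach q) b ∧
      (∀ k, C.attach k = C.attach q → k = i ∨ k = q) ∧
      (∀ b', C.graph.Adj (C.attach q) b' → b' = b) ∧
      0 < c s(C.attach q, b) ∧ w (C.attach q) = c s(C.attach q, b) • castVec (d i) := by
  classical
  obtain ⟨p⟩ := C.isTree.connected.preconnected (C.attach q) (C.attach x₀)
  obtain ⟨⟨⟨a, b⟩, hab⟩, -, ha, hb⟩ := p.exists_boundary_dart {v | w v ≠ 0} hq (not_not.2 hx₀)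
  change C.graph.Adj a b at hab
  change w a ≠ 0 at ha
  replace hb : w b = 0 := not_not.1 hb
  have hflow := h.outflow_eq_zero a
  -- Otherwise the inflow from the resting vertex `b` would make the outflow of `a` positive.
  obtain ⟨i, hi, hdi⟩ : ∃ i, C.attach i = a ∧ d i ≠ 0 := by
    by_contra! hn
    rw [h.outflow_eq ha hn] at hflow
    have := (Finset.sum_eq_zero_iff_of_nonneg (fun x _ => by
      split_ifs with hx
      · exact (h.inflow_pos hx.1 ha hx.2).le
      · exact le_rfl)).1 hflow b (Finset.mem_univ b)
    rw [if_pos ⟨hab, hb⟩] at this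
    exact (h.inflow_pos hab ha hb).ne' this
  have hstd := (h.standard i).resolve_left hdi
  have hP : ∀ x, C.graph.Adj a x → s(a, x) ∉ P := fun x hax =>
    hi ▸ h.notMem i x hdi (hi ▸ hax)
  -- If all neighbours rest, then `a` can move alone, so it is the only moving vertex and must carry
  -- `q`.
  have hqa : (∀ x, C.graph.Adj a x → w x = 0) → C.attach q = a := by
    intro hrest
    by_contra hne
    refine hq (h.eq_zero_of_move_vertex hP ha (fun x hax => ?_)
      (fun k' _ hk' => ⟨1, by rw [one_smul]⟩) _ hne)
    refine ⟨-c s(a, x), ?_⟩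
    rw [h.eq_smul_of_neighbor_eq_zero hax (hrest x hax), h.castVec_swap hax, neg_smul, smul_neg]
  obtain ⟨hc, hD, hG⟩ := h.hexGrad_eq_of_neighbor_eq_zero hab ha hb
  -- A second neighbour `b'` is impossible. If it rests, `q` would be the end `i`, but their
  -- directions differ. If it moves, vanishing outflow is the equality case `D b a = d i`, and the
  -- edge to `b'` would have direction zero.
  have key : ∀ b', b' ≠ b → C.graph.Adj a b' → (∀ k, C.attach k = a → k = i) →
      (∀ x, C.graph.Adj a x → x = b ∨ x = b') → False := by
    intro b' hbb hab' hk hx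
    by_cases hw' : w b' = 0
    · have hqa := hqa fun x hax => by
        rcases hx x hax with rfl | rfl
        exacts [hb, hw']
      exact hdi (hk q hqa ▸ hdq)
    · have hbal := h.balancing_of_two hbb.symm hi hab hab' hk hx
      have hDb' : D a b' = D b a - d i := by
        rw [h.swap a b hab, ← sub_eq_zero, ← hbal]
        abel
      rw [(outflow_of_two ha hab' hx hb).2 hw', hDb', hG, map_sub, map_sub, sub_eq_zero] at hflow
      have := (hexGrad_std_le hD hstd).2 hflow.symm
      rw [this, sub_self] at hDb'
      exact h.dir_ne_zero a b' hab' (hP b' hab') hDb'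
  rcases MarkedCurve.trivalent_cases (h.trivalent a) hi with hno | ⟨j, b₁, hji, hj, -, hk, hb'⟩ |
    ⟨b₁, b₂, hbb, hab₁, hab₂, hk, hx⟩
  · exact absurd hab (hno b)
  · have hbb₁ := hb' b hab
    have hqa := hqa fun x hax => by rw [hb' x hax, ← hbb₁]; exact hb
    have hqj : q = j := (hk q hqa).resolve_left fun hqi => hdi (hqi ▸ hdq)
    have hbal := h.balancing_of_one hji hi hj hab hk (fun x hax => by rw [hb' x hax, hbb₁])
    rw [← hqj, hdq, add_zero] at hbal
    have hDi : D b a = d i := by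
      rw [h.swap a b hab, eq_neg_of_add_eq_zero_left hbal, neg_neg]
    refine ⟨i, b, hstd, ?_⟩
    rw [hqa]
    refine ⟨hi, hab, fun k hka => hqj ▸ hk k hka, fun x hax => by rw [hb' x hax, hbb₁], hc, ?_⟩
    rw [← hDi]
    exact h.eq_smul_of_neighbor_eq_zero hab hb
  · rcases hx b hab with rfl | rfl
    · exact (key b₂ hbb.symm hab₂ hk hx).elim
    · exact (key b₁ hbb hab₁ hk fun x hax => (hx x hax).symm).elim

end RigidRay

end Rigidity

end TropicalFloor

namespace TropicalFloor

/-! ### Linear form of the conditions -/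

section Conditions

variable {V : Type*} [NormedAddCommGroup V] [NormedSpace ℝ V]

/-- The function `max (f - b) 0` together with the two affine functions it is the maximum of. -/
noncomputable def maxPair (f : V →ₗ[ℝ] ℝ) (b : ℝ) : (V → ℝ) × Set ((V →ₗ[ℝ] ℝ) × ℝ) :=
  (fun x => max (f x - b) 0, {(f, -b), (0, 0)})

theorem isMaxOf_maxPair (f : V →ₗ[ℝ] ℝ) (b : ℝ) :
    IsMaxOf (maxPair f b).1 (maxPair f b).2 := by
  intro x
  refine ⟨?_, ?_⟩
  · rcases max_choice (f x - b) 0 with h | h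
    · exact ⟨(f, -b), Or.inl rfl, by simpa [maxPair, sub_eq_add_neg] using h⟩
    · exact ⟨(0, 0), Or.inr rfl, by simpa [maxPair] using h⟩
  · rintro a (rfl | rfl)
    · simp [maxPair, sub_eq_add_neg]
    · simp [maxPair]

/-- A nonzero difference must pair the two different affine pieces, and `τ` lies where these agree.
-/
theorem IsCut.of_maxPair {f : V →ₗ[ℝ] ℝ} {b : ℝ} {τ : Set V} {ℓ : V →ₗ[ℝ] ℝ}
    (h : IsCut (maxPair f b).2 τ ℓ) : (ℓ = f ∨ ℓ = -f) ∧ ∀ x ∈ τ, f x = b := by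
  obtain ⟨a, ha, a', ha', hℓ, h0, hx⟩ := h
  rcases ha with rfl | rfl <;> rcases ha' with rfl | rfl
  · exact absurd hℓ (by simpa using h0)
  · refine ⟨Or.inl (by simpa using hℓ), fun x hxτ => ?_⟩
    have := (hx x hxτ).1
    simp only [LinearMap.zero_apply, add_zero] at this
    linarith
  · refine ⟨Or.inr (by simpa using hℓ), fun x hxτ => ?_⟩
    have := (hx x hxτ).1
    simp only [LinearMap.zero_apply, add_zero] at this
    linarith
  · exact absurd hℓ (by simpa using h0)

variable {ι : Type*}

/-- The coordinates of the contracted end. -/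
def evCoord (ι : Type*) (j : Fin 3) : Ambient ι →ₗ[ℝ] ℝ where
  toFun x := x.2.1 j
  map_add' _ _ := rfl
  map_smul' _ _ := rfl

/-- The coordinates of the forgetful maps to `M_{0,4}`. -/
def crossCoord (c : Fin 4 ↪ ι) : Ambient ι →ₗ[ℝ] ℝ where
  toFun x := x.1 c
  map_add' _ _ := rfl
  map_smul' _ _ := rfl

/-- The coordinates of the evaluation `∂ev_k`. -/
def tangencyCoord (k : ι) (j : Fin 2) : Ambient ι →ₗ[ℝ] ℝ where
  toFun x := tangencyEv k x j
  map_add' _ _ := by rw [map_add]; rfl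
  map_smul' _ _ := by rw [map_smul]; rfl

/-- The linear part of the monomial with exponent `a` of a tropical polynomial, pulled back along
`∂ev_k`. -/
noncomputable def monomialForm (k : ι) (a : ℕ × ℕ) : Ambient ι →ₗ[ℝ] ℝ :=
  (a.1 : ℝ) • tangencyCoord k 0 + (a.2 : ℝ) • tangencyCoord k 1

theorem monomialForm_apply (k : ι) (a : ℕ × ℕ) (x : Ambient ι) :
    monomialForm k a x = a.1 * tangencyEv k x 0 + a.2 * tangencyEv k x 1 := rfl

/-- The function that cuts out `∂ev_k^*(L)` together with the affine functions it is the maximum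
of. -/
noncomputable def curvePair (L : PlaneCurve) (k : ι) :
    (Ambient ι → ℝ) × Set ((Ambient ι →ₗ[ℝ] ℝ) × ℝ) :=
  (tangencyCurveFunction L k, {b | ∃ a ∈ L.exponents, b = (monomialForm k a, L.coeff a)})

theorem isMaxOf_curvePair [Fintype ι] (L : PlaneCurve) (k : ι) :
    IsMaxOf (curvePair L k).1 (curvePair L k).2 := by
  intro x
  refine ⟨?_, ?_⟩
  · obtain ⟨a, ha, h⟩ := Finset.exists_mem_eq_sup' ⟨_, L.zero_mem⟩
      fun a : ℕ × ℕ => a.1 * tangencyEv k x 0 + a.2 * tangencyEv k x 1 + L.coeff a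
    exact ⟨_, ⟨a, ha, rfl⟩, h⟩
  · rintro _ ⟨a, ha, rfl⟩
    exact Finset.le_sup'
      (fun a : ℕ × ℕ => a.1 * tangencyEv k x 0 + a.2 * tangencyEv k x 1 + L.coeff a) ha

/-- A vector on which two different monomials of degree at most `w` in two variables take the
maximum over the corners of the triangle of size `w` has standard direction. -/
theorem standard_of_two_maximal {m : ℕ} {a a' : ℕ × ℕ} (ha : a.1 + a.2 ≤ m)
    (ha' : a'.1 + a'.2 ≤ m) (hne : a ≠ a') {x : Fin 2 → ℝ} (hx : x ≠ 0)
    (h : ∀ b : ℕ × ℕ, b = (0, 0) ∨ b = (m, 0) ∨ b = (0, m) →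
      b.1 * x 0 + b.2 * x 1 ≤ a.1 * x 0 + a.2 * x 1)
    (haa : (a.1 : ℝ) * x 0 + a.2 * x 1 = a'.1 * x 0 + a'.2 * x 1) :
    ∃ u ∈ standardDirections, ∃ t : ℝ, 0 < t ∧ x = t • castVec u := by
  have hm0 : (0 : ℝ) < m := by
    rcases Nat.eq_zero_or_pos m with rfl | hm
    · exact absurd (Prod.ext (by omega) (by omega)) hne
    · exact_mod_cast hm
  have h1 := h _ (Or.inl rfl)
  have h2 := h _ (Or.inr (Or.inl rfl))
  have h3 := h _ (Or.inr (Or.inr rfl))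
  have hb : (a.1 : ℝ) + a.2 ≤ m := by exact_mod_cast ha
  have hb' : (a'.1 : ℝ) + a'.2 ≤ m := by exact_mod_cast ha'
  have hne' : (a.1 : ℝ) ≠ a'.1 ∨ (a.2 : ℝ) ≠ a'.2 := by
    by_contra! hh
    exact hne (Prod.ext (by exact_mod_cast hh.1) (by exact_mod_cast hh.2))
  have hx' : x 0 ≠ 0 ∨ x 1 ≠ 0 := by
    by_contra! hh
    exact hx (by funext j; fin_cases j <;> simp [hh.1, hh.2])
  have p1 : (0 : ℝ) ≤ a.1 := Nat.cast_nonneg _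
  have p2 : (0 : ℝ) ≤ a.2 := Nat.cast_nonneg _
  have p1' : (0 : ℝ) ≤ a'.1 := Nat.cast_nonneg _
  have p2' : (0 : ℝ) ≤ a'.2 := Nat.cast_nonneg _
  simp only [Nat.cast_zero, zero_mul, add_zero, zero_add] at h1 h2 h3
  generalize (a.1 : ℝ) = r at *
  generalize (a.2 : ℝ) = s at *
  generalize (a'.1 : ℝ) = r' at *
  generalize (a'.2 : ℝ) = s' at *
  generalize (m : ℝ) = m at *
  have hvec : ∀ (u : Fin 2 → ℤ) (t : ℝ), x 0 = t * u 0 → x 1 = t * u 1 → x = t • castVec u := by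
    intro u t h0 h1
    funext j
    fin_cases j
    exacts [h0, h1]
  -- In each of the three open sectors between the standard rays a single corner of the triangle is
  -- maximal, and both `a` and `a'` would have to be that corner.
  have hset : x 0 = x 1 ∧ 0 < x 0 ∨ x 0 = 0 ∧ x 1 < 0 ∨ x 1 = 0 ∧ x 0 < 0 := by
    generalize x 0 = X at *
    generalize x 1 = Y at *
    have key : ∀ {r s X Y : ℝ}, 0 ≤ s → r + s ≤ m → Y < X → 0 < X → m * X ≤ r * X + s * Y →
        s = 0 ∧ r = m := by
      intro r s X Y hs hrs hYX hX hle
      have e1 : 0 ≤ s * (X - Y) := mul_nonneg hs (by linarith)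
      have e2 : 0 ≤ (m - r - s) * X := mul_nonneg (by linarith) hX.le
      have e3 : s * (X - Y) = 0 := by nlinarith
      have e4 : (m - r - s) * X = 0 := by nlinarith
      have e5 := (mul_eq_zero.1 e3).resolve_right (by linarith)
      have e6 := (mul_eq_zero.1 e4).resolve_right hX.ne'
      exact ⟨e5, by linarith⟩
    have key' : ∀ {r s : ℝ}, 0 ≤ r → 0 ≤ s → X < 0 → Y < 0 → 0 ≤ r * X + s * Y →
        r = 0 ∧ s = 0 := by
      intro r s hr hs hX hY hle
      have e1 : r * X ≤ 0 := mul_nonpos_of_nonneg_of_nonpos hr hX.le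
      have e2 : s * Y ≤ 0 := mul_nonpos_of_nonneg_of_nonpos hs hY.le
      exact ⟨(mul_eq_zero.1 (by linarith : r * X = 0)).resolve_right hX.ne,
        (mul_eq_zero.1 (by linarith : s * Y = 0)).resolve_right hY.ne⟩
    have hXY : ¬ (Y < X ∧ 0 < X) := by
      rintro ⟨c1, c2⟩
      obtain ⟨e1, e2⟩ := key p2 hb c1 c2 h2
      obtain ⟨e3, e4⟩ := key p2' hb' c1 c2 (haa ▸ h2)
      rcases hne' with hh | hh <;> exact hh (by linarith)
    have hYX : ¬ (X < Y ∧ 0 < Y) := by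
      rintro ⟨c1, c2⟩
      obtain ⟨e1, e2⟩ := key p1 (by linarith) c1 c2 (by linarith : m * Y ≤ s * Y + r * X)
      obtain ⟨e3, e4⟩ := key p1' (by linarith) c1 c2 (by linarith : m * Y ≤ s' * Y + r' * X)
      rcases hne' with hh | hh <;> exact hh (by linarith)
    have hneg : ¬ (X < 0 ∧ Y < 0) := by
      rintro ⟨c1, c2⟩
      obtain ⟨e1, e2⟩ := key' p1 p2 c1 c2 h1
      obtain ⟨e3, e4⟩ := key' p1' p2' c1 c2 (haa ▸ h1)
      rcases hne' with hh | hh <;> exact hh (by linarith)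
    rcases lt_trichotomy X 0 with c1 | c1 | c1 <;> rcases lt_trichotomy Y 0 with c2 | c2 | c2
    · exact absurd ⟨c1, c2⟩ hneg
    · exact Or.inr (Or.inr ⟨c2, c1⟩)
    · exact absurd ⟨by linarith, c2⟩ hYX
    · exact Or.inr (Or.inl ⟨c1, c2⟩)
    · rcases hx' with hh | hh
      exacts [absurd c1 hh, absurd c2 hh]
    · exact absurd ⟨by linarith, c2⟩ hYX
    · exact absurd ⟨by linarith, c1⟩ hXY
    · exact absurd ⟨by linarith, c1⟩ hXY
    · rcases lt_trichotomy X Y with c | c | c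
      · exact absurd ⟨c, c2⟩ hYX
      · exact Or.inl ⟨c, c1⟩
      · exact absurd ⟨c, c1⟩ hXY
  rcases hset with ⟨h0, h1⟩ | ⟨h0, h1⟩ | ⟨h0, h1⟩
  · exact ⟨![1, 1], by simp [standardDirections], x 0, h1, hvec _ _ (by simp) (by simp [h0])⟩
  · exact ⟨![0, -1], by simp [standardDirections], -x 1, by linarith,
      hvec _ _ (by simp [h0]) (by simp)⟩
  · exact ⟨![-1, 0], by simp [standardDirections], -x 0, by linarith,
      hvec _ _ (by simp) (by simp [h0])⟩

variable [Fintype ι]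

/-- The functional factors through `∂ev_k`, so it also kills every vector whose image under `∂ev_k`
is a multiple of that of a killed one. -/
theorem IsCut.of_curvePair {L : PlaneCurve} {k : ι} {τ : Set (Ambient ι)} {ℓ : Ambient ι →ₗ[ℝ] ℝ}
    (h : IsCut (curvePair L k).2 τ ℓ) :
    ∃ n : Fin 2 → ℝ, ∀ x, ℓ x = n 0 * tangencyEv k x 0 + n 1 * tangencyEv k x 1 := by
  obtain ⟨_, ⟨a, ha, rfl⟩, _, ⟨a', ha', rfl⟩, hℓ, -, -⟩ := h
  refine ⟨![(a.1 : ℝ) - a'.1, (a.2 : ℝ) - a'.2], fun x => ?_⟩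
  rw [hℓ, LinearMap.sub_apply, monomialForm_apply, monomialForm_apply]
  simp only [Matrix.cons_val_zero, Matrix.cons_val_one]
  ring

/-- Both monomials stay maximal along the whole ray in direction `v`, so on `v` their linear parts
agree and dominate those of the corners. -/
theorem IsCut.standard_of_curvePair {L : PlaneCurve} {k : ι} {σ : Set (Ambient ι)}
    {ℓ : Ambient ι →ₗ[ℝ] ℝ} (h : IsCut (curvePair L k).2 σ ℓ) (hσ : σ.Nonempty) {v : Ambient ι}
    (hv : v ∈ recessionCone σ) (hne : tangencyEv k v ≠ 0) :
    ∃ u ∈ standardDirections, ∃ t : ℝ, 0 < t ∧ tangencyEv k v = t • castVec u := by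
  have hzero := h.apply_eq_zero (recessionCone_subset_vectorSpan hσ hv)
  obtain ⟨_, ⟨a, ha, rfl⟩, _, ⟨a', ha', rfl⟩, hℓ, h0, hmax⟩ := h
  have haa : a ≠ a' := by
    rintro rfl
    exact h0 (by rw [hℓ, sub_self])
  obtain ⟨y, hy⟩ := hσ
  rw [hℓ, LinearMap.sub_apply, sub_eq_zero, monomialForm_apply, monomialForm_apply] at hzero
  refine standard_of_two_maximal (L.le_w a ha) (L.le_w a' ha') haa hne (fun b hb => ?_) hzero
  have hbm : b ∈ L.exponents := by
    rcases hb with rfl | rfl | rfl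
    exacts [L.zero_mem, L.left_mem, L.right_mem]
  rw [← monomialForm_apply, ← monomialForm_apply]
  by_contra! hlt
  set δ := monomialForm k b v - monomialForm k a v with hδ
  have hδ0 : 0 < δ := sub_pos.2 hlt
  set g := monomialForm k a y + L.coeff a - (monomialForm k b y + L.coeff b) with hg
  have hg0 : 0 ≤ g := sub_nonneg.2 ((hmax y hy).2 _ ⟨b, hbm, rfl⟩)
  -- The monomial `b` starts `g` below `a` and gains at rate `δ`, so at this time it would exceed
  -- `a` by `1`.
  have := (hmax _ (hv y hy ((g + 1) / δ) (by positivity))).2 _ ⟨b, hbm, rfl⟩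
  simp only [map_add, map_smul, smul_eq_mul] at this
  have h1 : (g + 1) / δ * δ = g + 1 := div_mul_cancel₀ _ hδ0.ne'
  rw [hδ, mul_sub] at h1
  linarith

variable {Δ : ι → Fin 3 → ℤ} {x₀ : ι} {p : Fin 3 → ℝ} {η κ : Finset ι} {P : ι → Fin 2 → ℝ}
  {L : ι → PlaneCurve} {crs : List (Fin 4 ↪ ι)} {Y : TropicalCycle (moduliLattice Δ x₀)}

/-- The linear information about a cell of nonzero weight of the intersection product: it lies in a
cell `τ` satisfying the point and the cross-ratio conditions, which lies in a facet `ρ` of the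
moduli space, and the conditions are transverse along these cells. -/
theorem IsFloorCycle.exists_cells (hY : IsFloorCycle Δ x₀ p η κ P L crs Y)
    {σ : Set (Ambient ι)} (hσ : σ ∈ Y.facets) (hw : Y.weight σ ≠ 0) :
    ∃ M : TropicalCycle (moduliLattice Δ x₀), IsModuliSpace Δ x₀ M ∧
    ∃ ρ ∈ M.facets, ∃ τ, σ ⊆ τ ∧ τ ⊆ ρ ∧
      (∀ x ∈ τ, x.2.1 = p ∧ ∀ c ∈ crs, x.1 c = 0) ∧
      (∀ v ∈ vectorSpan ℝ ρ, v.2.1 = 0 → (∀ c ∈ crs, v.1 c = 0) → v ∈ vectorSpan ℝ τ) ∧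
      (∀ f ∈ η, ∀ v ∈ vectorSpan ℝ σ, tangencyEv f v = 0) ∧
      (∀ k ∈ κ, ∀ v ∈ recessionCone σ, tangencyEv k v ≠ 0 →
        ∃ u ∈ standardDirections, ∃ t : ℝ, 0 < t ∧ tangencyEv k v = t • castVec u) ∧
      ∀ v₀ ∈ vectorSpan ℝ σ, ∀ v ∈ vectorSpan ℝ τ,
        (∀ j, j ∈ η ∨ j ∈ κ → ∃ r : ℝ, tangencyEv j v = r • tangencyEv j v₀) →
        v ∈ vectorSpan ℝ σ := by
  obtain ⟨M, hM, hprod⟩ := hY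
  refine ⟨M, hM, ?_⟩
  -- `L₁` collects the point and cross-ratio conditions, which cut `τ` out of `ρ`; the tangency
  -- conditions `L₂` then cut `σ` out of `τ`.
  set L₁ : List ((Ambient ι → ℝ) × Set ((Ambient ι →ₗ[ℝ] ℝ) × ℝ)) :=
    (List.finRange 3).map (fun j => maxPair (evCoord ι j) (p j)) ++
      crs.map (fun c => maxPair (crossCoord c) 0) with hL₁
  set L₂ : List ((Ambient ι → ℝ) × Set ((Ambient ι →ₗ[ℝ] ℝ) × ℝ)) :=
    η.toList.flatMap (fun f => (List.finRange 2).map fun j => maxPair (tangencyCoord f j) (P f j)) ++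
      κ.toList.map (fun k => curvePair (L k) k) with hL₂
  have e₁ : pointFunctions p ++ crs.map crossRatioFunction = L₁.map Prod.fst := by
    rw [hL₁, List.map_append, List.map_map, List.map_map]
    congr 1
    refine List.map_congr_left fun c _ => ?_
    funext x
    simp [crossRatioFunction, maxPair, crossCoord]
  have e₂ : η.toList.flatMap (fun f => tangencyPointFunctions (P f) f) ++
      κ.toList.map (fun k => tangencyCurveFunction (L k) k) = L₂.map Prod.fst := by
    rw [hL₂, List.map_append, List.map_map, List.map_flatMap]
    simp only [List.map_map]
    rfl
  rw [List.append_assoc, e₁, e₂] at hprod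
  have hmax₁ : ∀ q ∈ L₁, IsMaxOf q.1 q.2 := by
    intro q hq
    rcases List.mem_append.1 hq with hq | hq <;> obtain ⟨j, -, rfl⟩ := List.mem_map.1 hq <;>
      exact isMaxOf_maxPair _ _
  have hmax₂ : ∀ q ∈ L₂, IsMaxOf q.1 q.2 := by
    intro q hq
    rcases List.mem_append.1 hq with hq | hq
    · obtain ⟨f, -, hq⟩ := List.mem_flatMap.1 hq
      obtain ⟨j, -, rfl⟩ := List.mem_map.1 hq
      exact isMaxOf_maxPair _ _
    · obtain ⟨k, -, rfl⟩ := List.mem_map.1 hq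
      exact isMaxOf_curvePair _ _
  obtain ⟨X, hX, hcut₁⟩ := IsIntersectionProduct.exists_isCutOut L₁ hmax₁ hprod
  obtain ⟨τ, hτ, hwτ, hsub₂, hex₂, hspan₂⟩ :=
    IsIntersectionProduct.exists_isCutOut_facet L₂ hmax₂ hX hσ hw
  obtain ⟨ρ, hρ, -, hsub₁, hex₁, hspan₁⟩ := hcut₁ τ hτ hwτ
  have mev : ∀ j, maxPair (evCoord ι j) (p j) ∈ L₁ := fun j =>
    List.mem_append_left _ (List.mem_map.2 ⟨j, List.mem_finRange j, rfl⟩)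
  have mcr : ∀ c ∈ crs, maxPair (crossCoord c) 0 ∈ L₁ := fun c hc =>
    List.mem_append_right _ (List.mem_map.2 ⟨c, hc, rfl⟩)
  have mf : ∀ f ∈ η, ∀ j, maxPair (tangencyCoord f j) (P f j) ∈ L₂ := fun f hf j =>
    List.mem_append_left _ (List.mem_flatMap.2 ⟨f, Finset.mem_toList.2 hf,
      List.mem_map.2 ⟨j, List.mem_finRange j, rfl⟩⟩)
  have mk : ∀ k ∈ κ, curvePair (L k) k ∈ L₂ := fun k hk =>
    List.mem_append_right _ (List.mem_map.2 ⟨k, Finset.mem_toList.2 hk, rfl⟩)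
  refine ⟨ρ, hρ, τ, hsub₂, hsub₁, fun x hx => ⟨?_, fun c hc => ?_⟩, ?_, ?_, ?_, ?_⟩
  · funext j
    obtain ⟨ℓ, hℓ⟩ := hex₁ _ (mev j)
    exact hℓ.of_maxPair.2 x hx
  · obtain ⟨ℓ, hℓ⟩ := hex₁ _ (mcr c hc)
    exact hℓ.of_maxPair.2 x hx
  · intro v hv hv0 hvc
    refine hspan₁ v hv fun q hq ℓ hℓ => ?_
    rcases List.mem_append.1 hq with hq | hq
    · obtain ⟨j, -, rfl⟩ := List.mem_map.1 hq
      have h0 : evCoord ι j v = 0 := congrFun hv0 j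
      rcases hℓ.of_maxPair.1 with rfl | rfl
      · exact h0
      · rw [LinearMap.neg_apply, h0, neg_zero]
    · obtain ⟨c, hc, rfl⟩ := List.mem_map.1 hq
      have h0 : crossCoord c v = 0 := hvc c hc
      rcases hℓ.of_maxPair.1 with rfl | rfl
      · exact h0
      · rw [LinearMap.neg_apply, h0, neg_zero]
  · intro f hf v hv
    funext j
    obtain ⟨ℓ, hℓ⟩ := hex₂ _ (mf f hf j)
    have h0 := hℓ.apply_eq_zero hv
    rcases hℓ.of_maxPair.1 with rfl | rfl
    · exact h0
    · rw [LinearMap.neg_apply, neg_eq_zero] at h0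
      exact h0
  · intro k hk v hv hne
    obtain ⟨ℓ, hℓ⟩ := hex₂ _ (mk k hk)
    exact hℓ.standard_of_curvePair (Y.nonempty σ (TropicalCycle.mem_facets.1 hσ).1) hv hne
  · intro v₀ hv₀ v hv hr
    refine hspan₂ v hv fun q hq ℓ hℓ => ?_
    have hz := hℓ.apply_eq_zero hv₀
    rcases List.mem_append.1 hq with hq | hq
    · obtain ⟨f, hf, hq⟩ := List.mem_flatMap.1 hq
      obtain ⟨j, -, rfl⟩ := List.mem_map.1 hq
      obtain ⟨r, hr⟩ := hr f (Or.inl (Finset.mem_toList.1 hf))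
      have h0 : tangencyCoord f j v = r * tangencyCoord f j v₀ := congrFun hr j
      rcases hℓ.of_maxPair.1 with rfl | rfl
      · rw [h0, hz, mul_zero]
      · rw [LinearMap.neg_apply] at hz ⊢
        rw [h0, ← mul_neg, hz, mul_zero]
    · obtain ⟨k, hk, rfl⟩ := List.mem_map.1 hq
      obtain ⟨r, hr⟩ := hr k (Or.inr (Finset.mem_toList.1 hk))
      obtain ⟨n, hn⟩ := hℓ.of_curvePair
      rw [hn] at hz ⊢
      rw [hr]
      simp only [Pi.smul_apply, smul_eq_mul]
      linear_combination r * hz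

end Conditions

end TropicalFloor

namespace TropicalFloor

/-! ### Degenerated cross-ratios and edge lengths -/

section CrossRatios

variable {ι : Type*}

namespace MarkedCurve

variable (C : MarkedCurve ι)

theorem split_iff (e : Sym2 (Fin C.n)) (k : ι) {i j : ι} :
    C.Split e i j ↔ ¬ (C.Split e k i ↔ C.Split e k j) :=
  separates_iff_not_iff C.isTree.connected _

theorem crossCoeff_pos_iff {e : Sym2 (Fin C.n)} {c : Fin 4 ↪ ι} :
    0 < crossCoeff (C.Split e) c ↔
      ¬ C.Split e (c 0) (c 1) ∧ C.Split e (c 0) (c 2) ∧ C.Split e (c 0) (c 3) := by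
  rw [crossCoeff, C.split_iff e (c 0) (i := c 1), C.split_iff e (c 0) (i := c 2)]
  by_cases h1 : C.Split e (c 0) (c 1) <;> by_cases h2 : C.Split e (c 0) (c 2) <;>
    by_cases h3 : C.Split e (c 0) (c 3) <;> simp [ind, h1, h2, h3]

theorem crossCoeff_neg_iff {e : Sym2 (Fin C.n)} {c : Fin 4 ↪ ι} :
    crossCoeff (C.Split e) c < 0 ↔
      C.Split e (c 0) (c 1) ∧ ¬ C.Split e (c 0) (c 2) ∧ C.Split e (c 0) (c 3) := by
  rw [crossCoeff, C.split_iff e (c 0) (i := c 1), C.split_iff e (c 0) (i := c 2)]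
  by_cases h1 : C.Split e (c 0) (c 1) <;> by_cases h2 : C.Split e (c 0) (c 2) <;>
    by_cases h3 : C.Split e (c 0) (c 3) <;> norm_num [ind, h1, h2, h3]

/-- Coefficients of opposite sign come from the splits `(c₀c₁|c₂c₃)` and `(c₀c₂|c₁c₃)`, which do not
both occur in one tree. -/
theorem not_crossCoeff_neg {e e' : Sym2 (Fin C.n)} {c : Fin 4 ↪ ι}
    (h : 0 < crossCoeff (C.Split e) c) : 0 ≤ crossCoeff (C.Split e') c := by
  by_contra! h'
  obtain ⟨h1, h2, h3⟩ := C.crossCoeff_pos_iff.1 h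
  obtain ⟨h1', h2', h3'⟩ := C.crossCoeff_neg_iff.1 h'
  refine splits_compatible (e := e) (e' := e') h1
    (not_separates_of_separates C.isTree.connected h2 h3) h2 h1' ?_
  exact (C.split_iff e' (c 0)).2 (by simp [h2', h3'])

/-- If a cross-ratio vanishes for nonnegative edge lengths, then all edges that contribute to it
have length zero. -/
theorem mul_crossCoeff_eq_zero {ℓ : C.graph.edgeSet → ℝ} (hℓ : ∀ e, 0 ≤ ℓ e) {c : Fin 4 ↪ ι}
    (h : ∑ e : C.graph.edgeSet, ℓ e * crossCoeff (C.Split e) c = 0) (e : C.graph.edgeSet) :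
    ℓ e * crossCoeff (C.Split e) c = 0 := by
  by_cases hpos : ∃ e : C.graph.edgeSet, 0 < crossCoeff (C.Split e) c
  · obtain ⟨e', he'⟩ := hpos
    exact (Finset.sum_eq_zero_iff_of_nonneg fun x _ =>
      mul_nonneg (hℓ x) (C.not_crossCoeff_neg he')).1 h e (Finset.mem_univ e)
  · push Not at hpos
    exact (Finset.sum_eq_zero_iff_of_nonpos fun x _ =>
      mul_nonpos_of_nonneg_of_nonpos (hℓ x) (hpos x)).1 h e (Finset.mem_univ e)

theorem crossCoeff_congr {S T : ι → ι → Prop} {c : Fin 4 ↪ ι}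
    (h : ∀ m n, S (c m) (c n) ↔ T (c m) (c n)) : crossCoeff S c = crossCoeff T c := by
  simp only [crossCoeff, h]

/-- An edge that splits off at most one of the four labels disappears under the forgetful map. -/
theorem crossCoeff_eq_zero_of_singleton {S : ι → ι → Prop} {c : Fin 4 ↪ ι} {j : ι}
    (h : ∀ m n, S (c m) (c n) ↔ ¬ (c m = j ↔ c n = j)) : crossCoeff S c = 0 := by
  have hne : ∀ m n : Fin 4, m ≠ n → c m = j → c n ≠ j := fun m n hmn hm hn =>
    hmn (c.injective (hm.trans hn.symm))
  simp only [crossCoeff, h]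
  by_cases h0 : c 0 = j
  · simp [ind, h0, hne 0 1 (by decide) h0, hne 0 2 (by decide) h0, hne 0 3 (by decide) h0]
  by_cases h1 : c 1 = j
  · simp [ind, h1, h0, hne 1 2 (by decide) h1, hne 1 3 (by decide) h1]
  by_cases h2 : c 2 = j
  · simp [ind, h2, h0, h1, hne 2 3 (by decide) h2]
  by_cases h3 : c 3 = j <;> simp [ind, h0, h1, h2, h3]

/-- If the ends `q` and `E` are separated from all pairs of other ends, then they are adjacent to a
common `3`-valent vertex. -/
theorem valence_eq_three_of_crossRatio_pos [Finite ι] {q E a b : ι} (hqE : q ≠ E) (haq : a ≠ q)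
    (haE : a ≠ E) (hbq : b ≠ q) (hbE : b ≠ E) (hab : a ≠ b)
    (h : ∀ c : Fin 4 ↪ ι, c 0 = q → c 1 = E → 0 < C.crossRatio c) :
    C.valence (C.attach q) = 3 ∧ C.attach E = C.attach q := by
  have hsep : ∀ a b, a ≠ q → a ≠ E → b ≠ q → b ≠ E → a ≠ b →
      ∃ e, C.Split e q a ∧ C.Split e q b := by
    intro a b haq haE hbq hbE hab
    let c : Fin 4 ↪ ι := ⟨![q, E, a, b], by
      intro m n hmn
      fin_cases m <;> fin_cases n <;> simp_all [eq_comm]⟩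
    have hc := h c rfl rfl
    rw [C.crossRatio_eq_sum] at hc
    obtain ⟨e, -, he⟩ := Finset.exists_lt_of_sum_lt (f := fun _ => (0 : ℝ))
      (by simpa using hc : ∑ e : C.graph.edgeSet, (0 : ℝ) < _)
    have := C.crossCoeff_pos_iff.1 (pos_of_mul_pos_right he (C.length_pos e e.2).le)
    exact ⟨e, this.2⟩
  have hne : C.attach q ≠ C.attach a := by
    obtain ⟨e, he, -⟩ := hsep a b haq haE hbq hbE hab
    intro hqa
    rw [Split, ← hqa] at he
    exact not_separates_self _ _ he
  obtain ⟨x, hx, hxa⟩ := exists_adj_separates C.isTree hne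
  -- Some edge separates `q` from both `a` and `i`, which is impossible for labels in different
  -- branches at the vertex of `q`.
  have hall : ∀ i, i ≠ q → i ≠ E → Separates C.graph s(C.attach q, x) (C.attach q) (C.attach i) := by
    intro i hiq hiE
    by_cases hia : a = i
    · exact hia ▸ hxa
    obtain ⟨e, he, hei⟩ := hsep a i haq haE hiq hiE hia
    by_contra hn
    exact not_separates_of_branch C.isTree hxa hn he hei
  -- A second branch would contain at least two labels, but only `E` is left for it.
  have hnb : C.graph.neighborSet (C.attach q) ⊆ {x} := by
    intro y hy
    by_contra hyx
    obtain ⟨i, j, hij, hi, hj⟩ := C.exists_two_labels hy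
    have key : ∀ i, Separates C.graph s(C.attach q, y) (C.attach q) (C.attach i) → i = E := by
      intro i hi
      by_contra hiE
      refine hyx (eq_of_separates C.isTree hi (hall i ?_ hiE))
      rintro rfl
      exact not_separates_self _ _ hi
    exact hij ((key i hi).trans (key j hj).symm)
  have hends : C.attach ⁻¹' {C.attach q} ⊆ {q, E} := by
    intro i hi
    by_contra hn
    simp only [Set.mem_insert_iff, Set.mem_singleton_iff, not_or] at hn
    have := hall i hn.1 hn.2
    rw [show C.attach i = C.attach q from hi] at this
    exact not_separates_self _ _ this
  have h1 := Set.ncard_le_ncard hnb (Set.toFinite _)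
  have h2 := Set.ncard_le_ncard hends (Set.toFinite _)
  have h3 := C.three_le_valence (C.attach q)
  rw [Set.ncard_singleton] at h1
  rw [Set.ncard_pair hqE] at h2
  refine ⟨by rw [valence]; omega, ?_⟩
  have heq := Set.eq_of_subset_of_ncard_le hends (by rw [Set.ncard_pair hqE]; omega)
    (Set.toFinite _)
  have : E ∈ C.attach ⁻¹' {C.attach q} := by rw [heq]; simp
  exact this

/-- The edges at a `3`-valent vertex with an end `i` do not contribute to cross-ratios without `i`
if these cross-ratios determine the lengths of the edges that contribute to them. -/
theorem crossCoeff_eq_zero_of_end [Finite ι] {i : ι} (hval : C.valence (C.attach i) = 3)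
    {crs : List (Fin 4 ↪ ι)} (hi : ∀ c ∈ crs, ∀ m, c m ≠ i)
    (hindep : ∀ ℓ : C.graph.edgeSet → ℝ,
      (∀ c ∈ crs, ∑ e : C.graph.edgeSet, ℓ e * crossCoeff (C.Split e) c = 0) →
      ∀ e : C.graph.edgeSet, (∃ c ∈ crs, crossCoeff (C.Split e) c ≠ 0) → ℓ e = 0)
    {b : Fin C.n} (hb : C.graph.Adj (C.attach i) b) {c : Fin 4 ↪ ι} (hc : c ∈ crs) :
    crossCoeff (C.Split s(C.attach i, b)) c = 0 := by
  classical
  rcases trivalent_cases hval rfl with hno | ⟨j, b₁, hji, hj, hab, hk, hb'⟩ |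
    ⟨b₁, b₂, hbb, hab₁, hab₂, hk, hx⟩
  · exact absurd hb (hno b)
  · refine crossCoeff_eq_zero_of_singleton (j := j) fun m n => ?_
    have key : ∀ m, C.Split s(C.attach i, b) i (c m) ↔ c m ≠ j := by
      intro m
      constructor
      · rintro h rfl
        rw [Split, hj] at h
        exact not_separates_self _ _ h
      · intro hm
        have hne : C.attach i ≠ C.attach (c m) := fun h =>
          (hk (c m) h.symm).elim (hi c hc m) hm
        obtain ⟨x, hx, hs⟩ := exists_adj_separates C.isTree hne
        rwa [hb' x hx, ← hb' b hb] at hs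
    rw [C.split_iff _ i, key, key, not_iff_not]
    exact not_iff_not
  · have key : ∀ {b₁ b₂ : Fin C.n}, b₁ ≠ b₂ → C.graph.Adj (C.attach i) b₁ →
        C.graph.Adj (C.attach i) b₂ → (∀ x, C.graph.Adj (C.attach i) x → x = b₁ ∨ x = b₂) →
        crossCoeff (C.Split s(C.attach i, b₁)) c = 0 := by
      intro b₁ b₂ hbb hab₁ hab₂ hx
      by_contra hcc
      -- Both edges at `i` split the labels other than `i` in the same way. Lengthening one and
      -- shortening the other preserves all cross-ratios in `crs`, contrary to `hindep`.
      have hsame : ∀ c ∈ crs, crossCoeff (C.Split s(C.attach i, b₁)) c =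
          crossCoeff (C.Split s(C.attach i, b₂)) c := by
        intro c hc
        refine crossCoeff_congr fun m n => ?_
        have key : ∀ m, C.Split s(C.attach i, b₁) i (c m) ↔
            ¬ C.Split s(C.attach i, b₂) i (c m) := by
          intro m
          constructor
          · intro h h'
            exact hbb (eq_of_separates C.isTree h h')
          · intro hm
            have hne : C.attach i ≠ C.attach (c m) := fun h => hi c hc m (hk (c m) h.symm)
            obtain ⟨x, hax, hs⟩ := exists_adj_separates C.isTree hne
            rcases hx x hax with rfl | rfl
            · exact hs
            · exact absurd hs hm
        rw [C.split_iff _ i, C.split_iff _ i (i := c m), key, key, not_iff_not]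
        exact not_iff_not
      let e₁ : C.graph.edgeSet := ⟨s(C.attach i, b₁), C.graph.mem_edgeSet.2 hab₁⟩
      let e₂ : C.graph.edgeSet := ⟨s(C.attach i, b₂), C.graph.mem_edgeSet.2 hab₂⟩
      have hne : e₁ ≠ e₂ := fun h => hbb (Sym2.congr_right.1 (congrArg Subtype.val h))
      have := hindep (Pi.single e₁ 1 - Pi.single e₂ 1) (fun c hc => by
        simp only [Pi.sub_apply, sub_mul, Finset.sum_sub_distrib, Pi.single_apply, ite_mul, one_mul,
          zero_mul, Finset.sum_ite_eq', Finset.mem_univ, if_true]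
        exact sub_eq_zero.2 (hsame c hc)) e₁ ⟨c, hc, hcc⟩
      simp [hne] at this
    rcases hx b hb with rfl | rfl
    · exact key hbb hab₁ hab₂ hx
    · exact key hbb.symm hab₂ hab₁ fun x hax => (hx x hax).symm

end MarkedCurve

end CrossRatios

end TropicalFloor

namespace TropicalFloor

theorem tangencyEv_apply {ι : Type*} (k : ι) (x : Ambient ι) : tangencyEv k x = x.2.2 k := rfl

/-! ### From cells of the floor cycle to rigid deformations -/

section FloorCycle

variable {ι : Type*} [Fintype ι]

theorem proj_castVec (x : Fin 3 → ℤ) : proj (fun j => (x j : ℝ)) = castVec (proj x) := rfl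

theorem proj_smul (r : ℝ) (x : Fin 3 → ℝ) : proj (r • x) = r • proj x := rfl

theorem proj_sub (x y : Fin 3 → ℝ) : proj (x - y) = proj x - proj y := rfl

/-- The projection `ℤ³ → ℤ²` as a homomorphism. -/
def projHom : (Fin 3 → ℤ) →+ (Fin 2 → ℤ) where
  toFun := proj
  map_zero' := rfl
  map_add' _ _ := rfl

theorem proj_mem_of_mem_floorDegree {s : ℕ} {α β : ℕ+ →₀ ℕ} {x : Fin 3 → ℤ}
    (hx : x ∈ floorDegree s α β) : proj x = 0 ∨ proj x ∈ standardDirections := by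
  have hvec : ∀ a b c : ℤ, proj ![a, b, c] = ![a, b] := by
    intro a b c
    funext j
    fin_cases j <;> rfl
  simp only [floorDegree, Finsupp.sum, Multiset.mem_add, Multiset.mem_sum,
    Multiset.mem_replicate] at hx
  rcases hx with (((⟨-, rfl⟩ | ⟨-, rfl⟩) | ⟨-, rfl⟩) | ⟨w, -, -, rfl⟩) | ⟨w, -, -, rfl⟩
  · right; rw [hvec]; simp [standardDirections]
  · right; rw [hvec]; simp [standardDirections]
  · right; rw [hvec]; simp [standardDirections]
  · left; rw [hvec]; simp
  · left; rw [hvec]; simp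

variable {Δ : ι → Fin 3 → ℤ} {x₀ : ι}

theorem StableMap.displacement_smul (C : StableMap Δ) (x₀ : ι) (r : ℝ)
    (ℓ : C.graph.edgeSet → ℝ) (a : Fin C.n) :
    C.displacement x₀ (r • ℓ) a = r • C.displacement x₀ ℓ a := by
  simp only [StableMap.displacement, Finset.smul_sum, smul_smul, Pi.smul_apply, smul_eq_mul,
    mul_assoc]

theorem StableMap.proj_displacement_sub (C : StableMap Δ) (x₀ : ι) (ℓ : C.graph.edgeSet → ℝ)
    {a b : Fin C.n} (h : C.graph.Adj a b) :
    proj (C.displacement x₀ ℓ b) - proj (C.displacement x₀ ℓ a) =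
      ℓ ⟨s(a, b), C.graph.mem_edgeSet.2 h⟩ • castVec (proj (C.slope a b)) := by
  rw [← proj_sub, C.displacement_sub x₀ ℓ h, proj_smul, proj_castVec]

theorem StableMap.proj_displacement_root (C : StableMap Δ) (x₀ : ι) (ℓ : C.graph.edgeSet → ℝ) :
    proj (C.displacement x₀ ℓ (C.attach x₀)) = 0 := by
  rw [C.displacement_root]
  rfl

theorem StableMap.proj_slope_swap (C : StableMap Δ) {a b : Fin C.n} (h : C.graph.Adj a b) :
    proj (C.slope b a) = -proj (C.slope a b) := by
  rw [C.slope_swap h]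
  rfl

theorem StableMap.sum_proj_slope (C : StableMap Δ) (a : Fin C.n) {N : Finset (Fin C.n)}
    {A : Finset ι} (hN : ∀ x, x ∈ N ↔ C.graph.Adj a x) (hA : ∀ i, i ∈ A ↔ C.attach i = a) :
    ∑ x ∈ N, proj (C.slope a x) + ∑ i ∈ A, proj (Δ i) = 0 := by
  classical
  have h := congrArg projHom (C.balancing a)
  rw [map_add, map_sum, map_sum, map_zero] at h
  refine Eq.trans (congrArg₂ (· + ·) (Finset.sum_congr ?_ fun _ _ => rfl)
    (Finset.sum_congr ?_ fun _ _ => rfl)) h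
  · ext x
    rw [hN, Finset.mem_filter]
    exact (and_iff_right (Finset.mem_univ x)).symm
  · ext x
    rw [hA, Finset.mem_filter]
    exact (and_iff_right (Finset.mem_univ x)).symm

/-- A displacement of the vertices of the projected curve along its edges comes from a change of
the edge lengths. -/
theorem StableMap.exists_proj_displacement_eq (C : StableMap Δ) (x₀ : ι)
    {Q : Set (Sym2 (Fin C.n))} {w' : Fin C.n → Fin 2 → ℝ} (h₀ : w' (C.attach x₀) = 0)
    (h1 : ∀ a b, C.graph.Adj a b → s(a, b) ∉ Q →
      ∃ r : ℝ, w' b - w' a = r • castVec (proj (C.slope a b)))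
    (h2 : ∀ a b, C.graph.Adj a b → s(a, b) ∈ Q → w' b = w' a) :
    ∃ ℓ' : C.graph.edgeSet → ℝ, (∀ e : C.graph.edgeSet, (e : Sym2 (Fin C.n)) ∈ Q → ℓ' e = 0) ∧
      ∀ a, proj (C.displacement x₀ ℓ' a) = w' a := by
  have hr : ∀ e : C.graph.edgeSet, ∃ r : ℝ, ((e : Sym2 (Fin C.n)) ∈ Q → r = 0) ∧
      ∀ a b, s(a, b) = (e : Sym2 (Fin C.n)) → w' b - w' a = r • castVec (proj (C.slope a b)) := by
    rintro ⟨e, he⟩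
    induction e with
    | _ x y =>
      have hxy : C.graph.Adj x y := he
      have key : ∃ r : ℝ, (s(x, y) ∈ Q → r = 0) ∧
          w' y - w' x = r • castVec (proj (C.slope x y)) := by
        by_cases hmem : s(x, y) ∈ Q
        · exact ⟨0, fun _ => rfl, by rw [h2 x y hxy hmem, sub_self, zero_smul]⟩
        · obtain ⟨r, hr⟩ := h1 x y hxy hmem
          exact ⟨r, fun h => absurd h hmem, hr⟩
      obtain ⟨r, hr0, hr⟩ := key
      refine ⟨r, hr0, fun a b hab => ?_⟩
      rcases Sym2.eq_iff.1 hab with ⟨rfl, rfl⟩ | ⟨rfl, rfl⟩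
      · exact hr
      · rw [C.proj_slope_swap hxy, map_neg, smul_neg, ← hr, neg_sub]
  choose ℓ' hℓ'Q hℓ' using hr
  refine ⟨ℓ', hℓ'Q, fun a => ?_⟩
  refine congrFun (eq_of_forall_adj_sub_eq C.isTree.connected (r := C.attach x₀)
    (f := fun a => proj (C.displacement x₀ ℓ' a)) ?_ fun x y hxy => ?_) a
  · exact (C.proj_displacement_root x₀ ℓ').trans h₀.symm
  · exact (C.proj_displacement_sub x₀ _ hxy).trans
      (hℓ' ⟨s(x, y), C.graph.mem_edgeSet.2 hxy⟩ x y rfl).symm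

/-- A nonnegative change of the edge lengths of a stable map that is unique up to scaling among
those satisfying the conditions yields a `RigidRay`. -/
theorem StableMap.rigidRay (C : StableMap Δ) {ℓ : C.graph.edgeSet → ℝ}
    {Q : Set (Sym2 (Fin C.n))} {cs : Sym2 (Fin C.n) → ℝ} {J : Set ι} (hx₀J : x₀ ∈ J)
    (htri : ∀ v, C.valence v = 3)
    (hstd : ∀ i, proj (Δ i) = 0 ∨ proj (Δ i) ∈ standardDirections)
    (hcs : ∀ e (h : e ∈ C.graph.edgeSet), cs e = ℓ ⟨e, h⟩) (hℓ : ∀ e, 0 ≤ ℓ e)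
    (hJ : ∀ j ∈ J, proj (Δ j) = 0)
    (hQ : ∀ e : C.graph.edgeSet, (e : Sym2 (Fin C.n)) ∈ Q → ℓ e = 0)
    (hend : ∀ i b, proj (Δ i) ≠ 0 → C.graph.Adj (C.attach i) b → s(C.attach i, b) ∉ Q)
    (hJstd : ∀ j ∈ J, proj (C.displacement x₀ ℓ (C.attach j)) ≠ 0 →
      ∃ u ∈ standardDirections, ∃ t : ℝ, 0 < t ∧
        proj (C.displacement x₀ ℓ (C.attach j)) = t • castVec u)
    (huniq : ∀ ℓ' : C.graph.edgeSet → ℝ,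
      (∀ e : C.graph.edgeSet, (e : Sym2 (Fin C.n)) ∈ Q → ℓ' e = 0) →
      (∀ j ∈ J, ∃ r : ℝ, proj (C.displacement x₀ ℓ' (C.attach j)) =
        r • proj (C.displacement x₀ ℓ (C.attach j))) → ∃ μ : ℝ, ℓ' = μ • ℓ)
    (hne : ∃ a, proj (C.displacement x₀ ℓ a) ≠ 0) :
    RigidRay C.toMarkedCurve (fun a b => proj (C.slope a b)) (fun i => proj (Δ i))
      (fun a => proj (C.displacement x₀ ℓ a)) cs Q J := by
  classical
  refine ⟨htri, fun a b h => C.proj_slope_swap h, fun a N A hN hA => C.sum_proj_slope a hN hA,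
    hstd, fun e he => by rw [hcs e he]; exact hℓ _, fun a b h => ?_, fun a b h hab h0 => ?_,
    fun a b h hab => ?_, hend, hJ, hJstd, fun w' h1 h2 h3 => ?_⟩
  · rw [hcs _ (C.graph.mem_edgeSet.2 h)]
    exact C.proj_displacement_sub x₀ ℓ h
  -- An edge outside `Q` whose projection is a point could be lengthened without moving anything in
  -- the plane. By uniqueness `ℓ` would be proportional to this change, and nothing would move.
  · let e₀ : C.graph.edgeSet := ⟨s(a, b), C.graph.mem_edgeSet.2 h⟩
    have hdisp : (fun a => proj (C.displacement x₀ (Pi.single e₀ 1) a)) = 0 := by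
      refine eq_of_forall_adj_sub_eq C.isTree.connected (r := C.attach x₀) ?_ fun x y hxy => ?_
      · exact C.proj_displacement_root x₀ _
      · rw [C.proj_displacement_sub x₀ _ hxy, Pi.zero_apply, Pi.zero_apply, sub_zero]
        by_cases he : s(x, y) = s(a, b)
        · have : proj (C.slope x y) = 0 := by
            rcases Sym2.eq_iff.1 he with ⟨rfl, rfl⟩ | ⟨rfl, rfl⟩
            · exact h0
            · rw [C.proj_slope_swap h]
              exact (congrArg Neg.neg h0).trans neg_zero
          rw [this, map_zero, smul_zero]
        · rw [Pi.single_eq_of_ne (fun hh => he (congrArg Subtype.val hh)), zero_smul]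
    obtain ⟨μ, hμ⟩ := huniq (Pi.single e₀ 1) (fun e he => by
        rw [Pi.single_eq_of_ne]
        rintro rfl
        exact hab he)
      (fun j _ => ⟨0, by rw [zero_smul]; exact congrFun hdisp _⟩)
    have hμ0 : μ ≠ 0 := by
      rintro rfl
      have := congrFun hμ e₀
      rw [Pi.single_eq_same, zero_smul] at this
      exact one_ne_zero this
    obtain ⟨a', ha'⟩ := hne
    have hz : proj (C.displacement x₀ (Pi.single e₀ 1) a') = 0 := congrFun hdisp a'
    rw [hμ, C.displacement_smul, proj_smul] at hz
    exact ha' ((smul_eq_zero.1 hz).resolve_left hμ0)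
  · have := C.proj_displacement_sub x₀ ℓ h
    rw [hQ _ hab, zero_smul, sub_eq_zero] at this
    exact this
  -- Membership of `x₀` in `J` forces `w'` to vanish there, as `w` does, so `w'` is induced by a
  -- change of lengths alone.
  · obtain ⟨r₀, hr₀⟩ := h3 x₀ hx₀J
    obtain ⟨ℓ', hℓ'Q, hw'⟩ := C.exists_proj_displacement_eq x₀
      (by rw [hr₀, C.proj_displacement_root, smul_zero]) h1 h2
    obtain ⟨μ, hμ⟩ := huniq ℓ' hℓ'Q fun j hj => by
      obtain ⟨r, hr⟩ := h3 j hj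
      exact ⟨r, (hw' _).trans hr⟩
    refine ⟨μ, funext fun a => ?_⟩
    rw [← hw', hμ, C.displacement_smul, proj_smul]
    rfl

variable {p : Fin 3 → ℝ} {η κ : Finset ι} {P : ι → Fin 2 → ℝ}
  {L : ι → PlaneCurve} {crs : List (Fin 4 ↪ ι)} {Y : TropicalCycle (moduliLattice Δ x₀)}

/-- The recession direction of a cell of nonzero weight along which the end `q` moves is given by
the growth of a single edge, which separates `q` and an end of standard direction from the other
ends. -/
theorem IsFloorCycle.exists_growing_edge
    (hx₀ : Δ x₀ = 0) (hstd : ∀ i, proj (Δ i) = 0 ∨ proj (Δ i) ∈ standardDirections)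
    (hη : ∀ f ∈ η, IsVerticalEnd Δ f) (hκ : ∀ k ∈ κ, IsVerticalEnd Δ k)
    (hcrs : ∀ c ∈ crs, ∀ j, c j = x₀ ∨ IsVerticalEnd Δ (c j))
    {q : ι} (hq : IsVerticalEnd Δ q)
    (hY : IsFloorCycle Δ x₀ p η κ P L crs Y) (hdim : Y.dim = 1)
    {σ : Set (Ambient ι)} (hσ : σ ∈ Y.facets) (hw : Y.weight σ ≠ 0) {v : Ambient ι}
    (hv : v ∈ recessionCone σ) (hqv : tangencyEv q v ≠ 0) :
    ∃ E, proj (Δ E) ∈ standardDirections ∧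
      (∃ t : ℝ, 0 < t ∧ tangencyEv q v = t • castVec (proj (Δ E))) ∧
      (∃ a b, a ≠ q ∧ a ≠ E ∧ b ≠ q ∧ b ≠ E ∧ a ≠ b) ∧
      ∀ y ∈ intrinsicInterior ℝ σ, ∀ c : Fin 4 ↪ ι, c 0 = q → c 1 = E → 0 < y.1 c := by
  classical
  obtain ⟨M, hM, ρ, hρ, τ, hστ, hτρ, hτ, hspanτ, hηv, hκv, hspanσ⟩ := hY.exists_cells hσ hw
  obtain ⟨C, htri, hinj, hspanρ, hparam⟩ := hM.exists_param hρ
  have hσne : σ.Nonempty := Y.nonempty σ (TropicalCycle.mem_facets.1 hσ).1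
  have hvσ := recessionCone_subset_vectorSpan hσne hv
  have hvτ := vectorSpan_mono ℝ hστ hvσ
  have hvρ := vectorSpan_mono ℝ hτρ hvτ
  obtain ⟨⟨ℓ, x⟩, hℓv⟩ : v ∈ LinearMap.range (C.param x₀) := hspanρ ▸ hvρ
  have hx : x = 0 := by
    have h0 : v.2.1 = 0 := by
      funext j
      exact (linear_eq_on_vectorSpan (f := evCoord ι j) (g := 0) (b := 0) (c := p j) (fun y hy => by
        have := congrFun (hτ y hy).1 j
        simpa [evCoord] using this) v hvτ)
    rw [← C.param_snd_fst x₀ ℓ x, hℓv, h0]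
  subst hx
  have hvert : ∀ j, j ∈ η ∨ j ∈ κ → proj (Δ j) = 0 := fun j hj =>
    hj.elim (fun h => (hη j h).1) (fun h => (hκ j h).1)
  have htang : ∀ (ℓ' : C.graph.edgeSet → ℝ) {j : ι}, proj (Δ j) = 0 →
      tangencyEv j (C.param x₀ (ℓ', 0)) = proj (C.displacement x₀ ℓ' (C.attach j)) := by
    intro ℓ' j hj
    rw [tangencyEv_apply, C.param_snd_snd x₀ _ _ hj, zero_add]
  have hstep : ∀ y ∈ σ, ∀ t : ℝ, 0 ≤ t → ∀ e, ∀ ℓ' x', y = C.param x₀ (ℓ', x') →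
      0 ≤ ℓ' e + t * ℓ e := by
    intro y hy t ht e ℓ' x' hy'
    obtain ⟨ℓt, xt, hℓt, h⟩ := hparam _ (hτρ (hστ (hv y hy t ht)))
    rw [hy', ← hℓv, ← map_smul, ← map_add] at h
    have := congrFun (congrArg Prod.fst (hinj h)) e
    simp only [Prod.smul_mk, Prod.mk_add_mk, Pi.add_apply, Pi.smul_apply, smul_eq_mul] at this
    rw [this]
    exact hℓt e
  have hℓ0 : ∀ e, 0 ≤ ℓ e := by
    intro e
    obtain ⟨y, hy⟩ := hσne
    obtain ⟨ℓ', x', hℓ', hy'⟩ := hparam y (hτρ (hστ hy))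
    by_contra! hneg
    -- Following the ray for this time would bring the length of `e` down to `-1`.
    have := hstep y hy ((ℓ' e + 1) / (-ℓ e))
      (div_nonneg (by linarith [hℓ' e]) (by linarith)) e ℓ' x' hy'
    have h1 : (ℓ' e + 1) / (-ℓ e) * (-ℓ e) = ℓ' e + 1 := div_mul_cancel₀ _ (by linarith)
    linarith
  -- On `τ` the cross-ratios in `crs` vanish, so all contributing edges have length zero there.
  -- Transversality puts every `ℓ'` that preserves these cross-ratios into the span of `τ`.
  have hindep : ∀ ℓ' : C.graph.edgeSet → ℝ,
      (∀ c ∈ crs, ∑ e : C.graph.edgeSet, ℓ' e * crossCoeff (C.Split e) c = 0) →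
      ∀ e : C.graph.edgeSet, (∃ c ∈ crs, crossCoeff (C.Split e) c ≠ 0) → ℓ' e = 0 := by
    intro ℓ' h e ⟨c, hc, hne⟩
    have hmem : C.param x₀ (ℓ', 0) ∈ vectorSpan ℝ τ := by
      refine hspanτ _ (hspanρ ▸ LinearMap.mem_range_self _ _) (C.param_snd_fst x₀ _ _)
        fun c hc => ?_
      rw [C.param_fst]
      exact h c hc
    have hle : vectorSpan ℝ τ ≤ (LinearMap.ker
        (LinearMap.proj e ∘ₗ LinearMap.fst ℝ (C.graph.edgeSet → ℝ) (Fin 3 → ℝ))).map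
          (C.param x₀) := by
      have hpt : ∀ y ∈ τ, ∃ z : (C.graph.edgeSet → ℝ) × (Fin 3 → ℝ), z.1 e = 0 ∧
          C.param x₀ z = y := by
        intro y hy
        obtain ⟨ℓy, xy, hℓy, hy'⟩ := hparam y (hτρ hy)
        have h0 := (hτ y hy).2 c hc
        rw [hy', C.param_fst] at h0
        exact ⟨(ℓy, xy), (mul_eq_zero.1 (C.mul_crossCoeff_eq_zero hℓy h0 e)).resolve_right hne,
          hy'.symm⟩
      rw [vectorSpan_def, Submodule.span_le]
      rintro _ ⟨y, hy, y', hy', rfl⟩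
      obtain ⟨z, hz, rfl⟩ := hpt y hy
      obtain ⟨z', hz', rfl⟩ := hpt y' hy'
      exact ⟨z - z', by simp [hz, hz'], map_sub _ _ _⟩
    obtain ⟨z, hz, hz'⟩ := hle hmem
    rw [hinj hz'] at hz
    exact hz
  have hvcr : ∀ c ∈ crs, ∑ e : C.graph.edgeSet, ℓ e * crossCoeff (C.Split e) c = 0 := by
    intro c hc
    rw [← C.param_fst x₀ ℓ 0, hℓv]
    exact linear_eq_on_vectorSpan (f := crossCoord c) (g := 0) (b := 0) (c := 0) (fun y hy => by
      have := (hτ y hy).2 c hc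
      simpa [crossCoord] using this) v hvτ
  set Q : Set (Sym2 (Fin C.n)) := {e | ∃ c ∈ crs, crossCoeff (C.Split e) c ≠ 0}
  have hv0 : v ≠ 0 := by
    rintro rfl
    exact hqv (map_zero _)
  -- Transversality puts such an `ℓ'` into the span of `σ`, which is the line through `v`.
  have huniq : ∀ ℓ' : C.graph.edgeSet → ℝ, (∀ e : C.graph.edgeSet, (e : Sym2 (Fin C.n)) ∈ Q →
      ℓ' e = 0) → (∀ j, j ∈ η ∨ j ∈ κ → ∃ r : ℝ, proj (C.displacement x₀ ℓ' (C.attach j)) =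
        r • proj (C.displacement x₀ ℓ (C.attach j))) → ∃ μ : ℝ, ℓ' = μ • ℓ := by
    intro ℓ' hQ' hJ
    have hmem : C.param x₀ (ℓ', 0) ∈ vectorSpan ℝ σ := by
      refine hspanσ v hvσ _ (hspanτ _ (hspanρ ▸ LinearMap.mem_range_self _ _)
        (C.param_snd_fst x₀ _ _) fun c hc => ?_) fun j hj => ?_
      · rw [C.param_fst]
        refine Finset.sum_eq_zero fun e _ => ?_
        by_cases he : crossCoeff (C.Split e) c = 0
        · rw [he, mul_zero]
        · rw [hQ' e ⟨c, hc, he⟩, zero_mul]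
      · rw [← hℓv, htang _ (hvert j hj), htang _ (hvert j hj)]
        exact hJ j hj
    have hfin : Module.finrank ℝ (vectorSpan ℝ σ) = 1 :=
      ((TropicalCycle.mem_facets.1 hσ).2).trans hdim
    obtain ⟨μ, hμ⟩ := exists_smul_eq_of_finrank_eq_one hfin
      (x := ⟨v, hvσ⟩) (fun h => hv0 (congrArg Subtype.val h)) ⟨_, hmem⟩
    have hμ : μ • v = C.param x₀ (ℓ', 0) := congrArg Subtype.val hμ
    rw [← hℓv, ← map_smul] at hμ
    exact ⟨μ, (congrArg Prod.fst (hinj hμ)).symm⟩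
  set w : Fin C.n → Fin 2 → ℝ := fun a => proj (C.displacement x₀ ℓ a)
  have hw₀ : w (C.attach x₀) = 0 := by
    exact C.proj_displacement_root x₀ ℓ
  have hwq : w (C.attach q) = tangencyEv q v := by rw [← hℓv, htang _ hq.1]
  have hwj : ∀ j, j ∈ η ∨ j ∈ κ → w (C.attach j) = tangencyEv j v := fun j hj => by
    rw [← hℓv, htang _ (hvert j hj)]
  set cs : Sym2 (Fin C.n) → ℝ := fun e => if h : e ∈ C.graph.edgeSet then ℓ ⟨e, h⟩ else 0
  have hcs' : ∀ e (h : e ∈ C.graph.edgeSet), cs e = ℓ ⟨e, h⟩ := fun e h => dif_pos h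
  have hray : RigidRay C.toMarkedCurve (fun a b => proj (C.slope a b)) (fun i => proj (Δ i)) w cs Q
      {j | j = x₀ ∨ j ∈ η ∨ j ∈ κ} := by
    refine C.rigidRay (Or.inl rfl) htri hstd hcs' hℓ0 (fun j hj => ?_)
      (fun e he => hindep ℓ hvcr e he) (fun i b hi hb hmem => ?_) (fun j hj hne => ?_)
      (fun ℓ' h1 h2 => huniq ℓ' h1 fun j hj => h2 j (Or.inr hj))
      ⟨C.attach q, fun h => hqv (hwq ▸ h)⟩
    · rcases hj with rfl | hj
      · rw [hx₀]; rfl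
      · exact hvert j hj
    · obtain ⟨c, hc, hne⟩ := hmem
      refine hne (C.crossCoeff_eq_zero_of_end (htri _) (fun c hc m hm => hi ?_) hindep hb hc)
      rcases hcrs c hc m with h | h
      · rw [← hm, h, hx₀]; rfl
      · rw [← hm]; exact h.1
    · change w (C.attach j) ≠ 0 at hne
      change ∃ u ∈ standardDirections, ∃ t : ℝ, 0 < t ∧ w (C.attach j) = t • castVec u
      rcases hj with rfl | hj
      · exact absurd hw₀ hne
      · rw [hwj j hj] at hne ⊢
        rcases hj with hj | hj
        · exact absurd (hηv j hj v hvσ) hne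
        · exact hκv j hj v hv hne
  obtain ⟨E, b, hEstd, hEq, hqb, hends, hnb, hpos, hwE⟩ :=
    hray.exists_end hw₀ (by rw [hwq]; exact hqv) hq.1
  have hsep : ∀ i, i ≠ q → i ≠ E → C.Split s(C.attach q, b) q i := by
    intro i hiq hiE
    have hne : C.attach q ≠ C.attach i := fun h => (hends i h.symm).elim hiE hiq
    obtain ⟨x, hx, hs⟩ := exists_adj_separates C.isTree hne
    rwa [hnb x hx] at hs
  refine ⟨E, hEstd, ⟨_, hpos, hwq ▸ hwE⟩, ?_, fun y hy c hc0 hc1 => ?_⟩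
  · obtain ⟨a, a', haa, ha, ha'⟩ := C.exists_two_labels hqb
    have key : ∀ a, Separates C.graph s(C.attach q, b) (C.attach q) (C.attach a) →
        a ≠ q ∧ a ≠ E := by
      intro a ha
      constructor
      · rintro rfl
        exact not_separates_self _ _ ha
      · rintro rfl
        rw [hEq] at ha
        exact not_separates_self _ _ ha
    exact ⟨a, a', (key a ha).1, (key a ha).2, (key a' ha').1, (key a' ha').2, haa⟩
  · have hyσ := intrinsicInterior_subset hy
    obtain ⟨ℓy, xy, hℓy, hy'⟩ := hparam y (hτρ (hστ hyσ))
    let ε : C.graph.edgeSet := ⟨s(C.attach q, b), C.graph.mem_edgeSet.2 hqb⟩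
    rw [hcs' _ (C.graph.mem_edgeSet.2 hqb)] at hpos
    -- From a relative interior point one can still move a little in direction `-v`, which shortens
    -- `ε` while its length stays nonnegative.
    have hεpos : 0 < ℓy ε := by
      obtain ⟨δ, hδ, hm⟩ := exists_add_smul_mem_of_mem_intrinsicInterior hy
        (Submodule.neg_mem _ hvσ)
      obtain ⟨ℓz, xz, hℓz, hz⟩ := hparam _ (hτρ (hστ hm))
      rw [hy', ← hℓv, ← map_neg, ← map_smul, ← map_add] at hz
      have := congrFun (congrArg Prod.fst (hinj hz)) ε
      simp only [Prod.smul_mk, Prod.neg_mk, Prod.mk_add_mk, Pi.add_apply, Pi.smul_apply,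
        Pi.neg_apply, smul_eq_mul] at this
      have h1 := hℓz ε
      have h2 : 0 < δ * ℓ ε := mul_pos hδ hpos
      linarith
    have hne : ∀ m n : Fin 4, m ≠ n → c m ≠ c n := fun m n h h' => h (c.injective h')
    have hcc : 0 < crossCoeff (C.Split ε) c := by
      refine C.crossCoeff_pos_iff.2 ⟨?_, ?_, ?_⟩
      · rw [hc0, hc1, MarkedCurve.Split, hEq]
        exact not_separates_self _ _
      · rw [hc0]
        exact hsep _ (hc0 ▸ hne 2 0 (by decide)) (hc1 ▸ hne 2 1 (by decide))
      · rw [hc0]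
        exact hsep _ (hc0 ▸ hne 3 0 (by decide)) (hc1 ▸ hne 3 1 (by decide))
    rw [hy', C.param_fst]
    exact Finset.sum_pos' (fun e _ => mul_nonneg (hℓy e) (C.not_crossCoeff_neg hcc))
      ⟨ε, Finset.mem_univ _, mul_pos hεpos hcc⟩

/-- A recession direction of a facet of the push-forward of a one-dimensional cycle is the image of
a recession direction of a facet of nonzero weight. -/
theorem IsPushforward.exists_recession {q : ι} {Z : TropicalCycle planeLattice}
    (hZ : IsPushforward (tangencyEv q) Y Z) (hdim : Y.dim = 1) {v : Fin 2 → ℝ}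
    (hv : IsRecessionEnd Z v) :
    ∃ σ ∈ Y.facets, Y.weight σ ≠ 0 ∧ ∃ v' ∈ recessionCone σ, tangencyEv q v' = v := by
  classical
  obtain ⟨hv0, σ', hσ', hw, hrec⟩ := hv
  rw [hZ.2.2 σ' hσ'] at hw
  obtain ⟨σ, hσ, hwσ⟩ := Finset.exists_ne_zero_of_sum_ne_zero hw
  obtain ⟨hσY, himg⟩ := Finset.mem_filter.1 hσ
  refine ⟨σ, hσY, left_ne_zero_of_mul hwσ, ?_⟩
  have hσne' := Z.nonempty σ' (TropicalCycle.mem_facets.1 hσ').1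
  have hvspan := recessionCone_subset_vectorSpan hσne' hrec
  have hmap : vectorSpan ℝ σ' = (vectorSpan ℝ σ).map (tangencyEv q) := by
    rw [← himg]
    exact ((tangencyEv q).toAffineMap.map_vectorSpan (s := σ)).symm
  rw [hmap] at hvspan
  obtain ⟨v', hv', hfv⟩ := hvspan
  refine ⟨v', fun x hx t ht => ?_, hfv⟩
  have hfin : Module.finrank ℝ (vectorSpan ℝ σ) = 1 :=
    ((TropicalCycle.mem_facets.1 hσY).2).trans hdim
  have hv'0 : v' ≠ 0 := by
    rintro rfl
    exact hv0 (by rw [← hfv, map_zero])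
  have hmem := hrec (tangencyEv q x) (himg ▸ Set.mem_image_of_mem _ hx) t ht
  rw [← himg] at hmem
  obtain ⟨z, hz, hfz⟩ := hmem
  -- The preimage `z` of the point on the image ray differs from `x` by a multiple of `v'`;
  -- comparing images shows that the factor is `t`.
  obtain ⟨μ, hμ⟩ := exists_smul_eq_of_finrank_eq_one hfin
    (x := ⟨v', hv'⟩) (fun h => hv'0 (congrArg Subtype.val h)) ⟨z - x, vsub_mem_vectorSpan ℝ hz hx⟩
  have hμ : μ • v' = z - x := congrArg Subtype.val hμ
  have hμt : μ • v = t • v := by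
    rw [← hfv, ← map_smul, hμ, map_sub, hfz, add_sub_cancel_left, hfv]
  have : μ = t := smul_left_injective ℝ hv0 hμt
  rw [← this, hμ, add_sub_cancel]
  exact hz

end FloorCycle

end TropicalFloor

/-! ### The two claims -/

open TropicalFloor in
theorem mainTheorem8 {ι : Type*} [Fintype ι] [DecidableEq ι]
    -- the degree of the floor: the end `x₀` is contracted, the other ends form `Δ³_s(α, β)`
    (s : ℕ) (α β : ℕ+ →₀ ℕ)
    (hαβ : (s : ℤ) - α.sum (fun w m => ((w : ℕ) : ℤ) * m)
      + β.sum (fun w m => ((w : ℕ) : ℤ) * m) = 0)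
    (Δ : ι → Fin 3 → ℤ) (x₀ : ι) (hx₀ : Δ x₀ = 0)
    (hΔ : (Finset.univ.erase x₀).val.map Δ = floorDegree s α β)
    -- the point, tangency and degenerated cross-ratio conditions
    (p : Fin 3 → ℝ) (η κ : Finset ι) (hηκ : Disjoint η κ)
    (hη : ∀ f ∈ η, IsVerticalEnd Δ f) (hκ : ∀ k ∈ κ, IsVerticalEnd Δ k)
    (P : ι → Fin 2 → ℝ) (L : ι → PlaneCurve)
    (crs : List (Fin 4 ↪ ι))
    (hcrs : ∀ c ∈ crs, ∀ j, c j = x₀ ∨ IsVerticalEnd Δ (c j))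
    (q : ι) (hq : IsVerticalEnd Δ q)
    (Y : TropicalCycle (moduliLattice Δ x₀))
    (hY : IsFloorCycle Δ x₀ p η κ P L crs Y) (hdim : Y.dim = 1)
    (Z : TropicalCycle planeLattice) (hZ : IsPushforward (tangencyEv q) Y Z) :
    (∀ v : Fin 2 → ℝ, IsRecessionEnd Z v →
      ∃ u ∈ standardDirections, ∃ t : ℝ, 0 < t ∧ v = t • (fun j => (u j : ℝ))) ∧
    (∀ σ ∈ Y.facets, Y.weight σ ≠ 0 →
      (∃ v ∈ recessionCone σ, IsRecessionEnd Z (tangencyEv q v)) →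
      ∀ C : StableMap Δ, C.toPoint x₀ ∈ intrinsicInterior ℝ σ →
        C.valence (C.attach q) = 3 ∧
        ∃ E, E ≠ q ∧ C.attach E = C.attach q ∧ proj (Δ E) ∈ standardDirections) := by
  have hstd : ∀ i, proj (Δ i) = 0 ∨ proj (Δ i) ∈ standardDirections := by
    intro i
    by_cases hi : i = x₀
    · left
      rw [hi, hx₀]
      rfl
    · refine proj_mem_of_mem_floorDegree (s := s) (α := α) (β := β) ?_
      rw [← hΔ]
      exact Multiset.mem_map_of_mem Δ (Finset.mem_erase.2 ⟨hi, Finset.mem_univ i⟩)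
  refine ⟨fun v hv => ?_, fun σ hσ hw ⟨v, hv, hend⟩ C hC => ?_⟩
  · obtain ⟨σ, hσ, hw, v', hv', rfl⟩ := hZ.exists_recession hdim hv
    obtain ⟨E, hE, ⟨t, ht, hvt⟩, -⟩ :=
      hY.exists_growing_edge hx₀ hstd hη hκ hcrs hq hdim hσ hw hv' hv.1
    exact ⟨_, hE, t, ht, hvt⟩
  -- The given stable map need not have the 3-valent type behind `exists_growing_edge`, so its
  -- vertex at `q` is read off from the cross-ratio coordinates of its point.
  · obtain ⟨E, hE, -, ⟨a, b, haq, haE, hbq, hbE, hab⟩, hpos⟩ :=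
      hY.exists_growing_edge hx₀ hstd hη hκ hcrs hq hdim hσ hw hv hend.1
    have hEq : E ≠ q := by
      rintro rfl
      rw [hq.1] at hE
      simp only [standardDirections, Set.mem_insert_iff, Set.mem_singleton_iff] at hE
      rcases hE with h | h | h
      · simpa using congrFun h 0
      · simpa using congrFun h 0
      · simpa using congrFun h 1
    obtain ⟨hval, hatt⟩ := C.valence_eq_three_of_crossRatio_pos hEq.symm haq haE hbq hbE hab
      (fun c h0 h1 => hpos _ hC c h0 h1)
    exact ⟨hval, E, hEq, hatt, hE⟩
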